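/- **Setting.** A concept class $\mathcal C=\{\mathcal C_d\}_{d\in\mathbb N}$ consists of domains $X_d$ of binary strings of length at most $d$, sets $\mathcal C_d$ of concepts $c:X_d\to\{0,1\}$, and a scheme that represents concepts by binary strings; $\mathrm{size}(c)$ is the length of the shortest representation of $c$. For a distribution $\mathcal X$ on $X_d$ and a target $c$, $\mathrm{err}(h)=\Pr_{x\sim\mathcal X}[h(x)\ne c(x)]$. "Polynomially bounded" means bounded by a polynomial in $d,1/\epsilon,1/\alpha,\log(1/\beta)$. *Private learning.* $\mathcal C$ is privately PAC learnable if there is a randomized algorithm $\mathcal A$ that takes $\epsilon>0$, $\alpha,\beta\in(0,1/2)$ and a database $z\in(X_d\times\{0,1\})^n$ with $n$ polynomial in $d,1/\epsilon,1/\alpha,\log(1/\beta)$, and outputs a hypothesis $h:X_d\to\{0,1\}$, such that (a) $\mathcal A(\epsilon,\alpha,\beta,\cdot)$ is $\epsilon$-differentially private: $\Pr[\mathcal A(z)\in S]\le e^{\epsilon}\Pr[\mathcal A(z')\in S]$ for every set $S$ of outputs and all $z,z'$ that differ in exactly one entry; (b) for all $d$, all $c\in\mathcal C_d$ and all distributions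 $\mathcal X$ on $X_d$, if $z_i=(x_i,c(x_i))$ with $x_i$ drawn i.i.d. from $\mathcal X$, then $\Pr[\mathrm{err}(h)\le\alpha]\ge1-\beta$. *Local learning.* An $\epsilon$-local randomizer is a randomized map $R$ into a discrete set with $\Pr[R(u)=w]\le e^{\epsilon}\Pr[R(u')=w]$ for all $u,u',w$. A randomized, possibly interactive algorithm is $\epsilon$-local if it accesses $z$ only by obtaining values $R(z_i)$, where $i$ and $R$ may depend on earlier answers, and if in every execution, for each $i$, the randomizers applied to $z_i$ are $\epsilon_1$-, $\dots$, $\epsilon_k$-local with $\epsilon_1+\dots+\epsilon_k\le\epsilon$. $\mathcal C$ is locally learnable if (b) holds for some algorithm, with $n$ as above, that is $\epsilon$-local for every $\epsilon>0$ and obtains at most $\mathrm{poly}(d,\mathrm{size}(c),1/\epsilon,1/\alpha,\log(1/\beta))$ such values. *Efficiency.* $\mathcal C$ is efficiently privately PAC learnable if moreover $\mathcal A$ is a program that tosses fair coins, runs in polynomially bounded time, and outputs strings that represent hypotheses and can be evaluated on $x\in X_d$ in polynomial time. $\mathcal C$ is efficiently locally learnable if it has a local learner of this kind for which also the time to evaluate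 each randomizer that it uses is polynomially bounded. Programs receive $d,\lceil1/\epsilon\rceil,\lceil1/\alpha\rceil,\lceil\log_2(1/\beta)\rceil$ in unary. $\mathsf{PARITY}$ is the class of functions $c_r(x)=\sum_i r_ix_i \bmod 2$ on $X_d=\{0,1\}^d$, represented by $r\in\{0,1\}^d$. **Statement.** 1. The locally learnable concept classes form a strict subset of the privately PAC learnable concept classes. 2. The efficiently locally learnable concept classes form a strict subset of the efficiently privately PAC learnable concept classes. 3. $\mathsf{PARITY}$ witnesses both separations: it is efficiently privately PAC learnable (in particular privately PAC learnable), but it is not locally learnable, even without computational restrictions (in particular not efficiently locally learnable). -/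

import Mathlib

/-! Private PAC learning, local learning, and their polynomial-time versions. -/

namespace PrivateLearning

/-! ### Concept classes -/

/-- A concept class, as an ensemble indexed by `d`. The examples in `X_d` are binary strings of
length at most `d`, labels are bits, and the class comes with a representation scheme: `rep d s` is
the concept represented by the string `s` (`none` if `s` represents no concept). -/
structure ConceptClass where
  /-- the domain `X_d` -/
  domain : ℕ → Set (List Bool)
  domain_length : ∀ d, ∀ x ∈ domain d, x.length ≤ d
  /-- the representation scheme of the concepts `X_d → {0,1}` -/
  rep : (d : ℕ) → List Bool → Option (domain d → Bool)

namespace ConceptClass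

/-- The class `C_d`: all the concepts that have a representation. -/
def concepts (C : ConceptClass) (d : ℕ) : Set (C.domain d → Bool) :=
  {c | ∃ s, C.rep d s = some c}

/-- `size(c)`: the length of the shortest representation of `c`. -/
noncomputable def size (C : ConceptClass) (d : ℕ) (c : C.domain d → Bool) : ℕ :=
  sInf {k | ∃ s, C.rep d s = some c ∧ s.length = k}

/-- Labeled examples, i.e. the possible entries of a database. -/
abbrev Example (C : ConceptClass) (d : ℕ) : Type := C.domain d × Bool

end ConceptClass

/-- The inner product modulo 2 of two bit strings. -/
def parityBit (r x : List Bool) : Bool := (List.zipWith and r x).foldr xor false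

/-- `PARITY`: the concepts `c_r(x) = r ⊙ x` on `{0,1}^d`, represented by `r ∈ {0,1}^d`. -/
def PARITY : ConceptClass where
  domain d := {x | x.length = d}
  domain_length _ _ hx := le_of_eq hx
  rep d r := if r.length = d then some (fun x => parityBit r x.1) else none

/-! ### Parameters and polynomial bounds -/

/-- The parameters `d, 1/ε, 1/α, log₂(1/β)`, the last three rounded up to natural numbers. -/
abbrev Params : Type := ℕ × ℕ × ℕ × ℕ

/-- The rounded parameters that belong to `d, ε, α, β`. -/
noncomputable def params (d : ℕ) (ε α β : ℝ) : Params :=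
  (d, ⌈1 / ε⌉₊, ⌈1 / α⌉₊, ⌈Real.logb 2 (1 / β)⌉₊)

/-- The value of a polynomial at given parameters. -/
noncomputable def bound (p : MvPolynomial (Fin 4) ℕ) (k : Params) : ℕ :=
  MvPolynomial.eval ![k.1, k.2.1, k.2.2.1, k.2.2.2] p

/-- The value of a polynomial at given parameters and a given concept size. -/
noncomputable def sizeBound (p : MvPolynomial (Fin 5) ℕ) (k : Params) (s : ℕ) : ℕ :=
  MvPolynomial.eval ![k.1, k.2.1, k.2.2.1, k.2.2.2, s] p

/-! ### Differential privacy -/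

/-- Databases that differ in exactly one entry. -/
def Neighbors {D : Type} {n : ℕ} (z z' : Fin n → D) : Prop := ∃! i, z i ≠ z' i

/-- `ε`-differential privacy of a randomized algorithm on databases with `n` entries. -/
def DifferentiallyPrivate {D O : Type} {n : ℕ} (ε : ℝ) (A : (Fin n → D) → PMF O) : Prop :=
  ∀ z z', Neighbors z z' → ∀ S : Set O,
    (A z).toOuterMeasure S ≤ ENNReal.ofReal (Real.exp ε) * (A z').toOuterMeasure S

/-! ### PAC learning -/

/-- `n` independent draws from `μ`. -/
noncomputable def iid {D : Type} (μ : PMF D) : (n : ℕ) → PMF (Fin n → D)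
  | 0 => PMF.pure Fin.elim0
  | n + 1 => μ.bind fun x => (iid μ n).map fun v => Fin.cons x v

/-- The misclassification error of `h` with respect to the target `c` and the distribution `μ`. -/
noncomputable def err {X : Type} (μ : PMF X) (c h : X → Bool) : ENNReal :=
  μ.toOuterMeasure {x | h x ≠ c x}

/-- On `n` examples drawn independently from `μ` and labeled by `c`, the algorithm `A` outputs with
probability at least `1 - β` a hypothesis of error at most `α`. -/
def PACSucceeds {X : Type} {n : ℕ} (A : (Fin n → X × Bool) → PMF (X → Bool))
    (c : X → Bool) (μ : PMF X) (α β : ℝ) : Prop :=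
  1 - ENNReal.ofReal β ≤
    ((iid (μ.map fun x => (x, c x)) n).bind A).toOuterMeasure {h | err μ c h ≤ ENNReal.ofReal α}

/-- `C` is (inefficiently) privately PAC learnable: some algorithm `A`, which takes a database of
`n = poly(d, 1/ε, 1/α, log(1/β))` labeled examples, is `ε`-differentially private and PAC learns
`C`. The hypothesis class consists of all functions `X_d → {0,1}`. -/
def PrivatelyPACLearnable (C : ConceptClass) : Prop :=
  ∃ (p : MvPolynomial (Fin 4) ℕ)
    (A : (d : ℕ) → (ε α β : ℝ) →
      (Fin (bound p (params d ε α β)) → C.Example d) → PMF (C.domain d → Bool)),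
    ∀ d : ℕ, ∀ ε > 0, ∀ α ∈ Set.Ioo (0 : ℝ) (1 / 2), ∀ β ∈ Set.Ioo (0 : ℝ) (1 / 2),
      DifferentiallyPrivate ε (A d ε α β) ∧
      ∀ c ∈ C.concepts d, ∀ μ : PMF (C.domain d), PACSucceeds (A d ε α β) c μ α β

/-! ### Local algorithms -/

/-- An `ε`-local randomizer `D → W`. -/
def LocalRandomizer {D W : Type} (ε : ℝ) (R : D → PMF W) : Prop :=
  ∀ u u' w, R u w ≤ ENNReal.ofReal (Real.exp ε) * R u' w

/-- A randomized (interactive) algorithm that accesses a database in `D^n` only by applying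
randomizers to single entries: it stops with an output, makes a random choice of its own, or asks
for the value of a randomizer `R` at entry `i` and continues depending on the answer. -/
inductive LocalProtocol (D : Type) (n : ℕ) (O : Type) : Type 1
  | output (o : O) : LocalProtocol D n O
  | toss {ι : Type} (ν : PMF ι) (next : ι → LocalProtocol D n O) : LocalProtocol D n O
  | query (i : Fin n) {W : Type} (R : D → PMF W) (next : W → LocalProtocol D n O) :
      LocalProtocol D n O

namespace LocalProtocol

variable {D O : Type} {n : ℕ}

/-- The output distribution on the database `z`. -/
noncomputable def run (z : Fin n → D) : LocalProtocol D n O → PMF O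
  | output o => PMF.pure o
  | toss ν next => ν.bind fun a => (next a).run z
  | query i R next => (R (z i)).bind fun w => (next w).run z

/-- In every execution, the randomizers applied to entry `i` are `ε₁`-, ..., `ε_k`-local randomizers
with `ε₁ + ... + ε_k ≤ b i`, for each `i`. -/
def WithinBudget : LocalProtocol D n O → (Fin n → ℝ) → Prop
  | output _, _ => True
  | toss ν next, b => ∀ a ∈ ν.support, (next a).WithinBudget b
  | query i R next, b => ∃ ε₁ : ℝ, 0 ≤ ε₁ ∧ ε₁ ≤ b i ∧ LocalRandomizer ε₁ R ∧
      ∀ w, (∃ u, w ∈ (R u).support) → (next w).WithinBudget (Function.update b i (b i - ε₁))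

/-- An `ε`-local algorithm. -/
def IsLocal (ε : ℝ) (P : LocalProtocol D n O) : Prop := P.WithinBudget fun _ => ε

/-- At most `k` randomizers are invoked in every execution. -/
def QueriesAtMost : LocalProtocol D n O → ℕ → Prop
  | output _, _ => True
  | toss ν next, k => ∀ a ∈ ν.support, (next a).QueriesAtMost k
  | query _ _ _, 0 => False
  | query _ R next, k + 1 => ∀ w, (∃ u, w ∈ (R u).support) → (next w).QueriesAtMost k

end LocalProtocol

/-- `C` is (inefficiently) locally learnable: it is PAC learnable from
`n = poly(d, 1/ε, 1/α, log(1/β))` examples by an `ε`-local algorithm that invokes at most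
`poly(d, size(c), 1/ε, 1/α, log(1/β))` randomizers. Differential privacy is not demanded separately:
it has to be derived from `ε`-locality by composition. -/
def LocallyLearnable (C : ConceptClass) : Prop :=
  ∃ (p : MvPolynomial (Fin 4) ℕ) (q : MvPolynomial (Fin 5) ℕ)
    (A : (d : ℕ) → (ε α β : ℝ) →
      LocalProtocol (C.Example d) (bound p (params d ε α β)) (C.domain d → Bool)),
    ∀ d : ℕ, ∀ ε > 0, ∀ α ∈ Set.Ioo (0 : ℝ) (1 / 2), ∀ β ∈ Set.Ioo (0 : ℝ) (1 / 2),
      (A d ε α β).IsLocal ε ∧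
      ∀ c ∈ C.concepts d,
        (A d ε α β).QueriesAtMost (sizeBound q (params d ε α β) (C.size d c)) ∧
        ∀ μ : PMF (C.domain d), PACSucceeds (fun z => (A d ε α β).run z) c μ α β

/-! ### A machine model with a step count

Programs manipulate binary trees (cons cells), as in pure LISP or in the WHILE language of N. Jones.
Every elementary operation handles a constant number of pointers and costs one step; a computation
of `t` steps allocates at most `t` new cells. Up to polynomials, time is the same as on Turing
machines. -/

/-- Binary trees: the data of the machine. -/
inductive Cell
  | nil : Cell
  | cons (a b : Cell) : Cell

namespace Cell

/-- The first component (`nil` for `nil`). -/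
def hd : Cell → Cell
  | nil => nil
  | cons a _ => a

/-- The second component (`nil` for `nil`). -/
def tl : Cell → Cell
  | nil => nil
  | cons _ b => b

/-- The number of nodes. -/
def size : Cell → ℕ
  | nil => 1
  | cons a b => a.size + b.size + 1

end Cell

/-- Programs. -/
inductive Code
  | id : Code
  | nil : Code
  | hd : Code
  | tl : Code
  | pair (f g : Code) : Code
  | comp (f g : Code) : Code
  | ite (c f g : Code) : Code
  | while (c f : Code) : Code

/-- `Runs M x y t`: on input `x`, program `M` halts with result `y` after exactly `t` steps. -/
inductive Runs : Code → Cell → Cell → ℕ → Prop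
  | id (x : Cell) : Runs Code.id x x 1
  | nil (x : Cell) : Runs Code.nil x Cell.nil 1
  | hd (x : Cell) : Runs Code.hd x x.hd 1
  | tl (x : Cell) : Runs Code.tl x x.tl 1
  | pair {f g : Code} {x y y' : Cell} {s t : ℕ} :
      Runs f x y s → Runs g x y' t → Runs (Code.pair f g) x (Cell.cons y y') (s + t + 1)
  | comp {f g : Code} {x y z : Cell} {s t : ℕ} :
      Runs g x y s → Runs f y z t → Runs (Code.comp f g) x z (s + t + 1)
  | ite_true {c f g : Code} {x v z : Cell} {s t : ℕ} :
      Runs c x v s → v ≠ Cell.nil → Runs f x z t → Runs (Code.ite c f g) x z (s + t + 1)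
  | ite_false {c f g : Code} {x z : Cell} {s t : ℕ} :
      Runs c x Cell.nil s → Runs g x z t → Runs (Code.ite c f g) x z (s + t + 1)
  | while_done {c f : Code} {x : Cell} {s : ℕ} :
      Runs c x Cell.nil s → Runs (Code.while c f) x x (s + 1)
  | while_step {c f : Code} {x v y z : Cell} {s t u : ℕ} :
      Runs c x v s → v ≠ Cell.nil → Runs f x y t → Runs (Code.while c f) y z u →
      Runs (Code.while c f) x z (s + t + u + 1)

/-- Types whose elements are written as data of the machine. -/
class Encoded (T : Type) where
  /-- the encoding -/
  enc : T → Cell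

/-- Bits. -/
instance instEncodedBool : Encoded Bool where
  enc b := if b then Cell.cons Cell.nil Cell.nil else Cell.nil

/-- The unary encoding of a natural number. -/
def encNat : ℕ → Cell
  | 0 => Cell.nil
  | k + 1 => Cell.cons Cell.nil (encNat k)

/-- Natural numbers, in unary. -/
instance instEncodedNat : Encoded ℕ where
  enc := encNat

/-- Pairs. -/
instance instEncodedProd {S T : Type} [Encoded S] [Encoded T] : Encoded (S × T) where
  enc a := Cell.cons (Encoded.enc a.1) (Encoded.enc a.2)

/-- Tagged unions. -/
instance instEncodedSum {S T : Type} [Encoded S] [Encoded T] : Encoded (S ⊕ T) where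
  enc
    | Sum.inl a => Cell.cons Cell.nil (Encoded.enc a)
    | Sum.inr b => Cell.cons (Cell.cons Cell.nil Cell.nil) (Encoded.enc b)

/-- Lists. -/
instance instEncodedList {T : Type} [Encoded T] : Encoded (List T) where
  enc l := l.foldr (fun a c => Cell.cons (Encoded.enc a) c) Cell.nil

/-- `f` is computed by a program in time polynomial in the size of the input. -/
def PolyTime {S T : Type} [Encoded S] [Encoded T] (f : S → T) : Prop :=
  ∃ (M : Code) (p : Polynomial ℕ), ∀ a : S,
    ∃ t ≤ p.eval (Encoded.enc a).size, Runs M (Encoded.enc a) (Encoded.enc (f a)) t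

/-! ### Efficient learning -/

/-- A string of `r` independent fair coin tosses. -/
noncomputable def coins (r : ℕ) : PMF (List Bool) :=
  (PMF.uniformOfFintype (Fin r → Bool)).map List.ofFn

/-- A labeled example as it is given to a program. -/
def exampleString {C : ConceptClass} {d : ℕ} (u : C.Example d) : List Bool × Bool := (u.1.1, u.2)

/-- The hypothesis on `X_d` represented by the string `s`, for an evaluation procedure `E`. -/
def hypothesis (C : ConceptClass) (d : ℕ) (E : List Bool × List Bool → Bool) (s : List Bool) :
    C.domain d → Bool :=
  fun x => E (s, x.1)

/-- The randomized algorithm given by a function `F` of the parameters, the database, and `r` coin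
tosses. -/
noncomputable def randomizedAlg {C : ConceptClass} {d n : ℕ}
    (F : Params × List (List Bool × Bool) × List Bool → List Bool) (k : Params) (r : ℕ)
    (z : Fin n → C.Example d) : PMF (List Bool) :=
  (coins r).map fun ω => F (k, List.ofFn fun i => exampleString (z i), ω)

/-- `C` is efficiently privately PAC learnable: a private PAC learner, which outputs representations
of hypotheses, runs in time polynomial in `d, 1/ε, 1/α, log(1/β)`, and hypotheses can be evaluated
in polynomial time. The parameters are given to the program in unary, rounded as in `params`. -/
def EfficientlyPrivatelyPACLearnable (C : ConceptClass) : Prop :=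
  ∃ (p r : MvPolynomial (Fin 4) ℕ)
    (F : Params × List (List Bool × Bool) × List Bool → List Bool)
    (E : List Bool × List Bool → Bool),
    PolyTime F ∧ PolyTime E ∧
    ∀ d : ℕ, ∀ ε > 0, ∀ α ∈ Set.Ioo (0 : ℝ) (1 / 2), ∀ β ∈ Set.Ioo (0 : ℝ) (1 / 2),
      let k := params d ε α β
      let A : (Fin (bound p k) → C.Example d) → PMF (List Bool) := randomizedAlg F k (bound r k)
      DifferentiallyPrivate ε A ∧
      ∀ c ∈ C.concepts d, ∀ μ : PMF (C.domain d),
        PACSucceeds (fun z => (A z).map (hypothesis C d E)) c μ α β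

/-- The local algorithm given by a next-action function `L` and an evaluation procedure `Q` for
randomizers. From the parameters, its own coin tosses `ω` and the answers so far, `L` computes
either the final output or the next query, consisting of an index and a description of a randomizer.
The described randomizer maps `u` to the first `l` bits of what `Q` computes from the parameters,
the description, `u` and `s` fresh coin tosses. The algorithm makes at most `T` queries; it stops
with the empty string when it attempts another one or when an index is out of range. -/
noncomputable def localAlgFrom {C : ConceptClass} {d n : ℕ}
    (L : Params × List Bool × List (List Bool) → (ℕ × List Bool) ⊕ List Bool)
    (Q : Params × List Bool × (List Bool × Bool) × List Bool → List Bool)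
    (k : Params) (s l : ℕ) (ω : List Bool) :
    (T : ℕ) → (answers : List (List Bool)) → LocalProtocol (C.Example d) n (List Bool)
  | 0, answers =>
    match L (k, ω, answers) with
    | Sum.inr h => LocalProtocol.output h
    | Sum.inl _ => LocalProtocol.output []
  | T + 1, answers =>
    match L (k, ω, answers) with
    | Sum.inr h => LocalProtocol.output h
    | Sum.inl (i, desc) =>
      if hi : i < n then
        LocalProtocol.query ⟨i, hi⟩
          (fun u => (coins s).map fun η => (Q (k, desc, exampleString u, η)).take l)
          (fun w => localAlgFrom L Q k s l ω T (answers ++ [w]))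
      else LocalProtocol.output []

/-- The same, with the `r` coin tosses of the algorithm. -/
noncomputable def localAlg {C : ConceptClass} {d n : ℕ}
    (L : Params × List Bool × List (List Bool) → (ℕ × List Bool) ⊕ List Bool)
    (Q : Params × List Bool × (List Bool × Bool) × List Bool → List Bool)
    (k : Params) (r s l T : ℕ) : LocalProtocol (C.Example d) n (List Bool) :=
  LocalProtocol.toss (coins r) fun ω => localAlgFrom L Q k s l ω T []

/-- `C` is efficiently locally learnable: a local learner, which outputs representations of
hypotheses, runs in time polynomial in `d, 1/ε, 1/α, log(1/β)`, so does the evaluation of the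
randomizers that it invokes, and hypotheses can be evaluated in polynomial time. The number of
queries, the numbers of coin tosses and the length of the answers are polynomially bounded. -/
def EfficientlyLocallyLearnable (C : ConceptClass) : Prop :=
  ∃ (p r s l T : MvPolynomial (Fin 4) ℕ)
    (L : Params × List Bool × List (List Bool) → (ℕ × List Bool) ⊕ List Bool)
    (Q : Params × List Bool × (List Bool × Bool) × List Bool → List Bool)
    (E : List Bool × List Bool → Bool),
    PolyTime L ∧ PolyTime Q ∧ PolyTime E ∧
    ∀ d : ℕ, ∀ ε > 0, ∀ α ∈ Set.Ioo (0 : ℝ) (1 / 2), ∀ β ∈ Set.Ioo (0 : ℝ) (1 / 2),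
      let k := params d ε α β
      let A : LocalProtocol (C.Example d) (bound p k) (List Bool) :=
        localAlg L Q k (bound r k) (bound s k) (bound l k) (bound T k)
      A.IsLocal ε ∧
      ∀ c ∈ C.concepts d, ∀ μ : PMF (C.domain d),
        PACSucceeds (fun z => (A.run z).map (hypothesis C d E)) c μ α β

end PrivateLearning

/-! The two inclusions: the privacy losses of the answers about an entry multiply along every
execution of a local algorithm, so the budget bounds the privacy loss of its output; and if the
algorithm is efficient, then one program can toss all the coins in advance and play the randomizers
itself.

`PARITY` is not locally learnable: let the examples be uniformly distributed. The characters
`(-1) ^ ⟨r, x⟩` are orthogonal, hence by Parseval the answer of a local randomizer has, for a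
typical target `c_r`, nearly the same probability as on an example with a random label; relatively,
the difference is on average `O(2 ^ (-d / 2))`. The same is true of all the answers obtained from
one entry together, because the likelihood of these answers, as a function of the entry, is governed
by the same budget. Therefore the `n` entries distinguish the targets only by `O(n * 2 ^ (-d / 2))`,
regardless of the number of queries. But two parities disagree on half of the points, so that a
hypothesis is accurate for at most one target, and `n` must be exponential in `d`.

`PARITY` is efficiently privately learnable: a uniformly random solution `r` of the linear equations
given by the examples generalizes well. One more equation halves the set of solutions or makes the
system inconsistent. If the algorithm also fails on purpose with probability `1/2`, then in both
cases the probability of an outcome changes at most by a factor of about `2`, and dropping all but a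
random fraction of about `ε` of the examples reduces this to `e ^ ε`. Repeated attempts on disjoint
parts of the database make a failure unlikely without more privacy loss. -/

namespace PrivateLearning

/-! ### Time and output size of programs -/

/-- The depth of a tree. Unlike the size, which `Code.pair` can double in one step by sharing, it
grows by at most one per step. -/
def Cell.depth : Cell → ℕ
  | Cell.nil => 0
  | Cell.cons a b => max a.depth b.depth + 1

theorem Cell.depth_lt_size (x : Cell) : x.depth < x.size := by
  induction x with
  | nil => simp [Cell.depth, Cell.size]
  | cons a b iha ihb => simp only [Cell.depth, Cell.size]; omega

theorem Cell.depth_hd_le (x : Cell) : x.hd.depth ≤ x.depth := by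
  cases x <;> simp only [Cell.hd, Cell.depth] <;> omega

theorem Cell.depth_tl_le (x : Cell) : x.tl.depth ≤ x.depth := by
  cases x <;> simp only [Cell.tl, Cell.depth] <;> omega

theorem Runs.depth_le {M : Code} {x y : Cell} {t : ℕ} (h : Runs M x y t) :
    y.depth ≤ x.depth + t := by
  induction h with
  | id x => omega
  | nil x => simp [Cell.depth]
  | hd x => have := x.depth_hd_le; omega
  | tl x => have := x.depth_tl_le; omega
  | pair _ _ ih₁ ih₂ => simp only [Cell.depth]; omega
  | comp _ _ ih₁ ih₂ => omega
  | ite_true _ _ _ _ ih => omega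
  | ite_false _ _ _ ih => omega
  | while_done _ _ => omega
  | while_step _ _ _ _ _ ih₁ ih₂ => omega

theorem polynomial_eval_mono {R : Type*} [Semiring R] [PartialOrder R] [IsOrderedRing R]
    [CanonicallyOrderedAdd R] (p : Polynomial R) {x y : R} (h : x ≤ y) : p.eval x ≤ p.eval y := by
  rw [Polynomial.eval_eq_sum, Polynomial.eval_eq_sum]
  exact Finset.sum_le_sum fun n _ =>
    mul_le_mul_of_nonneg_left (pow_le_pow_left₀ zero_le h n) zero_le

section Sizes

variable {S T : Type} [Encoded S] [Encoded T]

/-- The unit type; lists of units are unary numbers. -/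
instance instEncodedUnit : Encoded Unit where
  enc _ := Cell.nil

/-- Elements of a subtype, so that a program may be required to be correct on some inputs only. -/
instance instEncodedSubtype {p : S → Prop} : Encoded {a // p a} where
  enc a := Encoded.enc a.1

/-- The size of the encoding of `a`. -/
def encSize (a : T) : ℕ := (Encoded.enc a).size

theorem enc_prod (a : S × T) : Encoded.enc a = Cell.cons (Encoded.enc a.1) (Encoded.enc a.2) := rfl

theorem enc_list_cons (a : T) (l : List T) :
    Encoded.enc (a :: l) = Cell.cons (Encoded.enc a) (Encoded.enc l) := rfl

theorem enc_list_eq_nil {l : List T} : Encoded.enc l = Cell.nil ↔ l = [] := by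
  cases l with
  | nil => exact iff_of_true rfl rfl
  | cons a l => simp [enc_list_cons]

theorem enc_bool_eq_nil {b : Bool} : Encoded.enc b = Cell.nil ↔ b = false := by
  cases b <;> simp [Encoded.enc]

theorem enc_nat_eq_replicate (n : ℕ) : Encoded.enc n = Encoded.enc (List.replicate n ()) := by
  induction n with
  | zero => rfl
  | succ n ih => exact congrArg (Cell.cons Cell.nil) ih

theorem depth_enc_nat (n : ℕ) : (Encoded.enc n).depth = n := by
  induction n with
  | zero => rfl
  | succ n ih =>
    change max 0 (Encoded.enc n).depth + 1 = _
    omega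

@[simp] theorem encSize_prod (a : S × T) : encSize a = encSize a.1 + encSize a.2 + 1 := rfl

@[simp] theorem encSize_nil : encSize ([] : List T) = 1 := rfl

@[simp] theorem encSize_cons (a : T) (l : List T) :
    encSize (a :: l) = encSize a + encSize l + 1 := rfl

@[simp] theorem encSize_unit (a : Unit) : encSize a = 1 := rfl

theorem encSize_bool_le (b : Bool) : encSize b ≤ 3 := by cases b <;> decide

@[simp] theorem encSize_nat (n : ℕ) : encSize n = 2 * n + 1 := by
  induction n with
  | zero => rfl
  | succ n ih =>
    change 1 + encSize n + 1 = _
    omega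

theorem length_lt_encSize (l : List T) : l.length < encSize l := by
  induction l with
  | nil => simp
  | cons a l ih => simp only [List.length_cons, encSize_cons]; omega

theorem encSize_le_of_sublist {l l' : List T} (h : l.Sublist l') : encSize l ≤ encSize l' := by
  induction h with
  | slnil => rfl
  | cons a _ ih => simp only [encSize_cons]; omega
  | cons_cons a _ ih => simp only [encSize_cons]; omega

theorem encSize_le_of_mem {a : T} {l : List T} (h : a ∈ l) : encSize a ≤ encSize l := by
  have := encSize_le_of_sublist (List.singleton_sublist.2 h)
  simp only [encSize_cons, encSize_nil] at this
  omega

theorem encSize_list_le {l : List T} {K : ℕ} (h : ∀ a ∈ l, encSize a ≤ K) :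
    encSize l ≤ l.length * (K + 1) + 1 := by
  induction l with
  | nil => simp
  | cons a l ih =>
    have ha := h a (by simp)
    have hl := ih fun b hb => h b (by simp [hb])
    rw [encSize_cons, List.length_cons, add_one_mul]
    omega

theorem encSize_bits_le (l : List Bool) : encSize l ≤ 4 * l.length + 1 := by
  have := encSize_list_le fun b (_ : b ∈ l) => encSize_bool_le b
  omega

theorem encSize_append_add_one (l l' : List T) :
    encSize (l ++ l') + 1 = encSize l + encSize l' := by
  induction l with
  | nil => simp [add_comm]
  | cons a l ih => simp only [List.cons_append, encSize_cons]; omega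

theorem encSize_foldl_le {ι : Type*} {l : List ι} {step : T → ι → T} {K : ℕ}
    (hstep : ∀ b, ∀ u ∈ l, encSize (step b u) ≤ encSize b + K) (b : T) :
    encSize (l.foldl step b) ≤ encSize b + l.length * K := by
  induction l generalizing b with
  | nil => simp
  | cons u l ih =>
    have hfirst := hstep b u (by simp)
    have hrest := ih (fun b v hv => hstep b v (by simp [hv])) (step b u)
    rw [List.foldl_cons, List.length_cons, add_one_mul]
    omega

end Sizes

section DepthBounded

variable {S T : Type} [Encoded S] [Encoded T]

/-- Data types in which the size of an encoding is polynomially bounded by its depth. For these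
types the results of polynomial-time programs have polynomial size. -/
class DepthBounded (T : Type) [Encoded T] : Prop where
  exists_encSize_le : ∃ q : Polynomial ℕ, ∀ a : T, encSize a ≤ q.eval (Encoded.enc a).depth

instance : DepthBounded Bool := ⟨⟨3, fun b => by simpa using encSize_bool_le b⟩⟩

instance : DepthBounded Unit := ⟨⟨1, fun _ => by simp⟩⟩

instance : DepthBounded ℕ := ⟨⟨2 * Polynomial.X + 1, fun n => by simp [depth_enc_nat]⟩⟩

instance [DepthBounded S] [DepthBounded T] : DepthBounded (S × T) := by
  obtain ⟨q, hq⟩ := DepthBounded.exists_encSize_le (T := S)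
  obtain ⟨q', hq'⟩ := DepthBounded.exists_encSize_le (T := T)
  refine ⟨⟨q + q' + 1, fun a => ?_⟩⟩
  have h₁ := (hq a.1).trans (polynomial_eval_mono q (y := (Encoded.enc a).depth) (by
    simp only [enc_prod, Cell.depth]; omega))
  have h₂ := (hq' a.2).trans (polynomial_eval_mono q' (y := (Encoded.enc a).depth) (by
    simp only [enc_prod, Cell.depth]; omega))
  simp only [encSize_prod, Polynomial.eval_add, Polynomial.eval_one]
  omega

theorem depth_enc_le_of_mem {a : T} {l : List T} (h : a ∈ l) :
    (Encoded.enc a).depth ≤ (Encoded.enc l).depth := by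
  induction l with
  | nil => simp at h
  | cons b l ih =>
    rw [enc_list_cons, Cell.depth]
    rcases List.mem_cons.1 h with rfl | h
    · omega
    · have := ih h; omega

theorem length_le_depth_enc (l : List T) : l.length ≤ (Encoded.enc l).depth := by
  induction l with
  | nil => simp
  | cons b l ih => rw [enc_list_cons, Cell.depth, List.length_cons]; omega

instance [DepthBounded T] : DepthBounded (List T) := by
  obtain ⟨q, hq⟩ := DepthBounded.exists_encSize_le (T := T)
  refine ⟨⟨Polynomial.X * (q + 1) + 1, fun l => ?_⟩⟩
  have hsize : encSize l ≤ l.length * (q.eval (Encoded.enc l).depth + 1) + 1 :=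
    encSize_list_le fun a ha => (hq a).trans (polynomial_eval_mono q (depth_enc_le_of_mem ha))
  simp only [Polynomial.eval_add, Polynomial.eval_mul, Polynomial.eval_X, Polynomial.eval_one]
  exact hsize.trans (by gcongr; exact length_le_depth_enc l)

end DepthBounded

/-! ### Closure properties of polynomial time -/

/-- `g` is polynomially bounded in the size of the argument. -/
def PolyBounded {S : Type} [Encoded S] (g : S → ℕ) : Prop :=
  ∃ p : Polynomial ℕ, ∀ a, g a ≤ p.eval (encSize a)

namespace PolyBounded

variable {S T : Type} [Encoded S] [Encoded T] {f g : S → ℕ}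

theorem mono (hg : PolyBounded g) (h : ∀ a, f a ≤ g a) : PolyBounded f :=
  let ⟨p, hp⟩ := hg
  ⟨p, fun a => (h a).trans (hp a)⟩

theorem const (n : ℕ) : PolyBounded fun _ : S => n := ⟨Polynomial.C n, fun _ => by simp⟩

theorem size : PolyBounded fun a : S => encSize a := ⟨Polynomial.X, fun _ => by simp⟩

theorem add (hf : PolyBounded f) (hg : PolyBounded g) : PolyBounded fun a => f a + g a :=
  let ⟨p, hp⟩ := hf
  let ⟨q, hq⟩ := hg
  ⟨p + q, fun a => by simpa using add_le_add (hp a) (hq a)⟩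

theorem mul (hf : PolyBounded f) (hg : PolyBounded g) : PolyBounded fun a => f a * g a :=
  let ⟨p, hp⟩ := hf
  let ⟨q, hq⟩ := hg
  ⟨p * q, fun a => by simpa using Nat.mul_le_mul (hp a) (hq a)⟩

theorem eval (p : Polynomial ℕ) (hf : PolyBounded f) : PolyBounded fun a => p.eval (f a) :=
  let ⟨q, hq⟩ := hf
  ⟨p.comp q, fun a => by simpa using polynomial_eval_mono p (hq a)⟩

theorem comp {g : T → ℕ} {e : S → T} (hg : PolyBounded g)
    (he : PolyBounded fun a => encSize (e a)) : PolyBounded fun a => g (e a) :=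
  let ⟨q, hq⟩ := hg
  (he.eval q).mono fun a => hq (e a)

end PolyBounded

namespace PolyTime

variable {S T U V : Type} [Encoded S] [Encoded T] [Encoded U] [Encoded V]

theorem iff_exists_polyBounded {f : S → T} : PolyTime f ↔ ∃ (M : Code) (τ : S → ℕ),
    PolyBounded τ ∧ ∀ a, ∃ t ≤ τ a, Runs M (Encoded.enc a) (Encoded.enc (f a)) t := by
  constructor
  · rintro ⟨M, p, h⟩
    exact ⟨M, fun a => p.eval (encSize a), ⟨p, fun _ => le_rfl⟩, h⟩
  · rintro ⟨M, τ, ⟨p, hp⟩, h⟩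
    refine ⟨M, p, fun a => ?_⟩
    obtain ⟨t, ht, hr⟩ := h a
    exact ⟨t, ht.trans (hp a), hr⟩

theorem congr_enc {f : S → T} {g : S → U} (hf : PolyTime f)
    (h : ∀ a, Encoded.enc (g a) = Encoded.enc (f a)) : PolyTime g := by
  obtain ⟨M, p, hM⟩ := hf
  exact ⟨M, p, fun a => by rw [h]; exact hM a⟩

theorem congr {f g : S → T} (hf : PolyTime f) (h : ∀ a, g a = f a) : PolyTime g :=
  hf.congr_enc fun a => by rw [h]

theorem restrict {f : S → T} (hf : PolyTime f) (p : S → Prop) :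
    PolyTime fun a : {a // p a} => f a := by
  obtain ⟨M, q, hM⟩ := hf
  exact ⟨M, q, fun a => hM a⟩

theorem polyBounded_encSize [DepthBounded T] {f : S → T} (hf : PolyTime f) :
    PolyBounded fun a => encSize (f a) := by
  obtain ⟨M, τ, hτ, hM⟩ := iff_exists_polyBounded.1 hf
  obtain ⟨q, hq⟩ := DepthBounded.exists_encSize_le (T := T)
  refine ((PolyBounded.size.add hτ).eval q).mono fun a => ?_
  obtain ⟨t, ht, hr⟩ := hM a
  have hdepth : (Encoded.enc (f a)).depth ≤ encSize a + τ a :=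
    hr.depth_le.trans (add_le_add (Encoded.enc a).depth_lt_size.le ht)
  exact (hq (f a)).trans (polynomial_eval_mono q hdepth)

theorem comp_of_polyBounded {g : T → U} {f : S → T} (hg : PolyTime g) (hf : PolyTime f)
    (hb : PolyBounded fun a => encSize (f a)) : PolyTime fun a => g (f a) := by
  obtain ⟨M, σ, hσ, hM⟩ := iff_exists_polyBounded.1 hg
  obtain ⟨N, τ, hτ, hN⟩ := iff_exists_polyBounded.1 hf
  refine iff_exists_polyBounded.2 ⟨Code.comp M N, fun a => τ a + σ (f a) + 1,
    (hτ.add (hσ.comp hb)).add (.const 1), fun a => ?_⟩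
  obtain ⟨s, hs, hr⟩ := hN a
  obtain ⟨t, ht, hr'⟩ := hM (f a)
  exact ⟨s + t + 1, by dsimp only; omega, .comp hr hr'⟩

theorem comp [DepthBounded T] {g : T → U} {f : S → T} (hg : PolyTime g) (hf : PolyTime f) :
    PolyTime fun a => g (f a) :=
  hg.comp_of_polyBounded hf hf.polyBounded_encSize

theorem id : PolyTime fun a : S => a :=
  iff_exists_polyBounded.2 ⟨Code.id, fun _ => 1, .const 1, fun _ => ⟨1, le_rfl, .id _⟩⟩

/-- A program with constant result `c`. -/
def constCode : Cell → Code
  | Cell.nil => Code.nil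
  | Cell.cons a b => Code.pair (constCode a) (constCode b)

theorem runs_constCode (c x : Cell) : Runs (constCode c) x c c.size := by
  induction c with
  | nil => exact .nil x
  | cons a b iha ihb => exact .pair iha ihb

theorem const (b : T) : PolyTime fun _ : S => b :=
  iff_exists_polyBounded.2 ⟨constCode (Encoded.enc b), fun _ => _, .const _,
    fun _ => ⟨_, le_rfl, runs_constCode _ _⟩⟩

theorem pair {f : S → T} {g : S → U} (hf : PolyTime f) (hg : PolyTime g) :
    PolyTime fun a => (f a, g a) := by
  obtain ⟨M, σ, hσ, hM⟩ := iff_exists_polyBounded.1 hf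
  obtain ⟨N, τ, hτ, hN⟩ := iff_exists_polyBounded.1 hg
  refine iff_exists_polyBounded.2 ⟨Code.pair M N, fun a => σ a + τ a + 1,
    (hσ.add hτ).add (.const 1), fun a => ?_⟩
  obtain ⟨s, hs, hr⟩ := hM a
  obtain ⟨t, ht, hr'⟩ := hN a
  exact ⟨s + t + 1, by dsimp only; omega, .pair hr hr'⟩

theorem of_enc_eq_hd {f : S → T} {g : S → U} (hf : PolyTime f)
    (h : ∀ a, Encoded.enc (g a) = (Encoded.enc (f a)).hd) : PolyTime g := by
  obtain ⟨M, σ, hσ, hM⟩ := iff_exists_polyBounded.1 hf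
  refine iff_exists_polyBounded.2 ⟨Code.comp Code.hd M, fun a => σ a + 2, hσ.add (.const 2),
    fun a => ?_⟩
  obtain ⟨s, hs, hr⟩ := hM a
  exact ⟨s + 1 + 1, by dsimp only; omega, h a ▸ .comp hr (.hd _)⟩

theorem of_enc_eq_tl {f : S → T} {g : S → U} (hf : PolyTime f)
    (h : ∀ a, Encoded.enc (g a) = (Encoded.enc (f a)).tl) : PolyTime g := by
  obtain ⟨M, σ, hσ, hM⟩ := iff_exists_polyBounded.1 hf
  refine iff_exists_polyBounded.2 ⟨Code.comp Code.tl M, fun a => σ a + 2, hσ.add (.const 2),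
    fun a => ?_⟩
  obtain ⟨s, hs, hr⟩ := hM a
  exact ⟨s + 1 + 1, by dsimp only; omega, h a ▸ .comp hr (.tl _)⟩

theorem fst {f : S → T × U} (hf : PolyTime f) : PolyTime fun a => (f a).1 :=
  hf.of_enc_eq_hd fun _ => rfl

theorem snd {f : S → T × U} (hf : PolyTime f) : PolyTime fun a => (f a).2 :=
  hf.of_enc_eq_tl fun _ => rfl

theorem by_cases {v : S → V} {f : S → T} (hv : PolyTime v)
    (hf : PolyTime fun a : {a // Encoded.enc (v a) ≠ Cell.nil} => f a)
    (hf' : PolyTime fun a : {a // Encoded.enc (v a) = Cell.nil} => f a) : PolyTime f := by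
  obtain ⟨K, ρ, hρ, hK⟩ := iff_exists_polyBounded.1 hv
  obtain ⟨M, p, hM⟩ := hf
  obtain ⟨N, q, hN⟩ := hf'
  refine iff_exists_polyBounded.2 ⟨Code.ite K M N,
    fun a => ρ a + (p.eval (encSize a) + q.eval (encSize a)) + 1,
    (hρ.add ((PolyBounded.size.eval p).add (PolyBounded.size.eval q))).add (.const 1),
    fun a => ?_⟩
  obtain ⟨u, hu, hr⟩ := hK a
  by_cases h : Encoded.enc (v a) = Cell.nil
  · obtain ⟨t, ht, hr'⟩ := hN ⟨a, h⟩
    change t ≤ q.eval (encSize a) at ht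
    exact ⟨u + t + 1, by dsimp only; omega, .ite_false (h ▸ hr) hr'⟩
  · obtain ⟨t, ht, hr'⟩ := hM ⟨a, h⟩
    change t ≤ p.eval (encSize a) at ht
    exact ⟨u + t + 1, by dsimp only; omega, .ite_true hr h hr'⟩

theorem ite {c : S → Bool} {f g : S → T} (hc : PolyTime c) (hf : PolyTime f) (hg : PolyTime g) :
    PolyTime fun a => if c a then f a else g a :=
  by_cases hc
    ((hf.restrict _).congr fun a => if_pos (by simpa [enc_bool_eq_nil] using a.2))
    ((hg.restrict _).congr fun a => if_neg (by simpa [enc_bool_eq_nil] using a.2))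

theorem bool₂ (f : Bool → Bool → T) {b c : S → Bool} (hb : PolyTime b) (hc : PolyTime c) :
    PolyTime fun a => f (b a) (c a) :=
  (hb.ite (hc.ite (const (f true true)) (const (f true false)))
    (hc.ite (const (f false true)) (const (f false false)))).congr fun a => by
      cases b a <;> cases c a <;> rfl

theorem list_cons {f : S → T} {g : S → List T} (hf : PolyTime f) (hg : PolyTime g) :
    PolyTime fun a => f a :: g a :=
  (hf.pair hg).congr_enc fun _ => rfl

theorem list_isEmpty {l : S → List T} (hl : PolyTime l) : PolyTime fun a => (l a).isEmpty :=
  by_cases hl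
    ((const false).congr fun a => by simpa [enc_list_eq_nil] using a.2)
    ((const true).congr fun a => by simpa [enc_list_eq_nil] using a.2)

theorem list_match [DepthBounded U] {l : S → List U} {f : S → T} {g : S × U × List U → T}
    (hl : PolyTime l) (hf : PolyTime f) (hg : PolyTime g) :
    PolyTime fun a => match l a with
      | [] => f a
      | u :: l' => g (a, u, l') := by
  have hne (a : {a // Encoded.enc (l a) ≠ Cell.nil}) : l a ≠ [] := fun h => a.2 (by rw [h]; rfl)
  let split (a : {a // Encoded.enc (l a) ≠ Cell.nil}) : S × U × List U :=
    (a, (l a).head (hne a), (l a).tail)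
  have henc (a) : Encoded.enc (split a) = Encoded.enc (a.1, l a) := by
    rw [enc_prod, enc_prod (a.1, l a), ← List.cons_head_tail (hne a)]
    rfl
  have hsplit : PolyTime split := ((id.pair hl).restrict _).congr_enc henc
  have hbound : PolyBounded fun a => encSize (split a) :=
    (PolyBounded.size.add ((hl.restrict _).polyBounded_encSize.add (.const 1))).mono fun a =>
      (congrArg Cell.size (henc a)).le
  refine by_cases hl ((hg.comp_of_polyBounded hsplit hbound).congr fun a => ?_)
    ((hf.restrict _).congr fun a => ?_)
  · rw [← List.cons_head_tail (hne a)]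
  · rw [enc_list_eq_nil.1 a.2]

end PolyTime

namespace PolyTime

variable {S T U V : Type} [Encoded S] [Encoded T] [Encoded U] [Encoded V]

theorem sum_match [DepthBounded U] [DepthBounded V] {e : S → U ⊕ V} {f : S × U → T} {g : S × V → T}
    (he : PolyTime e) (hf : PolyTime f) (hg : PolyTime g) :
    PolyTime fun a => match e a with
      | .inl u => f (a, u)
      | .inr v => g (a, v) := by
  have htag : PolyTime fun a => (e a).isRight :=
    he.of_enc_eq_hd fun a => by cases e a <;> rfl
  refine by_cases htag ?_ ?_
  · have hright (a : {a // Encoded.enc (e a).isRight ≠ Cell.nil}) : (e a).isRight := by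
      simpa [enc_bool_eq_nil] using a.2
    have hget : PolyTime fun a => (e a.1).getRight (hright a) :=
      (he.restrict _).of_enc_eq_tl fun a => by
        conv_rhs => rw [← Sum.inr_getRight _ (hright a)]
        rfl
    refine (hg.comp_of_polyBounded ((id.restrict _).pair hget)
      ((PolyBounded.size.add hget.polyBounded_encSize).add (.const 1))).congr fun a => ?_
    obtain ⟨v, hv⟩ := Sum.isRight_iff.1 (hright a)
    simp only [hv, Sum.getRight_inr]
  · have hleft (a : {a // Encoded.enc (e a).isRight = Cell.nil}) : (e a).isLeft := by
      simpa [enc_bool_eq_nil] using a.2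
    have hget : PolyTime fun a => (e a.1).getLeft (hleft a) :=
      (he.restrict _).of_enc_eq_tl fun a => by
        conv_rhs => rw [← Sum.inl_getLeft _ (hleft a)]
        rfl
    refine (hf.comp_of_polyBounded ((id.restrict _).pair hget)
      ((PolyBounded.size.add hget.polyBounded_encSize).add (.const 1))).congr fun a => ?_
    obtain ⟨u, hu⟩ := Sum.isLeft_iff.1 (hleft a)
    simp only [hu, Sum.getLeft_inl]

/-- The body of the loop that folds `N` over a list. The state of the loop consists of the rest of
the list, the parameters, and the accumulator. -/
def foldBody (N : Code) : Code :=
  Code.pair (Code.comp Code.tl Code.hd) (Code.pair (Code.comp Code.hd Code.tl)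
    (Code.comp N (Code.pair (Code.comp Code.hd Code.tl)
      (Code.pair (Code.comp Code.tl Code.tl) (Code.comp Code.hd Code.hd)))))

theorem runs_foldBody {N : Code} {step : S × T × U → T} {a : S} {b : T} {u : U} {t : ℕ}
    (l : List U) (h : Runs N (Encoded.enc (a, b, u)) (Encoded.enc (step (a, b, u))) t) :
    Runs (foldBody N) (Encoded.enc (u :: l, a, b)) (Encoded.enc (l, a, step (a, b, u)))
      (t + 20) := by
  have hrun : Runs (foldBody N) (Encoded.enc (u :: l, a, b))
      (Encoded.enc (l, a, step (a, b, u))) _ :=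
    .pair (.comp (.hd _) (.tl _)) (.pair (.comp (.tl _) (.hd _))
      (.comp (.pair (.comp (.tl _) (.hd _)) (.pair (.comp (.tl _) (.tl _))
        (.comp (.hd _) (.hd _)))) h))
  convert hrun using 1
  omega

theorem runs_fold {N : Code} {step : S × T × U → T} (a : S) (τ : ℕ) (l : List U) (b : T)
    (h : ∀ l' u, l' ++ [u] <+: l → ∃ t ≤ τ,
      Runs N (Encoded.enc (a, l'.foldl (fun b u => step (a, b, u)) b, u))
        (Encoded.enc (step (a, l'.foldl (fun b u => step (a, b, u)) b, u))) t) :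
    ∃ t ≤ l.length * (τ + 22) + 2, Runs (Code.while Code.hd (foldBody N)) (Encoded.enc (l, a, b))
      (Encoded.enc (([] : List U), a, l.foldl (fun b u => step (a, b, u)) b)) t := by
  induction l generalizing b with
  | nil => exact ⟨2, by omega, .while_done (.hd _)⟩
  | cons u l ih =>
    obtain ⟨s, hs, hr⟩ := h [] u (by simp)
    obtain ⟨t, ht, hr'⟩ := ih (step (a, b, u)) fun l' u' hl => h (u :: l') u' (by simpa using hl)
    refine ⟨_, ?_, .while_step (.hd _) (by simp [enc_prod, enc_list_cons, Cell.hd])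
      (runs_foldBody l hr) hr'⟩
    rw [List.length_cons, add_one_mul]
    omega

theorem foldl_of_encSize_le [DepthBounded U] {l : S → List U} {init : S → T} {step : S × T × U → T}
    (hl : PolyTime l) (hinit : PolyTime init) (hstep : PolyTime step) {B : S → ℕ}
    (hB : PolyBounded B) (hle : ∀ a, ∀ l', l' <+: l a →
      encSize (l'.foldl (fun b u => step (a, b, u)) (init a)) ≤ B a) :
    PolyTime fun a => (l a).foldl (fun b u => step (a, b, u)) (init a) := by
  have hsize := hl.polyBounded_encSize
  obtain ⟨K, ρ, hρ, hK⟩ := iff_exists_polyBounded.1 hl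
  obtain ⟨M, σ, hσ, hM⟩ := iff_exists_polyBounded.1 hinit
  obtain ⟨N, q, hN⟩ := hstep
  let τ : S → ℕ := fun a => q.eval (encSize a + (B a + encSize (l a) + 1) + 1)
  have hτ : PolyBounded τ :=
    ((PolyBounded.size.add ((hB.add hsize).add (.const 1))).add (.const 1)).eval q
  refine iff_exists_polyBounded.2 ⟨Code.comp (Code.comp Code.tl Code.tl)
    (Code.comp (Code.while Code.hd (foldBody N)) (Code.pair K (Code.pair Code.id M))),
    fun a => (ρ a + σ a + 10) + (encSize (l a) * (τ a + 22) + 2),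
    ((hρ.add hσ).add (.const 10)).add ((hsize.mul (hτ.add (.const 22))).add (.const 2)),
    fun a => ?_⟩
  obtain ⟨u, hu, hr⟩ := hK a
  obtain ⟨s, hs, hr'⟩ := hM a
  obtain ⟨t, ht, hr''⟩ := runs_fold (N := N) (step := step) a (τ a) (l a) (init a) (by
    intro l' u hl'
    obtain ⟨t, ht, hr⟩ := hN (a, l'.foldl (fun b u => step (a, b, u)) (init a), u)
    refine ⟨t, ht.trans (polynomial_eval_mono q ?_), hr⟩
    change encSize (a, _, u) ≤ _
    have hacc := hle a l' ((List.prefix_append l' [u]).trans hl')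
    have hu : encSize u ≤ encSize (l a) := encSize_le_of_mem (hl'.subset (by simp))
    simp only [encSize_prod]
    omega)
  have hlen := Nat.mul_le_mul_right (τ a + 22) (length_lt_encSize (l a)).le
  exact ⟨_, by dsimp only; omega,
    .comp (.comp (.pair hr (.pair (.id _) hr')) hr'') (.comp (.tl _) (.tl _))⟩

theorem foldl [DepthBounded T] [DepthBounded U] {l : S → List U} {init : S → T}
    {step : S × T × U → T} (hl : PolyTime l) (hinit : PolyTime init) (hstep : PolyTime step)
    {B : S → ℕ} (hB : PolyBounded B)
    (hgrowth : ∀ a b, ∀ u ∈ l a, encSize (step (a, b, u)) ≤ encSize b + B a) :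
    PolyTime fun a => (l a).foldl (fun b u => step (a, b, u)) (init a) := by
  refine foldl_of_encSize_le hl hinit hstep
    (hinit.polyBounded_encSize.add (hl.polyBounded_encSize.mul hB)) fun a l' hl' => ?_
  refine (encSize_foldl_le (fun b u hu => hgrowth a b u (hl'.subset hu)) _).trans ?_
  gcongr
  exact hl'.length_le.trans (length_lt_encSize (l a)).le

/-! ### Lists -/

theorem list_tail [DepthBounded T] {l : S → List T} (hl : PolyTime l) :
    PolyTime fun a => (l a).tail :=
  (list_match hl (const []) id.snd.snd).congr fun a => by cases l a <;> rfl

theorem list_headD [DepthBounded T] {l : S → List T} (hl : PolyTime l) (b : T) :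
    PolyTime fun a => (l a).headD b :=
  (list_match hl (const b) id.snd.fst).congr fun a => by cases l a <;> rfl

theorem list_reverse_append [DepthBounded T] {l l' : S → List T} (hl : PolyTime l)
    (hl' : PolyTime l') : PolyTime fun a => (l a).reverse ++ l' a := by
  refine (foldl (T := List T) (step := fun x => x.2.2 :: x.2.1) hl hl'
    (id.snd.snd.list_cons id.snd.fst) (hl.polyBounded_encSize.add (.const 1))
    fun a b u hu => ?_).congr fun a => ?_
  · have := encSize_le_of_mem hu
    simp only [encSize_cons]
    omega
  · simp

theorem list_reverse [DepthBounded T] {l : S → List T} (hl : PolyTime l) :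
    PolyTime fun a => (l a).reverse :=
  (hl.list_reverse_append (const [])).congr fun _ => (List.append_nil _).symm

theorem list_append [DepthBounded T] {l l' : S → List T} (hl : PolyTime l) (hl' : PolyTime l') :
    PolyTime fun a => l a ++ l' a :=
  (hl.list_reverse.list_reverse_append hl').congr fun _ => by rw [List.reverse_reverse]

theorem comp_fst_snd_snd {g : S × U → V} (hg : PolyTime g) :
    PolyTime fun x : S × T × U => g (x.1, x.2.2) :=
  hg.comp_of_polyBounded (id.fst.pair id.snd.snd)
    (PolyBounded.size.mono fun x => by simp only [encSize_prod]; omega)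

theorem list_map [DepthBounded T] [DepthBounded U] {l : S → List T} {g : S × T → U}
    (hl : PolyTime l) (hg : PolyTime g) : PolyTime fun a => (l a).map fun u => g (a, u) := by
  obtain ⟨q, hq⟩ := hg.polyBounded_encSize
  have hfold : PolyTime fun a => (l a).foldl (fun b u => g (a, u) :: b) [] := by
    refine foldl (T := List U) (step := fun x => g (x.1, x.2.2) :: x.2.1) hl (const [])
      (hg.comp_fst_snd_snd.list_cons id.snd.fst)
      ((((PolyBounded.size.add hl.polyBounded_encSize).add (.const 1)).eval q).add (.const 1))
      fun a b u hu => ?_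
    have hu : encSize (a, u) ≤ encSize a + encSize (l a) + 1 := by
      simpa only [encSize_prod] using by gcongr; exact encSize_le_of_mem hu
    have hval : encSize (g (a, u)) ≤ _ := (hq (a, u)).trans (polynomial_eval_mono q hu)
    simp only [encSize_cons]
    omega
  exact hfold.list_reverse.congr fun a => by
    rw [List.foldl_flip_cons_eq_append, List.append_nil, List.reverse_reverse]

theorem list_filter [DepthBounded T] {l : S → List T} {g : S × T → Bool}
    (hl : PolyTime l) (hg : PolyTime g) : PolyTime fun a => (l a).filter fun u => g (a, u) := by
  have hfold : PolyTime fun a => (l a).foldl (fun b u => if g (a, u) then u :: b else b) [] := by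
    refine foldl (T := List T)
      (step := fun x => if g (x.1, x.2.2) then x.2.2 :: x.2.1 else x.2.1) hl (const [])
      (hg.comp_fst_snd_snd.ite (id.snd.snd.list_cons id.snd.fst) id.snd.fst)
      (hl.polyBounded_encSize.add (.const 1)) fun a b u hu => ?_
    have := encSize_le_of_mem hu
    dsimp only
    split
    · simp only [encSize_cons]; omega
    · omega
  exact hfold.list_reverse.congr fun a => by
    rw [← List.foldl_filter, List.foldl_flip_cons_eq_append (f := fun u => u)]
    simp

/-! ### Natural numbers -/

theorem units {n : S → ℕ} (hn : PolyTime n) : PolyTime fun a => List.replicate (n a) () :=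
  hn.congr_enc fun _ => (enc_nat_eq_replicate _).symm

theorem of_units {n : S → ℕ} (hn : PolyTime fun a => List.replicate (n a) ()) : PolyTime n :=
  hn.congr_enc fun _ => enc_nat_eq_replicate _

theorem list_length [DepthBounded T] {l : S → List T} (hl : PolyTime l) :
    PolyTime fun a => (l a).length :=
  of_units ((list_map (U := Unit) hl (const ())).congr fun _ => List.map_const'.symm)

theorem nat_add {m n : S → ℕ} (hm : PolyTime m) (hn : PolyTime n) :
    PolyTime fun a => m a + n a :=
  of_units ((hm.units.list_append hn.units).congr fun _ =>
    List.replicate_append_replicate.symm)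

theorem iterate [DepthBounded T] {n : S → ℕ} {init : S → T} {step : S × T → T}
    (hn : PolyTime n) (hinit : PolyTime init) (hstep : PolyTime step) {B : S → ℕ}
    (hB : PolyBounded B) (hgrowth : ∀ a b, encSize (step (a, b)) ≤ encSize b + B a) :
    PolyTime fun a => (fun b => step (a, b))^[n a] (init a) := by
  have hstep' : PolyTime fun x : S × T × Unit => step (x.1, x.2.1) :=
    hstep.comp_of_polyBounded (id.fst.pair id.snd.fst)
      (PolyBounded.size.mono fun x => by simp only [encSize_prod]; omega)
  refine (foldl hn.units hinit hstep' hB fun a b _ _ => hgrowth a b).congr fun a => ?_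
  simpa using (List.foldl_const (fun b => step (a, b)) (init a) (List.replicate (n a) ())).symm

theorem comp_fst {g : S → V} (hg : PolyTime g) : PolyTime fun x : S × T => g x.1 :=
  hg.comp_of_polyBounded id.fst
    (PolyBounded.size.mono fun x => by simp only [encSize_prod]; omega)

theorem nat_mul {m n : S → ℕ} (hm : PolyTime m) (hn : PolyTime n) :
    PolyTime fun a => m a * n a := by
  refine (iterate (T := ℕ) (step := fun x => x.2 + n x.1) hm (const 0)
    (id.snd.nat_add hn.comp_fst) hn.polyBounded_encSize
    fun a b => by simp only [encSize_nat]; omega).congr fun a => ?_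
  simp only [add_right_iterate, smul_eq_mul, zero_add]

theorem list_drop [DepthBounded T] {n : S → ℕ} {l : S → List T} (hn : PolyTime n)
    (hl : PolyTime l) : PolyTime fun a => (l a).drop (n a) := by
  refine (iterate (T := List T) (step := fun x => x.2.tail) hn hl id.snd.list_tail (.const 0)
    fun a b => encSize_le_of_sublist (List.tail_sublist b)).congr fun a => ?_
  generalize l a = l
  induction n a generalizing l with
  | zero => rfl
  | succ k ih => rw [Function.iterate_succ_apply, ← ih, List.drop_tail]

theorem nat_sub {m n : S → ℕ} (hm : PolyTime m) (hn : PolyTime n) : PolyTime fun a => m a - n a :=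
  of_units ((list_drop hn hm.units).congr fun _ => List.drop_replicate.symm)

theorem list_take [DepthBounded T] {n : S → ℕ} {l : S → List T} (hn : PolyTime n)
    (hl : PolyTime l) : PolyTime fun a => (l a).take (n a) :=
  (list_drop (nat_sub hl.list_length hn) hl.list_reverse).list_reverse.congr fun a => by
    rw [List.drop_reverse, List.reverse_reverse, List.take_eq_take_iff]
    omega

theorem nat_le {m n : S → ℕ} (hm : PolyTime m) (hn : PolyTime n) :
    PolyTime fun a => decide (m a ≤ n a) :=
  (hm.nat_sub hn).units.list_isEmpty.congr fun a => by
    rw [Bool.eq_iff_iff]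
    simp [Nat.sub_eq_zero_iff_le]

theorem list_replicate [DepthBounded T] {n : S → ℕ} (hn : PolyTime n) (b : T) :
    PolyTime fun a => List.replicate (n a) b :=
  (list_map hn.units (const b)).congr fun a => by rw [List.map_replicate]

theorem list_range {n : S → ℕ} (hn : PolyTime n) : PolyTime fun a => List.range (n a) := by
  have hrange (k : ℕ) :
      (List.replicate k ()).foldl (fun (b : List ℕ) _ => b ++ [b.length]) [] = List.range k := by
    induction k with
    | zero => rfl
    | succ k ih =>
      rw [List.replicate_succ', List.foldl_concat, ih, List.length_range, List.range_succ]
  refine (foldl_of_encSize_le (T := List ℕ) (step := fun x => x.2.1 ++ [x.2.1.length]) hn.units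
    (const []) (id.snd.fst.list_append (id.snd.fst.list_length.list_cons (const [])))
    (hn.polyBounded_encSize.mul (hn.polyBounded_encSize.add (.const 1)) |>.add (.const 1))
    fun a l' hl' => ?_).congr fun a => (hrange (n a)).symm
  obtain ⟨k, hk, rfl⟩ : ∃ k ≤ n a, l' = List.replicate k () :=
    ⟨l'.length, by simpa using hl'.length_le, List.eq_replicate_iff.2 ⟨rfl, by simp⟩⟩
  rw [hrange]
  refine (encSize_list_le (K := encSize (n a)) fun i hi => ?_).trans ?_
  · have := List.mem_range.1 hi
    simp only [encSize_nat]
    omega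
  · rw [List.length_range]
    gcongr
    simp only [encSize_nat]
    omega

theorem list_set [DepthBounded T] {l : S → List T} {n : S → ℕ} {b : S → T} (hl : PolyTime l)
    (hn : PolyTime n) (hb : PolyTime b) : PolyTime fun a => (l a).set (n a) (b a) := by
  have hlt : PolyTime fun a => decide (n a + 1 ≤ (l a).length) :=
    (hn.nat_add (const 1)).nat_le hl.list_length
  refine (hlt.ite ((list_take hn hl).list_append
    (hb.list_cons (list_drop (hn.nat_add (const 1)) hl))) hl).congr fun a => ?_
  rw [List.set_eq_take_append_cons_drop]
  simp only [decide_eq_true_eq, Nat.add_one_le_iff]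

theorem bound (p : MvPolynomial (Fin 4) ℕ) {k : S → Params} (hk : PolyTime k) :
    PolyTime fun a => bound p (k a) := by
  induction p using MvPolynomial.induction_on with
  | C n => exact (const n).congr fun _ => by simp [PrivateLearning.bound]
  | add p q hp hq => exact (hp.nat_add hq).congr fun _ => by simp [PrivateLearning.bound]
  | mul_X p i hp =>
    have hcoord :
        PolyTime fun a => (![(k a).1, (k a).2.1, (k a).2.2.1, (k a).2.2.2] : Fin 4 → ℕ) i := by
      fin_cases i
      · exact hk.fst
      · exact hk.snd.fst
      · exact hk.snd.snd.fst
      · exact hk.snd.snd.snd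
    exact (hp.nat_mul hcoord).congr fun _ => by simp [PrivateLearning.bound]

end PolyTime

open scoped ENNReal

/-! ### Independent draws -/

theorem pmf_bind_congr {D O : Type*} (μ : PMF D) {f g : D → PMF O}
    (h : ∀ a ∈ μ.support, f a = g a) : μ.bind f = μ.bind g := by
  ext o
  rw [PMF.bind_apply, PMF.bind_apply]
  refine tsum_congr fun a => ?_
  by_cases ha : μ a = 0
  · rw [ha, zero_mul, zero_mul]
  · rw [h a ha]

/-- The distribution of the list of `n` independent draws from `μ`. Unlike for `iid`, the type of
the outcomes does not depend on `n`. -/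
noncomputable def draws {D : Type*} (μ : PMF D) : ℕ → PMF (List D)
  | 0 => PMF.pure []
  | n + 1 => μ.bind fun x => (draws μ n).map fun l => x :: l

theorem map_ofFn_iid {D : Type} (μ : PMF D) (n : ℕ) : (iid μ n).map List.ofFn = draws μ n := by
  induction n with
  | zero => simp [iid, draws, PMF.pure_map]
  | succ n ih =>
    rw [iid, draws, PMF.map_bind]
    congr 1
    funext x
    rw [← ih, PMF.map_comp, PMF.map_comp]
    congr 1
    funext v
    simp [List.ofFn_succ]

theorem length_of_mem_support_draws {D : Type*} {μ : PMF D} {n : ℕ} {l : List D}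
    (h : l ∈ (draws μ n).support) : l.length = n := by
  induction n generalizing l with
  | zero => simpa [draws] using h
  | succ n ih =>
    simp only [draws, PMF.mem_support_bind_iff, PMF.mem_support_map_iff] at h
    obtain ⟨x, -, l', hl', rfl⟩ := h
    simp [ih hl']

theorem draws_add {D : Type*} (μ : PMF D) (m n : ℕ) :
    draws μ (m + n) = (draws μ m).bind fun l => (draws μ n).map fun l' => l ++ l' := by
  induction m with
  | zero =>
    rw [Nat.zero_add, draws, PMF.pure_bind]
    simp only [List.nil_append]
    exact (PMF.map_id _).symm
  | succ m ih =>
    rw [Nat.add_right_comm, draws, draws, PMF.bind_bind]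
    congr 1
    funext x
    rw [ih, PMF.map_bind, PMF.bind_map]
    congr 1
    funext l
    simp only [Function.comp, PMF.map_comp]
    rfl

theorem bind_draws_add {D O : Type*} (μ : PMF D) (m n : ℕ) (f : List D → List D → PMF O) :
    ((draws μ (m + n)).bind fun l => f (l.take m) (l.drop m)) =
      (draws μ m).bind fun l => (draws μ n).bind fun l' => f l l' := by
  rw [draws_add, PMF.bind_bind]
  refine pmf_bind_congr _ fun l hl => ?_
  rw [PMF.bind_map]
  congr 1
  funext l'
  simp [← length_of_mem_support_draws hl]

theorem map_draws_add {D O : Type*} (μ : PMF D) (m n : ℕ) (f : List D → List D → O) :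
    ((draws μ (m + n)).map fun l => f (l.take m) (l.drop m)) =
      (draws μ m).bind fun l => (draws μ n).map fun l' => f l l' :=
  bind_draws_add μ m n fun l l' => PMF.pure (f l l')

theorem iid_apply {D : Type} (μ : PMF D) (n : ℕ) (v : Fin n → D) : iid μ n v = ∏ i, μ (v i) := by
  classical
  induction n with
  | zero =>
    rw [iid, PMF.pure_apply]
    simp [Subsingleton.elim v Fin.elim0]
  | succ n ih =>
    have hmap_self : (iid μ n).map (Fin.cons (v 0)) v = iid μ n (Fin.tail v) := by
      rw [PMF.map_apply, tsum_eq_single (Fin.tail v), if_pos (Fin.cons_self_tail v).symm]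
      exact fun w hw => if_neg fun h => hw (by rw [h, Fin.tail_cons])
    have hmap_ne (x) (hx : x ≠ v 0) : (iid μ n).map (Fin.cons x) v = 0 := by
      rw [PMF.map_apply, ENNReal.tsum_eq_zero]
      exact fun w => if_neg fun h => hx (by rw [h, Fin.cons_zero])
    rw [iid, PMF.bind_apply, tsum_eq_single (v 0) fun x hx => by rw [hmap_ne x hx, mul_zero],
      hmap_self, ih, Fin.prod_univ_succ]
    rfl

theorem coins_eq_draws (r : ℕ) : coins r = draws (PMF.uniformOfFintype Bool) r := by
  rw [coins, ← map_ofFn_iid]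
  congr 1
  ext v
  rw [iid_apply]
  simp [ENNReal.inv_pow]

/-! ### Differential privacy of local algorithms -/

theorem differentiallyPrivate_of_apply_le {D O : Type} {n : ℕ} {ε : ℝ}
    {A : (Fin n → D) → PMF O}
    (h : ∀ z z' i, (∀ j, j ≠ i → z j = z' j) → ∀ o,
      A z o ≤ ENNReal.ofReal (Real.exp ε) * A z' o) : DifferentiallyPrivate ε A := by
  rintro z z' ⟨i, -, hi⟩ S
  rw [PMF.toOuterMeasure_apply, PMF.toOuterMeasure_apply, ← ENNReal.tsum_mul_left]
  refine ENNReal.tsum_le_tsum fun o => ?_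
  by_cases ho : o ∈ S
  · simp only [Set.indicator_of_mem ho]
    exact h z z' i (fun j hj => not_not.1 fun hne => hj (hi j hne)) o
  · simp [Set.indicator_of_notMem ho]

theorem DifferentiallyPrivate.map {D O O' : Type} {n : ℕ} {ε : ℝ} {A : (Fin n → D) → PMF O}
    (hA : DifferentiallyPrivate ε A) (f : O → O') :
    DifferentiallyPrivate ε fun z => (A z).map f := by
  intro z z' hz S
  rw [PMF.toOuterMeasure_map_apply, PMF.toOuterMeasure_map_apply]
  exact hA z z' hz _

theorem bind_apply_le_mul_bind_apply {D O : Type*} {p p' : PMF D} {f f' : D → PMF O} {o : O}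
    {c c' : ℝ≥0∞} (hp : ∀ a, p a ≤ c * p' a) (hf : ∀ a, p' a ≠ 0 → f a o ≤ c' * f' a o) :
    p.bind f o ≤ c * c' * p'.bind f' o := by
  rw [PMF.bind_apply, PMF.bind_apply, ← ENNReal.tsum_mul_left]
  refine ENNReal.tsum_le_tsum fun a => ?_
  by_cases ha : p' a = 0
  · have hpa : p a = 0 := by simpa [ha] using hp a
    simp [hpa]
  · calc p a * f a o ≤ (c * p' a) * (c' * f' a o) := mul_le_mul' (hp a) (hf a ha)
      _ = c * c' * (p' a * f' a o) := by ring

namespace LocalProtocol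

variable {D O : Type} {n : ℕ}

theorem run_apply_le {z z' : Fin n → D} {i : Fin n} (hz : ∀ j, j ≠ i → z j = z' j) (o : O)
    (P : LocalProtocol D n O) (b : Fin n → ℝ) (hb : 0 ≤ b i) (hP : P.WithinBudget b) :
    P.run z o ≤ ENNReal.ofReal (Real.exp (b i)) * P.run z' o := by
  induction P generalizing b with
  | output o' =>
    refine le_mul_of_one_le_left' ?_
    rw [ENNReal.one_le_ofReal]
    exact Real.one_le_exp hb
  | toss ν next ih =>
    rw [run, run, ← one_mul (ENNReal.ofReal _)]
    exact bind_apply_le_mul_bind_apply (fun a => by rw [one_mul]) fun a ha => ih a b hb (hP a ha)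
  | query j R next ih =>
    obtain ⟨ε, -, hεb, hR, hnext⟩ := hP
    rw [run, run]
    by_cases hj : j = i
    · subst hj
      have hexp : ENNReal.ofReal (Real.exp (b j)) =
          ENNReal.ofReal (Real.exp ε) * ENNReal.ofReal (Real.exp (b j - ε)) := by
        rw [← ENNReal.ofReal_mul (Real.exp_nonneg _), ← Real.exp_add, add_sub_cancel]
      rw [hexp]
      refine bind_apply_le_mul_bind_apply (fun w => hR _ _ w) fun w hw => ?_
      simpa using ih w (Function.update b j (b j - ε)) (by simpa using hεb) (hnext w ⟨_, hw⟩)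
    · rw [hz j hj, ← one_mul (ENNReal.ofReal _)]
      refine bind_apply_le_mul_bind_apply (fun a => by rw [one_mul]) fun w hw => ?_
      have hbi : Function.update b j (b j - ε) i = b i := Function.update_of_ne (Ne.symm hj) _ _
      have := ih w (Function.update b j (b j - ε)) (by rwa [hbi]) (hnext w ⟨_, hw⟩)
      rwa [hbi] at this

theorem IsLocal.differentiallyPrivate {ε : ℝ} (hε : 0 ≤ ε) {P : LocalProtocol D n O}
    (hP : P.IsLocal ε) : DifferentiallyPrivate ε fun z => P.run z :=
  differentiallyPrivate_of_apply_le fun _ _ _ hz o => P.run_apply_le hz o _ hε hP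

end LocalProtocol

theorem LocallyLearnable.privatelyPACLearnable {C : ConceptClass} (h : LocallyLearnable C) :
    PrivatelyPACLearnable C := by
  obtain ⟨p, q, A, hA⟩ := h
  refine ⟨p, fun d ε α β z => (A d ε α β).run z, fun d ε hε α hα β hβ => ?_⟩
  obtain ⟨hlocal, hlearn⟩ := hA d ε hε α hα β hβ
  exact ⟨hlocal.differentiallyPrivate hε.le, fun c hc => (hlearn c hc).2⟩

theorem EfficientlyPrivatelyPACLearnable.privatelyPACLearnable {C : ConceptClass}
    (h : EfficientlyPrivatelyPACLearnable C) : PrivatelyPACLearnable C := by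
  obtain ⟨p, r, F, E, -, -, hA⟩ := h
  refine ⟨p, fun d ε α β z => (randomizedAlg F (params d ε α β)
    (bound r (params d ε α β)) z).map (hypothesis C d E), fun d ε hε α hα β hβ => ?_⟩
  obtain ⟨hprivate, hlearn⟩ := hA d ε hε α hα β hβ
  exact ⟨hprivate.map _, hlearn⟩

/-! ### Simulation of efficient local algorithms -/

section Simulation

variable (L : Params × List Bool × List (List Bool) → (ℕ × List Bool) ⊕ List Bool)
  (Q : Params × List Bool × (List Bool × Bool) × List Bool → List Bool)

/-- One query of a local algorithm, simulated on the database `db`. The state consists of the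
answers so far and the unused coin tosses; it does not change if the algorithm makes no query. -/
def simulationStep (k : Params) (s l : ℕ) (ω : List Bool) (db : List (List Bool × Bool))
    (st : List (List Bool) × List Bool) : List (List Bool) × List Bool :=
  match L (k, ω, st.1) with
  | Sum.inl (i, desc) =>
    match db.drop i with
    | [] => st
    | u :: _ => (st.1 ++ [(Q (k, desc, u, st.2.take s)).take l], st.2.drop s)
  | Sum.inr _ => st

/-- The output of a local algorithm after the given answers, if no more queries are allowed. -/
def simulationOutput (k : Params) (ω : List Bool) (answers : List (List Bool)) : List Bool :=
  match L (k, ω, answers) with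
  | Sum.inl _ => []
  | Sum.inr h => h

variable {L} in
theorem map_simulationOutput_of_fixed {k : Params} {s l : ℕ} {ω : List Bool}
    {db : List (List Bool × Bool)} {answers : List (List Bool)}
    (hfix : ∀ η, simulationStep L Q k s l ω db (answers, η) = (answers, η)) (r T : ℕ) :
    ((coins r).map fun η =>
      simulationOutput L k ω ((simulationStep L Q k s l ω db)^[T] (answers, η)).1) =
      PMF.pure (simulationOutput L k ω answers) := by
  simp only [Function.iterate_fixed (hfix _)]
  exact PMF.map_const _ _

theorem run_localAlgFrom {C : ConceptClass} {d n : ℕ} (k : Params) (s l : ℕ) (ω : List Bool)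
    (z : Fin n → C.Example d) (T : ℕ) (answers : List (List Bool)) :
    (localAlgFrom L Q k s l ω T answers).run z =
      (coins (T * s)).map fun η => simulationOutput L k ω
        ((simulationStep L Q k s l ω (List.ofFn fun i => exampleString (z i)))^[T]
          (answers, η)).1 := by
  set db := List.ofFn fun i => exampleString (z i) with hdb
  induction T generalizing answers with
  | zero =>
    simp only [localAlgFrom, Function.iterate_zero_apply, simulationOutput]
    cases h : L (k, ω, answers) <;> exact (PMF.map_const _ _).symm
  | succ T ih =>
    rw [localAlgFrom]
    rcases h : L (k, ω, answers) with ⟨i, desc⟩ | o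
    · by_cases hi : i < n
      · have hdrop : db.drop i = exampleString (z ⟨i, hi⟩) :: db.drop (i + 1) := by
          rw [List.drop_eq_getElem_cons (by simpa [hdb] using hi)]
          simp [hdb]
        let answer (η : List Bool) := (Q (k, desc, exampleString (z ⟨i, hi⟩), η)).take l
        have hstep (η : List Bool) : simulationStep L Q k s l ω db (answers, η) =
            (answers ++ [answer (η.take s)], η.drop s) := by
          simp only [simulationStep, h, hdrop, answer]
        simp only [dif_pos hi, LocalProtocol.run, Function.iterate_succ_apply, hstep, ih,
          coins_eq_draws, PMF.bind_map]
        rw [add_one_mul, add_comm, map_draws_add _ s (T * s) fun η η' => simulationOutput L k ω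
          ((simulationStep L Q k s l ω db)^[T] (answers ++ [answer η], η')).1]
        rfl
      · have hdrop : db.drop i = [] := List.drop_eq_nil_of_le (by simpa [hdb] using hi)
        simp only [dif_neg hi, LocalProtocol.run]
        rw [map_simulationOutput_of_fixed Q fun η => by simp only [simulationStep, h, hdrop]]
        simp only [simulationOutput, h]
    · simp only [LocalProtocol.run]
      rw [map_simulationOutput_of_fixed Q fun η => by simp only [simulationStep, h]]
      simp only [simulationOutput, h]

/-- The simulation of a local algorithm as a function of the parameters, the database, and all the
coin tosses. -/
noncomputable def simulation (r s l T : MvPolynomial (Fin 4) ℕ)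
    (x : Params × List (List Bool × Bool) × List Bool) : List Bool :=
  simulationOutput L x.1 (x.2.2.take (bound r x.1))
    ((simulationStep L Q x.1 (bound s x.1) (bound l x.1) (x.2.2.take (bound r x.1)) x.2.1)^[
      bound T x.1] ([], x.2.2.drop (bound r x.1))).1

theorem randomizedAlg_simulation {C : ConceptClass} {d n : ℕ} (r s l T : MvPolynomial (Fin 4) ℕ)
    (k : Params) :
    randomizedAlg (simulation L Q r s l T) k (bound (r + T * s) k) =
      fun z : Fin n → C.Example d =>
        (localAlg L Q k (bound r k) (bound s k) (bound l k) (bound T k)).run z := by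
  funext z
  have hb : bound (r + T * s) k = bound r k + bound T k * bound s k := by simp [bound]
  rw [randomizedAlg, localAlg, LocalProtocol.run, hb, coins_eq_draws, coins_eq_draws]
  simp only [run_localAlgFrom, simulation, coins_eq_draws]
  exact map_draws_add _ _ _ fun ω η => simulationOutput L k ω
    ((simulationStep L Q k (bound s k) (bound l k) ω (List.ofFn fun i => exampleString (z i)))^[
      bound T k] ([], η)).1

theorem encSize_simulationStep_le (k : Params) (s l : ℕ) (ω : List Bool)
    (db : List (List Bool × Bool)) (st : List (List Bool) × List Bool) :
    encSize (simulationStep L Q k s l ω db st) ≤ encSize st + (4 * l + 2) := by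
  unfold simulationStep
  rcases L (k, ω, st.1) with ⟨i, desc⟩ | o
  · rcases hdb : db.drop i with _ | ⟨u, l'⟩ <;> simp only [hdb]
    · omega
    · set answer := (Q (k, desc, u, st.2.take s)).take l
      have hlen : answer.length ≤ l := List.length_take_le _ _
      have hbits := encSize_bits_le answer
      have happend := encSize_append_add_one st.1 [answer]
      have hdrop := encSize_le_of_sublist (List.drop_sublist s st.2)
      simp only [encSize_prod, encSize_cons, encSize_nil] at happend ⊢
      omega
  · exact Nat.le_add_right _ _

variable {L Q}

theorem PolyTime.simulationStep (hL : PolyTime L) (hQ : PolyTime Q) :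
    PolyTime fun x : (Params × ℕ × ℕ × List Bool × List (List Bool × Bool)) ×
        List (List Bool) × List Bool =>
      simulationStep L Q x.1.1 x.1.2.1 x.1.2.2.1 x.1.2.2.2.1 x.1.2.2.2.2 x.2 := by
  let Input := (Params × ℕ × ℕ × List Bool × List (List Bool × Bool)) ×
    List (List Bool) × List Bool
  have hanswer : PolyTime fun x : Input × List Bool × List Bool × Bool =>
      (Q (x.1.1.1, x.2.1, x.2.2, x.1.2.2.take x.1.1.2.1)).take x.1.1.2.2.1 :=
    list_take id.fst.fst.snd.snd.fst (hQ.comp (id.fst.fst.fst.pair (id.snd.fst.pair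
      (id.snd.snd.pair (list_take id.fst.fst.snd.fst id.fst.snd.snd)))))
  have hquery : PolyTime fun x : Input × List Bool × List Bool × Bool =>
      (x.1.2.1 ++ [(Q (x.1.1.1, x.2.1, x.2.2, x.1.2.2.take x.1.1.2.1)).take x.1.1.2.2.1],
        x.1.2.2.drop x.1.1.2.1) :=
    (id.fst.snd.fst.list_append (hanswer.list_cons (const []))).pair
      (list_drop id.fst.fst.snd.fst id.fst.snd.snd)
  have hindex := list_match (S := Input × ℕ × List Bool)
    (list_drop id.snd.fst id.fst.fst.snd.snd.snd.snd) id.fst.snd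
    (hquery.comp (id.fst.fst.pair (id.fst.snd.snd.pair id.snd.fst)))
  refine (sum_match (hL.comp (id.fst.fst.pair (id.fst.snd.snd.snd.fst.pair id.snd.fst)))
    hindex id.fst.snd).congr fun x => ?_
  unfold PrivateLearning.simulationStep
  rcases L (x.1.1, x.1.2.2.2.1, x.2.1) with ⟨i, desc⟩ | o
  · rcases hdb : x.1.2.2.2.2.drop i with _ | ⟨u, l⟩ <;> simp only [hdb]
  · rfl

theorem PolyTime.simulation (hL : PolyTime L) (hQ : PolyTime Q)
    (r s l T : MvPolynomial (Fin 4) ℕ) : PolyTime (simulation L Q r s l T) := by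
  have hω : PolyTime fun x : Params × List (List Bool × Bool) × List Bool =>
      x.2.2.take (PrivateLearning.bound r x.1) := list_take (bound r id.fst) id.snd.snd
  have hstep := (hL.simulationStep hQ).comp <| PolyTime.pair
    (S := (Params × List (List Bool × Bool) × List Bool) × List (List Bool) × List Bool)
    (id.fst.fst.pair ((bound s id.fst.fst).pair ((bound l id.fst.fst).pair
      ((hω.comp id.fst).pair id.fst.snd.fst)))) id.snd
  have hiter := iterate (bound T id.fst) ((const []).pair (list_drop (bound r id.fst) id.snd.snd))
    hstep (((PolyBounded.const 2).mul (bound l id.fst).polyBounded_encSize))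
    fun x st => (encSize_simulationStep_le L Q _ _ _ _ _ _).trans (by
      simp only [encSize_nat]
      omega)
  have hout : PolyTime fun y : Params × List Bool × List (List Bool) =>
      simulationOutput L y.1 y.2.1 y.2.2 :=
    (sum_match hL (const []) id.snd).congr fun y => by
      unfold simulationOutput
      cases L y <;> rfl
  exact hout.comp (id.fst.pair (hω.pair hiter.fst))

end Simulation

theorem EfficientlyLocallyLearnable.efficientlyPrivatelyPACLearnable {C : ConceptClass}
    (h : EfficientlyLocallyLearnable C) : EfficientlyPrivatelyPACLearnable C := by
  obtain ⟨p, r, s, l, T, L, Q, E, hL, hQ, hE, hA⟩ := h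
  refine ⟨p, r + T * s, simulation L Q r s l T, E, hL.simulation hQ r s l T, hE,
    fun d ε hε α hα β hβ => ?_⟩
  obtain ⟨hlocal, hlearn⟩ := hA d ε hε α hα β hβ
  simp only [randomizedAlg_simulation]
  exact ⟨hlocal.differentiallyPrivate hε.le, hlearn⟩

/-! ### Expectations -/

/-- The expectation of a function with values in `[0, ∞]`. It is a plain sum, so that expectations
can be exchanged with one another and with sums without any measurability conditions. -/
noncomputable def expect {α : Type*} (μ : PMF α) (g : α → ℝ≥0∞) : ℝ≥0∞ := ∑' a, μ a * g a

section Expect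

variable {α β : Type*}

theorem expect_pure (a : α) (g : α → ℝ≥0∞) : expect (PMF.pure a) g = g a := by
  classical
  rw [expect, tsum_eq_single a fun b hb => by rw [PMF.pure_apply_of_ne _ _ hb, zero_mul],
    PMF.pure_apply_self, one_mul]

theorem expect_bind (μ : PMF α) (f : α → PMF β) (g : β → ℝ≥0∞) :
    expect (μ.bind f) g = expect μ fun a => expect (f a) g := by
  simp only [expect, PMF.bind_apply, ← ENNReal.tsum_mul_right, ← ENNReal.tsum_mul_left]
  rw [ENNReal.tsum_comm]
  simp only [mul_assoc]

theorem expect_map (μ : PMF α) (f : α → β) (g : β → ℝ≥0∞) :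
    expect (μ.map f) g = expect μ fun a => g (f a) := by
  rw [PMF.map, expect_bind]
  simp only [Function.comp, expect_pure]

theorem expect_mono {μ : PMF α} {f g : α → ℝ≥0∞} (h : ∀ a ∈ μ.support, f a ≤ g a) :
    expect μ f ≤ expect μ g := by
  refine ENNReal.tsum_le_tsum fun a => ?_
  by_cases ha : μ a = 0
  · rw [ha, zero_mul, zero_mul]
  · exact mul_le_mul_right (h a ha) _

theorem expect_congr {μ : PMF α} {f g : α → ℝ≥0∞} (h : ∀ a ∈ μ.support, f a = g a) :
    expect μ f = expect μ g :=
  (expect_mono fun a ha => (h a ha).le).antisymm (expect_mono fun a ha => (h a ha).ge)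

theorem expect_const (μ : PMF α) (c : ℝ≥0∞) : expect μ (fun _ => c) = c := by
  rw [expect, ENNReal.tsum_mul_right, PMF.tsum_coe, one_mul]

theorem expect_add (μ : PMF α) (f g : α → ℝ≥0∞) :
    expect μ (fun a => f a + g a) = expect μ f + expect μ g := by
  simp only [expect, mul_add, ENNReal.tsum_add]

theorem expect_mul_left (μ : PMF α) (c : ℝ≥0∞) (g : α → ℝ≥0∞) :
    expect μ (fun a => c * g a) = c * expect μ g := by
  simp only [expect, ← ENNReal.tsum_mul_left, mul_left_comm]

theorem expect_mul_right (μ : PMF α) (c : ℝ≥0∞) (g : α → ℝ≥0∞) :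
    expect μ (fun a => g a * c) = expect μ g * c := by
  simp only [mul_comm _ c, expect_mul_left]

theorem expect_tsum (μ : PMF α) (g : β → α → ℝ≥0∞) :
    expect μ (fun a => ∑' b, g b a) = ∑' b, expect μ (g b) := by
  simp only [expect, ← ENNReal.tsum_mul_left]
  exact ENNReal.tsum_comm

theorem expect_sum (s : Finset β) (μ : PMF α) (g : β → α → ℝ≥0∞) :
    expect μ (fun a => ∑ b ∈ s, g b a) = ∑ b ∈ s, expect μ (g b) := by
  simp only [expect, Finset.mul_sum]
  exact Summable.tsum_finsetSum fun _ _ => ENNReal.summable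

theorem expect_comm (μ : PMF α) (ν : PMF β) (g : α → β → ℝ≥0∞) :
    (expect μ fun a => expect ν (g a)) = expect ν fun b => expect μ fun a => g a b := by
  simp only [expect, ← ENNReal.tsum_mul_left, mul_left_comm (μ _)]
  exact ENNReal.tsum_comm

theorem toOuterMeasure_eq_expect (μ : PMF α) (S : Set α) :
    μ.toOuterMeasure S = expect μ (S.indicator 1) := by
  rw [PMF.toOuterMeasure_apply, expect]
  refine tsum_congr fun a => ?_
  by_cases ha : a ∈ S <;> simp [ha]

theorem toOuterMeasure_bind (μ : PMF α) (f : α → PMF β) (S : Set β) :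
    (μ.bind f).toOuterMeasure S = expect μ fun a => (f a).toOuterMeasure S := by
  simp only [toOuterMeasure_eq_expect, expect_bind]

theorem toOuterMeasure_add_compl (μ : PMF α) (S : Set α) :
    μ.toOuterMeasure S + μ.toOuterMeasure Sᶜ = 1 := by
  rw [toOuterMeasure_eq_expect, toOuterMeasure_eq_expect, ← expect_add, ← expect_const μ 1]
  exact expect_congr fun a _ => Set.indicator_self_add_compl_apply S 1 a

theorem toOuterMeasure_le_one (μ : PMF α) (S : Set α) : μ.toOuterMeasure S ≤ 1 :=
  (toOuterMeasure_add_compl μ S).le.trans' le_self_add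

end Expect

theorem expect_iid_prod {D : Type} (μ : PMF D) (n : ℕ) (g : Fin n → D → ℝ≥0∞) :
    expect (iid μ n) (fun z => ∏ i, g i (z i)) = ∏ i, expect μ (g i) := by
  induction n with
  | zero => simp only [Finset.univ_eq_empty, Finset.prod_empty, expect_const]
  | succ n ih =>
    rw [iid, expect_bind, Fin.prod_univ_succ, ← ih, ← expect_mul_right]
    simp only [expect_map, Fin.prod_univ_succ, Fin.cons_zero, Fin.cons_succ, expect_mul_left]

theorem pacSucceeds_iff_expect_compl_le {X : Type} {n : ℕ}
    {A : (Fin n → X × Bool) → PMF (X → Bool)} {c : X → Bool} {μ : PMF X} {α β : ℝ} :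
    PACSucceeds A c μ α β ↔
      expect (iid (μ.map fun x => (x, c x)) n)
        (fun z => (A z).toOuterMeasure {h | err μ c h ≤ ENNReal.ofReal α}ᶜ) ≤
        ENNReal.ofReal β := by
  rw [← toOuterMeasure_bind, PACSucceeds, tsub_le_iff_right,
    ← toOuterMeasure_add_compl _ {h | err μ c h ≤ ENNReal.ofReal α}]
  exact ENNReal.add_le_add_iff_left ((toOuterMeasure_le_one _ _).trans_lt ENNReal.one_lt_top).ne

/-! ### A lower bound for local algorithms -/

theorem prod_le_prod_add_sum {ι : Type*} [DecidableEq ι] (s : Finset ι) (a b : ι → ℝ≥0∞) :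
    ∏ i ∈ s, b i ≤ ∏ i ∈ s, a i + ∑ i ∈ s, (b i - a i) * ∏ j ∈ s.erase i, b j := by
  induction s using Finset.induction_on with
  | empty => simp
  | insert k s hk ih =>
    have hsum : ∑ i ∈ s, (b i - a i) * ∏ j ∈ (insert k s).erase i, b j =
        b k * ∑ i ∈ s, (b i - a i) * ∏ j ∈ s.erase i, b j := by
      rw [Finset.mul_sum]
      refine Finset.sum_congr rfl fun i hi => ?_
      have hki : k ≠ i := fun h => hk (h ▸ hi)
      rw [Finset.erase_insert_of_ne hki,
        Finset.prod_insert fun h => hk (Finset.mem_of_mem_erase h), mul_left_comm]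
    rw [Finset.prod_insert hk, Finset.prod_insert hk, Finset.sum_insert hk,
      Finset.erase_insert hk, hsum]
    generalize ∑ i ∈ s, (b i - a i) * ∏ j ∈ s.erase i, b j = E at ih ⊢
    generalize ∏ i ∈ s, b i = B at ih ⊢
    generalize ∏ i ∈ s, a i = A at ih ⊢
    rcases le_total (a k) (b k) with h | h
    · calc b k * B = a k * B + (b k - a k) * B := by rw [← add_mul, add_tsub_cancel_of_le h]
        _ ≤ a k * (A + E) + (b k - a k) * B := by gcongr
        _ = a k * A + ((b k - a k) * B + a k * E) := by ring
        _ ≤ _ := by gcongr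
    · calc b k * B ≤ b k * (A + E) := by gcongr
        _ ≤ a k * A + ((b k - a k) * B + b k * E) := by
          rw [mul_add]
          gcongr
          exact le_add_self

theorem card_mul_prod_le_sum_prod {ι κ : Type*} [Fintype ι] [Fintype κ] (a : ι → κ → ℝ≥0∞)
    (b : κ → ℝ≥0∞) {δ : ℝ≥0∞} (h : ∀ i, ∑ r, (b i - a r i) ≤ δ * b i) (s : Finset ι) :
    s.card * ∏ i, b i ≤ ∑ r ∈ s, ∏ i, a r i + Fintype.card κ * δ * ∏ i, b i := by
  classical
  calc (s.card : ℝ≥0∞) * ∏ i, b i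
      = ∑ r ∈ s, ∏ i, b i := by rw [Finset.sum_const, nsmul_eq_mul]
    _ ≤ ∑ r ∈ s, (∏ i, a r i + ∑ i, (b i - a r i) * ∏ j ∈ Finset.univ.erase i, b j) :=
        Finset.sum_le_sum fun _ _ => prod_le_prod_add_sum _ _ _
    _ = ∑ r ∈ s, ∏ i, a r i + ∑ i, (∑ r ∈ s, (b i - a r i)) * ∏ j ∈ Finset.univ.erase i, b j := by
        simp only [Finset.sum_add_distrib, Finset.sum_mul]
        rw [Finset.sum_comm]
    _ ≤ ∑ r ∈ s, ∏ i, a r i + ∑ i, δ * b i * ∏ j ∈ Finset.univ.erase i, b j := by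
        gcongr with i
        exact (Finset.sum_le_sum_of_subset (Finset.subset_univ s)).trans (h i)
    _ = _ := by
        simp only [mul_assoc, Finset.mul_prod_erase _ _ (Finset.mem_univ _), Finset.sum_const,
          Finset.card_univ, nsmul_eq_mul]

namespace LocalProtocol

section Reweight

variable {D W : Type} {n : ℕ}

/-- Weights on the values of the database entries, updated after the randomizer `R` has answered `w`
at entry `i`. Started from constant weights, the weight of `u` at entry `j` is the likelihood, given
that this entry is `u`, of the answers obtained from it. -/
noncomputable def reweight (g : Fin n → D → ℝ≥0∞) (i : Fin n) (R : D → PMF W) (w : W)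
    (j : Fin n) (u : D) : ℝ≥0∞ :=
  g j u * if j = i then R u w else 1

theorem prod_reweight (g : Fin n → D → ℝ≥0∞) (i : Fin n) (R : D → PMF W) (w : W)
    (z : Fin n → D) :
    ∏ j, reweight g i R w j (z j) = (∏ j, g j (z j)) * R (z i) w := by
  simp only [reweight]
  rw [Finset.prod_mul_distrib, Finset.prod_ite_eq' Finset.univ i fun j => R (z j) w,
    if_pos (Finset.mem_univ i)]

theorem tsum_prod_expect_reweight (μ : PMF D) (g : Fin n → D → ℝ≥0∞) (i : Fin n)
    (R : D → PMF W) :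
    ∑' w, ∏ j, expect μ (reweight g i R w j) = ∏ j, expect μ (g j) := by
  simp only [← expect_iid_prod, prod_reweight, ← expect_tsum, ENNReal.tsum_mul_left, PMF.tsum_coe,
    mul_one]

theorem prod_expect_reweight_eq_zero (μ : PMF D) (g : Fin n → D → ℝ≥0∞) (i : Fin n)
    {R : D → PMF W} {w : W} (hw : ¬∃ u, w ∈ (R u).support) :
    ∏ j, expect μ (reweight g i R w j) = 0 := by
  have hR : ∀ u, R u w = 0 := fun u => by_contra fun h => hw ⟨u, h⟩
  simp only [← expect_iid_prod, prod_reweight, hR, mul_zero, expect_const]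

theorem reweight_le {g : Fin n → D → ℝ≥0∞} {ε ε₁ : ℝ} {b : Fin n → ℝ} {i : Fin n}
    {R : D → PMF W} (hg : ∀ j u u', g j u ≤ ENNReal.ofReal (Real.exp (ε - b j)) * g j u')
    (hR : LocalRandomizer ε₁ R) (w : W) (j : Fin n) (u u' : D) :
    reweight g i R w j u ≤
      ENNReal.ofReal (Real.exp (ε - Function.update b i (b i - ε₁) j)) *
        reweight g i R w j u' := by
  rcases eq_or_ne j i with rfl | hj
  · simp only [reweight, if_true, Function.update_self]
    calc g j u * R u w
        ≤ (ENNReal.ofReal (Real.exp (ε - b j)) * g j u') *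
            (ENNReal.ofReal (Real.exp ε₁) * R u' w) := mul_le_mul' (hg j u u') (hR u u' w)
      _ = ENNReal.ofReal (Real.exp (ε - b j) * Real.exp ε₁) * (g j u' * R u' w) := by
          rw [ENNReal.ofReal_mul (Real.exp_nonneg _)]
          ring
      _ = _ := by rw [← Real.exp_add, sub_sub_eq_add_sub, sub_add_eq_add_sub]
  · simpa only [reweight, if_neg hj, mul_one, Function.update_of_ne hj] using hg j u u'

end Reweight

section LowerBound

variable {ι D O : Type} {n : ℕ}

theorem expect_mul_run_toss (μ : PMF D) (g : Fin n → D → ℝ≥0∞) (S : Set O) {A : Type} (ν : PMF A)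
    (next : A → LocalProtocol D n O) :
    expect (iid μ n) (fun z => (∏ i, g i (z i)) * ((toss ν next).run z).toOuterMeasure S) =
      expect ν fun a =>
        expect (iid μ n) fun z => (∏ i, g i (z i)) * ((next a).run z).toOuterMeasure S := by
  simp only [run, toOuterMeasure_bind, ← expect_mul_left]
  exact expect_comm _ _ _

theorem expect_mul_run_query (μ : PMF D) (g : Fin n → D → ℝ≥0∞) (S : Set O) (i : Fin n) {W : Type}
    (R : D → PMF W) (next : W → LocalProtocol D n O) :
    expect (iid μ n) (fun z => (∏ i, g i (z i)) * ((query i R next).run z).toOuterMeasure S) =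
      ∑' w, expect (iid μ n) fun z =>
        (∏ j, reweight g i R w j (z j)) * ((next w).run z).toOuterMeasure S := by
  simp only [run, PMF.toOuterMeasure_bind_apply, ← ENNReal.tsum_mul_left, ← expect_tsum,
    prod_reweight, mul_assoc]

variable [Fintype ι]

theorem sum_expect_mul_run_output (μ : ι → PMF D) (g : Fin n → D → ℝ≥0∞) (bad : ι → Set O)
    (o : O) [DecidablePred fun r => o ∈ bad r] :
    ∑ r, expect (iid (μ r) n)
        (fun z => (∏ i, g i (z i)) * ((output o).run z).toOuterMeasure (bad r)) =
      ∑ r with o ∈ bad r, ∏ i, expect (μ r) (g i) := by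
  rw [Finset.sum_filter]
  refine Finset.sum_congr rfl fun r _ => ?_
  simp only [run, PMF.toOuterMeasure_pure_apply]
  rw [expect_mul_right, expect_iid_prod, mul_ite, mul_one, mul_zero]
  congr

variable {μ : ι → PMF D} {μ₀ : PMF D} {ε : ℝ} {δ : ℝ≥0∞} {bad : ι → Set O} {N : ℕ}

theorem le_weighted_sum_failure
    (hδ : ∀ g : D → ℝ≥0∞, (∀ u u', g u ≤ ENNReal.ofReal (Real.exp ε) * g u') →
      ∑ r, (expect μ₀ g - expect (μ r) g) ≤ δ * expect μ₀ g)
    (hN : ∀ o, N ≤ {r | o ∈ bad r}.ncard)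
    (P : LocalProtocol D n O) (b : Fin n → ℝ) (hP : P.WithinBudget b) (hb : ∀ i, 0 ≤ b i)
    (g : Fin n → D → ℝ≥0∞)
    (hg : ∀ i u u', g i u ≤ ENNReal.ofReal (Real.exp (ε - b i)) * g i u') :
    N * ∏ i, expect μ₀ (g i) ≤
      ∑ r, expect (iid (μ r) n) (fun z => (∏ i, g i (z i)) * (P.run z).toOuterMeasure (bad r)) +
        n * δ * ∏ i, expect μ₀ (g i) := by
  classical
  induction P generalizing b g with
  | output o =>
    have hcard : N ≤ (Finset.univ.filter fun r => o ∈ bad r).card := by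
      simpa only [Set.ncard_eq_toFinset_card', Set.toFinset_ofPred] using hN o
    have hratio : ∀ i, ∑ r, (expect μ₀ (g i) - expect (μ r) (g i)) ≤ δ * expect μ₀ (g i) := by
      refine fun i => hδ _ fun u u' => (hg i u u').trans ?_
      gcongr
      exact sub_le_self ε (hb i)
    have hsum := card_mul_prod_le_sum_prod (fun r i => expect (μ r) (g i)) _ hratio
      (Finset.univ.filter fun r => o ∈ bad r)
    rw [Fintype.card_fin, ← sum_expect_mul_run_output] at hsum
    exact hsum.trans' (by gcongr)
  | toss ν next ih =>
    simp only [expect_mul_run_toss, ← expect_sum]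
    rw [← expect_const ν (N * _), ← expect_const ν (n * δ * _), ← expect_add]
    exact expect_mono fun a ha => ih a b (hP a ha) hb g hg
  | query i R next ih =>
    obtain ⟨ε₁, -, hε₁, hR, hnext⟩ := hP
    simp only [expect_mul_run_query, ← tsum_prod_expect_reweight μ₀ g i R]
    rw [← Summable.tsum_finsetSum fun _ _ => ENNReal.summable, ← ENNReal.tsum_mul_left,
      ← ENNReal.tsum_mul_left, ← ENNReal.tsum_add]
    refine ENNReal.tsum_le_tsum fun w => ?_
    by_cases hw : ∃ u, w ∈ (R u).support
    · refine ih w _ (hnext w hw) (fun j => ?_) (reweight g i R w) (reweight_le hg hR w)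
      rcases eq_or_ne j i with rfl | hj
      · simpa only [Function.update_self, sub_nonneg] using hε₁
      · simpa only [Function.update_of_ne hj] using hb j
    · rw [prod_expect_reweight_eq_zero μ₀ g i hw, mul_zero]
      exact zero_le

/-- Taking for `g` the likelihood of an answer as a function of the entry, `hδ` says that a single
`ε`-local randomizer can hardly tell the `μ r` from `μ₀`. -/
theorem le_sum_failure (hε : 0 ≤ ε)
    (hδ : ∀ g : D → ℝ≥0∞, (∀ u u', g u ≤ ENNReal.ofReal (Real.exp ε) * g u') →
      ∑ r, (expect μ₀ g - expect (μ r) g) ≤ δ * expect μ₀ g)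
    (hN : ∀ o, N ≤ {r | o ∈ bad r}.ncard)
    (P : LocalProtocol D n O) (hP : P.IsLocal ε) :
    N ≤ ∑ r, expect (iid (μ r) n) (fun z => (P.run z).toOuterMeasure (bad r)) + n * δ := by
  simpa only [Finset.prod_const_one, expect_const, one_mul, mul_one] using
    le_weighted_sum_failure hδ hN P _ hP (fun _ => hε) (fun _ _ => 1) (by simp)

end LowerBound

end LocalProtocol

/-! ### Inner products modulo 2 -/

@[simp] theorem parityBit_nil_left (x : List Bool) : parityBit [] x = false := rfl

@[simp] theorem parityBit_nil_right (r : List Bool) : parityBit r [] = false := by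
  cases r <;> rfl

@[simp] theorem parityBit_cons (a b : Bool) (r x : List Bool) :
    parityBit (a :: r) (b :: x) = xor (a && b) (parityBit r x) := rfl

theorem parityBit_comm (r x : List Bool) : parityBit r x = parityBit x r := by
  induction r generalizing x with
  | nil => simp
  | cons a r ih => cases x <;> simp [ih, Bool.and_comm]

/-- The sum of two bit vectors. -/
def bitAdd (a b : List Bool) : List Bool := List.zipWith xor a b

@[simp] theorem bitAdd_cons (a b : Bool) (r x : List Bool) :
    bitAdd (a :: r) (b :: x) = xor a b :: bitAdd r x := rfl

theorem length_bitAdd (a b : List Bool) : (bitAdd a b).length = min a.length b.length :=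
  List.length_zipWith

theorem parityBit_bitAdd (x : List Bool) {a b : List Bool} (h : a.length = b.length) :
    parityBit x (bitAdd a b) = xor (parityBit x a) (parityBit x b) := by
  induction a generalizing b x with
  | nil => simp [bitAdd, List.length_eq_zero_iff.1 h.symm]
  | cons u a ih =>
    rcases b with _ | ⟨v, b⟩
    · simp at h
    rcases x with _ | ⟨w, x⟩
    · simp
    rw [bitAdd_cons, parityBit_cons, parityBit_cons, parityBit_cons, ih x (Nat.succ.inj h)]
    cases w <;> cases u <;> cases v <;> simp

theorem bitAdd_bitAdd_cancel {a b : List Bool} (h : a.length = b.length) :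
    bitAdd a (bitAdd a b) = b := by
  induction a generalizing b with
  | nil => simp [bitAdd, List.length_eq_zero_iff.1 h.symm]
  | cons u a ih =>
    rcases b with _ | ⟨v, b⟩
    · simp at h
    rw [bitAdd_cons, bitAdd_cons, ih (Nat.succ.inj h), ← Bool.xor_assoc, Bool.xor_self,
      Bool.false_xor]

theorem parityBit_replicate_false (n : ℕ) (x : List Bool) :
    parityBit (List.replicate n false) x = false := by
  induction n generalizing x with
  | zero => simp
  | succ n ih => cases x <;> simp [List.replicate_succ, ih]

theorem exists_parityBit_ne {x y : List Bool} (h : x.length = y.length) (hne : x ≠ y) :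
    ∃ r : List Bool, r.length = x.length ∧ parityBit r x ≠ parityBit r y := by
  induction x generalizing y with
  | nil => exact absurd (List.length_eq_zero_iff.1 h.symm).symm hne
  | cons u x ih =>
    rcases y with _ | ⟨v, y⟩
    · simp at h
    rcases eq_or_ne u v with rfl | huv
    · obtain ⟨r, hr, hrxy⟩ := ih (Nat.succ.inj h) fun hxy => hne (by rw [hxy])
      exact ⟨false :: r, by simp [hr], by simpa using hrxy⟩
    · exact ⟨true :: List.replicate x.length false, by simp,
        by simpa [parityBit_replicate_false] using huv⟩

instance instFintypeDomain (d : ℕ) : Fintype (PARITY.domain d) :=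
  inferInstanceAs (Fintype (List.Vector Bool d))

instance instNonemptyDomain (d : ℕ) : Nonempty (PARITY.domain d) :=
  ⟨⟨List.replicate d false, List.length_replicate⟩⟩

section Domain

variable {d : ℕ}

variable (d) in
theorem card_domain : Fintype.card (PARITY.domain d) = 2 ^ d :=
  (card_vector d).trans (by rw [Fintype.card_bool])

theorem length_of_domain (x : PARITY.domain d) : x.1.length = d := x.2

theorem length_eq_of_domain (x y : PARITY.domain d) : x.1.length = y.1.length :=
  (length_of_domain x).trans (length_of_domain y).symm

/-- The concept `c_r` of `PARITY`. -/
def parityFun (r : List Bool) (x : PARITY.domain d) : Bool := parityBit r x.1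

theorem mem_concepts_iff {c : PARITY.domain d → Bool} :
    c ∈ PARITY.concepts d ↔ ∃ r : PARITY.domain d, c = parityFun r.1 := by
  constructor
  · rintro ⟨s, hs⟩
    simp only [PARITY] at hs
    split_ifs at hs with h
    exact ⟨⟨s, h⟩, (Option.some.inj hs).symm⟩
  · rintro ⟨r, rfl⟩
    exact ⟨r.1, if_pos r.2⟩

/-- Translation by `a` on `{0,1}^d`. -/
def translate (a : PARITY.domain d) : PARITY.domain d ≃ PARITY.domain d :=
  Function.Involutive.toPerm
    (fun x => ⟨bitAdd a.1 x.1, (length_bitAdd _ _).trans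
      (by rw [length_of_domain, length_of_domain, min_self])⟩)
    fun x => Subtype.ext (bitAdd_bitAdd_cancel (length_eq_of_domain a x))

theorem parityBit_translate (s : List Bool) (a x : PARITY.domain d) :
    parityBit s (translate a x).1 = xor (parityBit s a.1) (parityBit s x.1) :=
  parityBit_bitAdd s (length_eq_of_domain a x)

theorem exists_parityBit_domain_ne {x y : PARITY.domain d} (h : x ≠ y) :
    ∃ r : PARITY.domain d, parityBit x.1 r.1 ≠ parityBit y.1 r.1 := by
  obtain ⟨r, hlength, hr⟩ := exists_parityBit_ne (length_eq_of_domain x y) fun hxy =>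
    h (Subtype.ext hxy)
  exact ⟨⟨r, hlength.trans x.2⟩, by rwa [parityBit_comm x.1, parityBit_comm y.1]⟩

/-! ### Characters -/

/-- The character `(-1)^{r ⊙ x}`. -/
noncomputable def chi (r x : List Bool) : ℝ := if parityBit r x then -1 else 1

theorem chi_comm (r x : List Bool) : chi r x = chi x r := by rw [chi, chi, parityBit_comm]

theorem chi_mul_self (r x : List Bool) : chi r x * chi r x = 1 := by
  unfold chi; split_ifs <;> norm_num

theorem chi_mul_chi_of_ne {r x s y : List Bool} (h : parityBit r x ≠ parityBit s y) :
    chi r x * chi s y = -1 := by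
  unfold chi
  split_ifs with hrx hsy hsy <;> simp_all

theorem chi_translate (s : List Bool) (a x : PARITY.domain d) :
    chi s (translate a x).1 = chi s a.1 * chi s x.1 := by
  unfold chi
  rw [parityBit_translate]
  cases parityBit s a.1 <;> cases parityBit s x.1 <;> norm_num

theorem sum_chi_mul_chi {x y : PARITY.domain d} (h : x ≠ y) :
    ∑ r : PARITY.domain d, chi x.1 r.1 * chi y.1 r.1 = 0 := by
  obtain ⟨t, ht⟩ := exists_parityBit_domain_ne h
  have hneg : ∀ r, chi x.1 (translate t r).1 * chi y.1 (translate t r).1 =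
      -(chi x.1 r.1 * chi y.1 r.1) := fun r => by
    rw [chi_translate, chi_translate, mul_mul_mul_comm, chi_mul_chi_of_ne ht, neg_one_mul]
  have hsum := Equiv.sum_comp (translate t) fun r => chi x.1 r.1 * chi y.1 r.1
  simp only [hneg, Finset.sum_neg_distrib] at hsum
  linarith

theorem sum_sq_sum_chi_mul (Δ : PARITY.domain d → ℝ) :
    ∑ r : PARITY.domain d, (∑ x : PARITY.domain d, chi x.1 r.1 * Δ x) ^ 2 =
      2 ^ d * ∑ x, Δ x ^ 2 := by
  have hexpand : ∀ r : PARITY.domain d, (∑ x : PARITY.domain d, chi x.1 r.1 * Δ x) ^ 2 =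
      ∑ x : PARITY.domain d, ∑ y : PARITY.domain d,
        chi x.1 r.1 * chi y.1 r.1 * (Δ x * Δ y) := fun r => by
    simp only [sq, Finset.sum_mul_sum, mul_mul_mul_comm]
  simp only [hexpand]
  rw [Finset.sum_comm, Finset.mul_sum]
  refine Finset.sum_congr rfl fun x _ => ?_
  rw [Finset.sum_comm, Finset.sum_eq_single x]
  · simp only [chi_mul_self, one_mul, Finset.sum_const, Finset.card_univ, card_domain, sq,
      nsmul_eq_mul, Nat.cast_pow, Nat.cast_ofNat]
  · intro y _ hy
    rw [← Finset.sum_mul, sum_chi_mul_chi hy.symm, zero_mul]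
  · exact fun hx => absurd (Finset.mem_univ x) hx

theorem sum_abs_sum_chi_mul_le (Δ : PARITY.domain d → ℝ) {M : ℝ} (hM : ∀ x, |Δ x| ≤ M) :
    ∑ r : PARITY.domain d, |∑ x : PARITY.domain d, chi x.1 r.1 * Δ x| ≤
      2 ^ d * (√(2 ^ d) * M) := by
  have hM0 : 0 ≤ M := (abs_nonneg _).trans (hM (Classical.arbitrary _))
  have hsq : ∑ x, Δ x ^ 2 ≤ 2 ^ d * M ^ 2 := by
    calc ∑ x, Δ x ^ 2 ≤ ∑ _x : PARITY.domain d, M ^ 2 :=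
          Finset.sum_le_sum fun x _ => sq_le_sq' (abs_le.1 (hM x)).1 (abs_le.1 (hM x)).2
      _ = 2 ^ d * M ^ 2 := by
        rw [Finset.sum_const, Finset.card_univ, card_domain, nsmul_eq_mul, Nat.cast_pow,
          Nat.cast_ofNat]
  refine le_of_sq_le_sq ?_ (by positivity)
  calc (∑ r : PARITY.domain d, |∑ x : PARITY.domain d, chi x.1 r.1 * Δ x|) ^ 2
      ≤ 2 ^ d * ∑ r : PARITY.domain d, |∑ x : PARITY.domain d, chi x.1 r.1 * Δ x| ^ 2 := by
        simpa only [Finset.card_univ, card_domain, Nat.cast_pow, Nat.cast_ofNat] using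
          sq_sum_le_card_mul_sum_sq (s := Finset.univ)
            (f := fun r : PARITY.domain d => |∑ x : PARITY.domain d, chi x.1 r.1 * Δ x|)
    _ = 2 ^ d * (2 ^ d * ∑ x, Δ x ^ 2) := by simp only [sq_abs, sum_sq_sum_chi_mul]
    _ ≤ 2 ^ d * (2 ^ d * (2 ^ d * M ^ 2)) := by gcongr
    _ = (2 ^ d * (√(2 ^ d) * M)) ^ 2 := by
        rw [mul_pow, mul_pow, Real.sq_sqrt (by positivity)]
        ring

end Domain

/-! ### Parities are hard for local algorithms -/

section Uniform

variable {α : Type*} [Fintype α]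

theorem expect_fintype (μ : PMF α) (g : α → ℝ≥0∞) : expect μ g = ∑ u, μ u * g u := tsum_fintype _

variable [Nonempty α]

theorem expect_uniformOfFintype_ofReal {f : α → ℝ} (hf : ∀ u, 0 ≤ f u) :
    expect (PMF.uniformOfFintype α) (fun u => ENNReal.ofReal (f u)) =
      ENNReal.ofReal ((∑ u, f u) / Fintype.card α) := by
  rw [expect_fintype, ENNReal.ofReal_div_of_pos (by exact_mod_cast Fintype.card_pos),
    ENNReal.ofReal_sum_of_nonneg fun u _ => hf u, ENNReal.ofReal_natCast, ENNReal.div_eq_inv_mul]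
  simp only [PMF.uniformOfFintype_apply, ← Finset.mul_sum]

theorem expect_uniformOfFintype_eq_top {g : α → ℝ≥0∞} {u : α} (hu : g u = ⊤) :
    expect (PMF.uniformOfFintype α) g = ⊤ :=
  ENNReal.tsum_eq_top_of_eq_top ⟨u, by
    rw [hu, PMF.uniformOfFintype_apply]
    exact ENNReal.mul_top (ENNReal.inv_ne_zero.2 (ENNReal.natCast_ne_top _))⟩

theorem toOuterMeasure_uniformOfFintype_preimage (e : α ≃ α) (S : Set α) :
    (PMF.uniformOfFintype α).toOuterMeasure (e ⁻¹' S) =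
      (PMF.uniformOfFintype α).toOuterMeasure S := by
  classical
  rw [PMF.toOuterMeasure_apply_fintype, PMF.toOuterMeasure_apply_fintype,
    ← e.sum_comp (S.indicator _)]
  simp only [Set.indicator_apply, Set.mem_preimage, PMF.uniformOfFintype_apply]

theorem le_mul_average_of_le_mul {f : α → ℝ} {K : ℝ} (hf : ∀ u u', f u ≤ K * f u') (u : α) :
    f u ≤ K * ((∑ u', f u') / Fintype.card α) := by
  rw [← mul_div_assoc, le_div_iff₀ (by exact_mod_cast Fintype.card_pos), Finset.mul_sum, mul_comm,
    ← nsmul_eq_mul, ← Finset.card_univ]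
  exact Finset.card_nsmul_le_sum _ _ _ fun u' _ => hf u u'

end Uniform

section Hardness

variable {d : ℕ}

/-- The distribution of labeled examples for the target `c_r` and the uniform distribution. -/
noncomputable def parityExamples (d : ℕ) (r : PARITY.domain d) : PMF (PARITY.Example d) :=
  (PMF.uniformOfFintype (PARITY.domain d)).map fun x => (x, parityFun r.1 x)

/-- The deviation of `f` at the two labels of `x` from its average over these labels. -/
noncomputable def labelDeviation (f : PARITY.Example d → ℝ) (x : PARITY.domain d) : ℝ :=
  (f (x, true) - f (x, false)) / 2

theorem abs_labelDeviation_le {f : PARITY.Example d → ℝ} (hf : ∀ u, 0 ≤ f u) {B : ℝ}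
    (hB : ∀ u, f u ≤ B) (x : PARITY.domain d) : |labelDeviation f x| ≤ B / 2 := by
  have := hf (x, true)
  have := hf (x, false)
  have := hB (x, true)
  have := hB (x, false)
  rw [labelDeviation, abs_le]
  constructor <;> linarith

variable (d) in
theorem card_example : Fintype.card (PARITY.Example d) = 2 ^ d * 2 := by
  rw [Fintype.card_prod, card_domain, Fintype.card_bool]

theorem expect_parityExamples_ofReal {f : PARITY.Example d → ℝ} (hf : ∀ u, 0 ≤ f u)
    (r : PARITY.domain d) :
    expect (parityExamples d r) (fun u => ENNReal.ofReal (f u)) =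
      ENNReal.ofReal ((∑ u, f u) / Fintype.card (PARITY.Example d) -
        (∑ x : PARITY.domain d, chi x.1 r.1 * labelDeviation f x) / 2 ^ d) := by
  have hlabel : ∀ x : PARITY.domain d, f (x, parityFun r.1 x) =
      (f (x, true) + f (x, false)) / 2 - chi x.1 r.1 * labelDeviation f x := by
    intro x
    rw [chi_comm, chi, labelDeviation, parityFun]
    cases parityBit r.1 x.1 <;> simp <;> ring
  have hsum : ∑ u, f u = ∑ x, (f (x, true) + f (x, false)) := by
    simp only [Fintype.sum_prod_type, Fintype.sum_bool]
  rw [parityExamples, expect_map, expect_uniformOfFintype_ofReal fun x => hf _, card_domain,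
    card_example, hsum]
  simp only [hlabel, Finset.sum_sub_distrib, ← Finset.sum_div]
  push_cast
  congr 1
  field_simp

theorem sum_expect_ofReal_sub_expect_parityExamples_le {f : PARITY.Example d → ℝ} {K : ℝ}
    (hK : 0 ≤ K) (hf : ∀ u, 0 ≤ f u) (hfK : ∀ u u', f u ≤ K * f u') :
    ∑ r, (expect (PMF.uniformOfFintype (PARITY.Example d)) (fun u => ENNReal.ofReal (f u)) -
      expect (parityExamples d r) fun u => ENNReal.ofReal (f u)) ≤
        ENNReal.ofReal (K / 2 * √(2 ^ d)) *
          expect (PMF.uniformOfFintype (PARITY.Example d)) fun u => ENNReal.ofReal (f u) := by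
  simp only [expect_uniformOfFintype_ofReal hf, expect_parityExamples_ofReal hf]
  have hbound := sum_abs_sum_chi_mul_le _ (abs_labelDeviation_le hf (le_mul_average_of_le_mul hfK))
  set m := (∑ u, f u) / Fintype.card (PARITY.Example d)
  set correlation := fun r : PARITY.domain d =>
    ∑ x : PARITY.domain d, chi x.1 r.1 * labelDeviation f x
  have hsub : ∀ r, ENNReal.ofReal m - ENNReal.ofReal (m - correlation r / 2 ^ d) ≤
      ENNReal.ofReal (|correlation r| / 2 ^ d) := by
    intro r
    rw [tsub_le_iff_right]
    refine (ENNReal.ofReal_le_ofReal ?_).trans ENNReal.ofReal_add_le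
    have : correlation r / 2 ^ d ≤ |correlation r| / 2 ^ d := by gcongr; exact le_abs_self _
    linarith
  calc ∑ r, (ENNReal.ofReal m - ENNReal.ofReal (m - correlation r / 2 ^ d))
      ≤ ∑ r, ENNReal.ofReal (|correlation r| / 2 ^ d) := Finset.sum_le_sum fun r _ => hsub r
    _ = ENNReal.ofReal ((∑ r, |correlation r|) / 2 ^ d) := by
        rw [Finset.sum_div, ENNReal.ofReal_sum_of_nonneg fun r _ => by positivity]
    _ ≤ ENNReal.ofReal (K / 2 * √(2 ^ d) * m) := by
        refine ENNReal.ofReal_le_ofReal ((div_le_iff₀ (by positivity)).2 (hbound.trans_eq ?_))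
        ring
    _ = ENNReal.ofReal (K / 2 * √(2 ^ d)) * ENNReal.ofReal m := ENNReal.ofReal_mul (by positivity)

theorem sum_expect_sub_expect_parityExamples_le {ε : ℝ} {g : PARITY.Example d → ℝ≥0∞}
    (hg : ∀ u u', g u ≤ ENNReal.ofReal (Real.exp ε) * g u') :
    ∑ r, (expect (PMF.uniformOfFintype (PARITY.Example d)) g - expect (parityExamples d r) g) ≤
      ENNReal.ofReal (Real.exp ε / 2 * √(2 ^ d)) *
        expect (PMF.uniformOfFintype (PARITY.Example d)) g := by
  by_cases hfin : ∀ u, g u ≠ ⊤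
  · lift g to PARITY.Example d → NNReal using hfin
    have := sum_expect_ofReal_sub_expect_parityExamples_le (f := fun u => g u)
      (Real.exp_nonneg ε) (fun u => (g u).2) fun u u' => by
        simpa only [ENNReal.ofReal, ← ENNReal.coe_mul, ENNReal.coe_le_coe, ← NNReal.coe_le_coe,
          NNReal.coe_mul, Real.coe_toNNReal _ (Real.exp_nonneg ε)] using hg u u'
    simpa only [ENNReal.ofReal_coe_nnreal] using this
  · push Not at hfin
    obtain ⟨u, hu⟩ := hfin
    rw [expect_uniformOfFintype_eq_top hu, ENNReal.mul_top
      (ENNReal.ofReal_pos.2 (by positivity)).ne']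
    exact le_top

theorem toOuterMeasure_parityFun_ne {r s : PARITY.domain d} (h : r ≠ s) :
    (PMF.uniformOfFintype (PARITY.domain d)).toOuterMeasure
      {x | parityFun r.1 x ≠ parityFun s.1 x} = 2⁻¹ := by
  obtain ⟨t, ht⟩ := exists_parityBit_domain_ne h
  have hcompl : translate t ⁻¹' {x | parityFun r.1 x ≠ parityFun s.1 x} =
      {x | parityFun r.1 x ≠ parityFun s.1 x}ᶜ := by
    ext x
    simp only [parityFun, Set.mem_preimage, Set.mem_ofPred_eq, Set.mem_compl_iff,
      parityBit_translate]
    revert ht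
    cases parityBit r.1 t.1 <;> cases parityBit s.1 t.1 <;> simp
  have hadd := toOuterMeasure_add_compl (PMF.uniformOfFintype (PARITY.domain d))
    {x | parityFun r.1 x ≠ parityFun s.1 x}
  rw [← hcompl, toOuterMeasure_uniformOfFintype_preimage, ← mul_two] at hadd
  exact ENNReal.eq_inv_of_mul_eq_one_left hadd

theorem toOuterMeasure_ne_le_err_add_err {X : Type} (μ : PMF X) (c c' h : X → Bool) :
    μ.toOuterMeasure {x | c x ≠ c' x} ≤ err μ c h + err μ c' h := by
  refine (MeasureTheory.measure_mono fun x hx => ?_).trans (MeasureTheory.measure_union_le _ _)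
  by_contra hagree
  simp only [Set.mem_union, Set.mem_ofPred_eq, not_or, not_not] at hagree
  exact hx (hagree.1.symm.trans hagree.2)

theorem le_ncard_inaccurate {a : ℝ≥0∞} (ha : a < 4⁻¹) (h : PARITY.domain d → Bool) :
    2 ^ d - 1 ≤ {r : PARITY.domain d |
      ¬ err (PMF.uniformOfFintype (PARITY.domain d)) (parityFun r.1) h ≤ a}.ncard := by
  set accurate := {r : PARITY.domain d |
    err (PMF.uniformOfFintype (PARITY.domain d)) (parityFun r.1) h ≤ a} with haccurate
  have hunique : accurate.ncard ≤ 1 := by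
    rw [Set.ncard_le_one]
    intro r hr s hs
    by_contra hne
    have hhalf : (2⁻¹ : ℝ≥0∞) ≤ a + a := (toOuterMeasure_parityFun_ne hne).ge.trans
      ((toOuterMeasure_ne_le_err_add_err _ _ _ h).trans (add_le_add hr hs))
    have hquarters : (4⁻¹ : ℝ≥0∞) + 4⁻¹ = 2⁻¹ := by
      rw [show (4 : ℝ≥0∞) = 2 * 2 by norm_num, ENNReal.mul_inv (by simp) (by simp), ← mul_add,
        ENNReal.inv_two_add_inv_two, mul_one]
    exact (hhalf.trans_lt (ENNReal.add_lt_add ha ha)).ne hquarters.symm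
  have hcompl := Set.ncard_add_ncard_compl accurate
  rw [Nat.card_eq_fintype_card, card_domain] at hcompl
  rw [← Set.compl_ofPred, ← haccurate]
  omega

theorem LocalProtocol.sqrt_two_pow_lt_of_pacSucceeds {n : ℕ} {O : Type}
    {P : LocalProtocol (PARITY.Example d) n O} (hP : P.IsLocal 1)
    (hyp : O → PARITY.domain d → Bool)
    (h : ∀ c ∈ PARITY.concepts d, ∀ μ : PMF (PARITY.domain d),
      PACSucceeds (fun z => (P.run z).map hyp) c μ (1 / 8) (1 / 4)) :
    √(2 ^ d) < 2 * n + 2 := by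
  let bad (r : PARITY.domain d) : Set O := {o | ¬ err (PMF.uniformOfFintype (PARITY.domain d))
    (parityFun r.1) (hyp o) ≤ ENNReal.ofReal (1 / 8)}
  have heighth : ENNReal.ofReal (1 / 8) < 4⁻¹ := by
    rw [← ENNReal.ofReal_ofNat 4, ← ENNReal.ofReal_inv_of_pos (by norm_num),
      ENNReal.ofReal_lt_ofReal_iff (by norm_num)]
    norm_num
  have hfail : ∀ r : PARITY.domain d, expect (iid (parityExamples d r) n)
      (fun z => (P.run z).toOuterMeasure (bad r)) ≤ ENNReal.ofReal (1 / 4) := by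
    intro r
    have := pacSucceeds_iff_expect_compl_le.1
      (h _ (mem_concepts_iff.2 ⟨r, rfl⟩) (PMF.uniformOfFintype (PARITY.domain d)))
    simp only [PMF.toOuterMeasure_map_apply] at this
    exact this
  have hcount := (LocalProtocol.le_sum_failure zero_le_one
    (fun _ => sum_expect_sub_expect_parityExamples_le) (bad := bad)
    (fun o => le_ncard_inaccurate heighth (hyp o)) P hP).trans
      (add_le_add_left (Finset.sum_le_sum fun r _ => hfail r) _)
  rw [Finset.sum_const, Finset.card_univ, card_domain, nsmul_eq_mul,
    ← ENNReal.ofReal_natCast (2 ^ d), ← ENNReal.ofReal_mul (by positivity),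
    ← ENNReal.ofReal_natCast n, ← ENNReal.ofReal_mul (by positivity),
    ← ENNReal.ofReal_natCast, ← ENNReal.ofReal_add (by positivity) (by positivity),
    ENNReal.ofReal_le_ofReal_iff (by positivity), Nat.cast_sub Nat.one_le_two_pow] at hcount
  push_cast at hcount
  have hsq : √(2 ^ d) * √(2 ^ d) = (2 : ℝ) ^ d := Real.mul_self_sqrt (by positivity)
  have hexp : (n * √(2 ^ d)) * Real.exp 1 ≤ (n * √(2 ^ d)) * 3 := by
    gcongr
    exact Real.exp_one_lt_three.le
  by_contra! hlarge
  nlinarith [n.cast_nonneg (α := ℝ)]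

theorem exists_bound_le_two_pow (p : MvPolynomial (Fin 4) ℕ) (a b c : ℕ) :
    ∃ d, bound p (d, a, b, c) ≤ 2 ^ d := by
  obtain ⟨P, hP⟩ : ∃ P : Polynomial ℕ, ∀ d, bound p (d, a, b, c) = P.eval d := by
    refine ⟨MvPolynomial.eval₂ Polynomial.C ![Polynomial.X, Polynomial.C a, Polynomial.C b,
      Polynomial.C c] p, fun d => ?_⟩
    induction p using MvPolynomial.induction_on with
    | C n => simp [bound]
    | add p q hp hq => simp_all [bound]
    | mul_X p i hp =>
      simp only [bound, map_mul, MvPolynomial.eval_X, MvPolynomial.eval₂_mul,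
        MvPolynomial.eval₂_X, Polynomial.eval_mul] at hp ⊢
      rw [hp]
      fin_cases i <;> simp
  have hlittleO : (fun d : ℕ => ((P.eval d : ℕ) : ℝ)) =o[Filter.atTop]
      fun d : ℕ => (2 : ℝ) ^ d := by
    clear hP
    induction P using Polynomial.induction_on' with
    | add P Q hP hQ => simpa using hP.add hQ
    | monomial k m =>
      simpa using (isLittleO_pow_const_const_pow_of_one_lt k
        (one_lt_two : (1 : ℝ) < 2)).const_mul_left (m : ℝ)
  obtain ⟨d, hd⟩ := (hlittleO.bound one_pos).exists
  refine ⟨d, hP d ▸ ?_⟩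
  simp only [Real.norm_natCast, norm_pow, Real.norm_ofNat, one_mul] at hd
  exact_mod_cast hd

theorem not_forall_pacSucceeds_of_isLocal (p : MvPolynomial (Fin 4) ℕ) {O : ℕ → Type}
    {P : (d : ℕ) → LocalProtocol (PARITY.Example d) (bound p (params d 1 (1 / 8) (1 / 4))) (O d)}
    (hP : ∀ d, (P d).IsLocal 1) (hyp : (d : ℕ) → O d → PARITY.domain d → Bool) :
    ¬ ∀ d, ∀ c ∈ PARITY.concepts d, ∀ μ : PMF (PARITY.domain d),
      PACSucceeds (fun z => ((P d).run z).map (hyp d)) c μ (1 / 8) (1 / 4) := by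
  intro h
  obtain ⟨d, hd⟩ := exists_bound_le_two_pow ((2 * p + 2) ^ 2) ⌈1 / (1 : ℝ)⌉₊ ⌈1 / (1 / 8 : ℝ)⌉₊
    ⌈Real.logb 2 (1 / (1 / 4 : ℝ))⌉₊
  have hlt := LocalProtocol.sqrt_two_pow_lt_of_pacSucceeds (hP d) (hyp d) (h d)
  rw [Real.sqrt_lt' (by positivity)] at hlt
  refine hd.not_gt ?_
  simp only [bound, map_pow, map_add, map_mul, map_ofNat] at hlt ⊢
  exact_mod_cast hlt

end Hardness

theorem not_locallyLearnable_parity : ¬ LocallyLearnable PARITY := by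
  rintro ⟨p, _, A, hA⟩
  have hA' := fun d => hA d 1 one_pos (1 / 8) (by norm_num) (1 / 4) (by norm_num)
  refine not_forall_pacSucceeds_of_isLocal p (fun d => (hA' d).1) (fun _ => id) fun d c hc => ?_
  simpa only [PMF.map_id] using ((hA' d).2 c hc).2

theorem not_efficientlyLocallyLearnable_parity : ¬ EfficientlyLocallyLearnable PARITY := by
  rintro ⟨p, _, _, _, _, _, _, E, -, -, -, hA⟩
  have hA' := fun d => hA d 1 one_pos (1 / 8) (by norm_num) (1 / 4) (by norm_num)
  exact not_forall_pacSucceeds_of_isLocal p (fun d => (hA' d).1) (fun d => hypothesis PARITY d E)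
    fun d => (hA' d).2

/-! ### The private parity learner -/

/-- Whether the first `a` coins are all `false`, an event of probability `2⁻ᵃ`. -/
def allFalse (a : ℕ) (ω : List Bool) : Bool := ((ω.take a).filter fun b => b).isEmpty

/-- A random subsample of a database, which keeps each example with probability `2⁻ᵃ`. The example
number `i` is kept according to the first `a` coins of the block number `i` of `M` coins, so that
each decision is independent of the rest of the database. -/
def keptExamples {D : Type} (a M : ℕ) : List D → List Bool → List D
  | [], _ => []
  | u :: us, ω =>
    if allFalse a ω then u :: keptExamples a M us (ω.drop M) else keptExamples a M us (ω.drop M)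

/-- The standard basis vector number `i` of `𝔽₂ᵈ`, as a string. -/
def unitVector (d i : ℕ) : List Bool := (List.replicate d false).set i true

/-- The standard basis of `𝔽₂ᵈ`, as strings. -/
def unitVectors (d : ℕ) : List (List Bool) := (List.range d).map (unitVector d)

/-- The state of the elimination for a system of linear equations over `𝔽₂`: whether the system is
consistent, vectors that span the solutions of the homogeneous system, and a solution. -/
abbrev SolverState : Type := Bool × List (List Bool) × List Bool

/-- Adding the linear equation `⟨u.1, r⟩ = u.2` in the unknown `r`. If some direction `b` violates
the homogeneous equation, then adding `b` repairs every other vector that violates it. -/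
def eliminate (st : SolverState) (u : List Bool × Bool) : SolverState :=
  match st.2.1.filter (parityBit u.1) with
  | [] => (st.1 && (parityBit u.1 st.2.2 == u.2), st.2.1, st.2.2)
  | b :: _ => (st.1, st.2.1.map fun c => if parityBit u.1 c then bitAdd c b else c,
      if parityBit u.1 st.2.2 == u.2 then st.2.2 else bitAdd st.2.2 b)

/-- The elimination for the equations `us`, which starts from the vector `v` of length `d`. When `v`
is uniformly random, so is the solution that it arrives at. -/
def solve (d : ℕ) (v : List Bool) (us : List (List Bool × Bool)) : SolverState :=
  us.foldl eliminate (true, unitVectors d, v)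

/-- The attempt to learn from the first `m` examples: whether it succeeds, and the solution. The
first coin makes it fail with probability `1/2`, whatever the examples; the next `d` coins are the
random starting vector of the elimination. -/
def chunkResult (d a M m : ℕ) (db : List (List Bool × Bool)) (ω : List Bool) : Bool × List Bool :=
  let st := solve d ((ω.drop 1).take d) (keptExamples a M (db.take m) (ω.drop (1 + d)))
  (!ω.headD true && st.1, st.2.2)

/-- The examples and coins that remain: after a failure, `m` examples and `c` coins are dropped. -/
def nextChunk (d a M m c : ℕ) (st : List (List Bool × Bool) × List Bool) :
    List (List Bool × Bool) × List Bool :=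
  if (chunkResult d a M m st.1 st.2).1 then st else (st.1.drop m, st.2.drop c)

/-- The result of the first chunk, among `K + 1`, on which the attempt succeeds. -/
def firstResult (d a M m c K : ℕ) (db : List (List Bool × Bool)) (ω : List Bool) : List Bool :=
  let st := (nextChunk d a M m c)^[K] (db, ω)
  if (chunkResult d a M m st.1 st.2).1 then (chunkResult d a M m st.1 st.2).2 else []

/-- The number of examples in a chunk, where the variables stand for the entries of `Params`. -/
noncomputable def chunkExamples : MvPolynomial (Fin 4) ℕ :=
  (MvPolynomial.X 0 + MvPolynomial.X 3 + 2) * MvPolynomial.X 2 * (8 * MvPolynomial.X 1)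

/-- The number of coins for a chunk, where the variables stand for the entries of `Params`. -/
noncomputable def chunkCoins : MvPolynomial (Fin 4) ℕ :=
  1 + MvPolynomial.X 0 + chunkExamples * (8 * MvPolynomial.X 1)

/-- The private parity learner, as a function of the parameters, the database and the coins. The
examples are kept with probability `2 ^ -Nat.size (4 * ⌈1/ε⌉)`, which is at least `1 / (8 * ⌈1/ε⌉)`
and less than `1 / (4 * ⌈1/ε⌉)`. -/
noncomputable def parityLearner (x : Params × List (List Bool × Bool) × List Bool) : List Bool :=
  firstResult x.1.1 (Nat.size (4 * x.1.2.1)) (8 * x.1.2.1) (bound chunkExamples x.1)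
    (bound chunkCoins x.1) x.1.2.2.2 x.2.1 x.2.2

/-! ### Running time of the learner -/

theorem length_unitVector (d i : ℕ) : (unitVector d i).length = d := by
  rw [unitVector, List.length_set, List.length_replicate]

theorem length_unitVectors (d : ℕ) : (unitVectors d).length = d := by
  rw [unitVectors, List.length_map, List.length_range]

theorem foldl_parityBit (r x : List Bool) (b : Bool) :
    (r.foldl (fun (s : List Bool × Bool) a => (s.1.tail, xor s.2 (a && s.1.headD false)))
      (x, b)).2 = xor b (parityBit r x) := by
  induction r generalizing x b with
  | nil => simp
  | cons a r ih =>
    rw [List.foldl_cons, ih]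
    cases x <;> simp

theorem foldl_bitAdd (a b l : List Bool) :
    (a.foldl (fun (s : List Bool × List Bool) u =>
      if s.1.isEmpty then s else (s.1.tail, xor u (s.1.headD false) :: s.2)) (b, l)).2 =
      (bitAdd a b).reverse ++ l := by
  induction a generalizing b l with
  | nil => simp [bitAdd]
  | cons u a ih =>
    rw [List.foldl_cons]
    cases b with
    | nil => simpa [bitAdd] using ih [] l
    | cons v b => simpa using ih b (xor u v :: l)

theorem foldl_keptExamples {D : Type} (a M : ℕ) (us l : List D) (ω : List Bool) :
    (us.foldl (fun (s : List Bool × List D) u =>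
      (s.1.drop M, if allFalse a s.1 then u :: s.2 else s.2)) (ω, l)).2 =
      (keptExamples a M us ω).reverse ++ l := by
  induction us generalizing ω l with
  | nil => simp [keptExamples]
  | cons u us ih =>
    rw [List.foldl_cons, ih, keptExamples]
    split <;> simp

theorem iterate_double_of_le (n i : ℕ) :
    (fun s : ℕ × ℕ => if s.1 ≤ n then (s.1 + s.1, s.2 + 1) else s)^[i] (1, 0) =
      (2 ^ min i n.size, min i n.size) := by
  induction i with
  | zero => simp
  | succ i ih =>
    rw [Function.iterate_succ_apply', ih]
    rcases lt_or_ge i n.size with hi | hi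
    · rw [min_eq_left hi.le, min_eq_left (Nat.succ_le_of_lt hi), if_pos (Nat.lt_size.1 hi),
        pow_succ, mul_two]
    · rw [min_eq_right hi, min_eq_right (hi.trans i.le_succ), if_neg]
      exact (Nat.lt_size_self n).not_ge

theorem size_le_self (n : ℕ) : n.size ≤ n := Nat.size_le.2 n.lt_two_pow_self

namespace PolyTime

variable {S D : Type} [Encoded S] [Encoded D] [DepthBounded D]

protected theorem parityBit {f g : S → List Bool} (hf : PolyTime f) (hg : PolyTime g) :
    PolyTime fun a => parityBit (f a) (g a) := by
  have hfold : PolyTime fun a => (f a).foldl (fun (s : List Bool × Bool) a =>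
      (s.1.tail, xor s.2 (a && s.1.headD false))) (g a, false) := by
    refine foldl (T := List Bool × Bool)
      (step := fun x => (x.2.1.1.tail, xor x.2.1.2 (x.2.2 && x.2.1.1.headD false))) hf
      (hg.pair (const false)) (id.snd.fst.fst.list_tail.pair (bool₂ _ id.snd.fst.snd
        (bool₂ and id.snd.snd (id.snd.fst.fst.list_headD false)))) (.const 3) fun a b u _ => ?_
    have htail := encSize_le_of_sublist (List.tail_sublist b.1)
    have hbit := encSize_bool_le (xor b.2 (u && b.1.headD false))
    simp only [encSize_prod]
    omega
  exact hfold.snd.congr fun a => by rw [foldl_parityBit, Bool.false_xor]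

protected theorem bitAdd {f g : S → List Bool} (hf : PolyTime f) (hg : PolyTime g) :
    PolyTime fun a => bitAdd (f a) (g a) := by
  have hfold : PolyTime fun a => (f a).foldl (fun (s : List Bool × List Bool) u =>
      if s.1.isEmpty then s else (s.1.tail, xor u (s.1.headD false) :: s.2)) (g a, []) := by
    refine foldl (T := List Bool × List Bool)
      (step := fun x => if x.2.1.1.isEmpty then x.2.1 else
        (x.2.1.1.tail, xor x.2.2 (x.2.1.1.headD false) :: x.2.1.2)) hf
      (hg.pair (const [])) (id.snd.fst.fst.list_isEmpty.ite id.snd.fst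
        (id.snd.fst.fst.list_tail.pair ((bool₂ _ id.snd.snd
          (id.snd.fst.fst.list_headD false)).list_cons id.snd.fst.snd)))
      (.const 4) fun a b u _ => ?_
    have htail := encSize_le_of_sublist (List.tail_sublist b.1)
    have hbit := encSize_bool_le (xor u (b.1.headD false))
    dsimp only
    split
    · omega
    · simp only [encSize_prod, encSize_cons]
      omega
  exact hfold.snd.list_reverse.congr fun a => by
    rw [foldl_bitAdd, List.append_nil, List.reverse_reverse]

theorem nat_size {n : S → ℕ} (hn : PolyTime n) : PolyTime fun a => (n a).size := by
  have hiter := iterate (T := ℕ × ℕ) (n := n) (init := fun _ => (1, 0))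
    (step := fun x => if x.2.1 ≤ n x.1 then (x.2.1 + x.2.1, x.2.2 + 1) else x.2) hn (const (1, 0))
    (((id.snd.fst.nat_le hn.comp_fst).ite ((id.snd.fst.nat_add id.snd.fst).pair
      (id.snd.snd.nat_add (const 1))) id.snd).congr fun x => by simp only [decide_eq_true_eq])
    (B := fun a => encSize (n a) + 2) (hn.polyBounded_encSize.add (.const 2)) fun a b => by
      dsimp only
      split
      · simp only [encSize_prod, encSize_nat]
        omega
      · omega
  exact hiter.snd.congr fun a => by
    dsimp only
    rw [iterate_double_of_le, min_eq_right (size_le_self (n a))]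

protected theorem allFalse {a : S → ℕ} {ω : S → List Bool} (ha : PolyTime a) (hω : PolyTime ω) :
    PolyTime fun x => allFalse (a x) (ω x) :=
  (list_filter (g := fun x => x.2) (list_take ha hω) id.snd).list_isEmpty

protected theorem keptExamples {a M : S → ℕ} {us : S → List D} {ω : S → List Bool}
    (ha : PolyTime a) (hM : PolyTime M) (hus : PolyTime us) (hω : PolyTime ω) :
    PolyTime fun x => keptExamples (a x) (M x) (us x) (ω x) := by
  have hfold : PolyTime fun x => (us x).foldl (fun (s : List Bool × List D) u =>
      (s.1.drop (M x), if allFalse (a x) s.1 then u :: s.2 else s.2)) (ω x, []) := by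
    refine foldl (T := List Bool × List D)
      (step := fun y => (y.2.1.1.drop (M y.1),
        if allFalse (a y.1) y.2.1.1 then y.2.2 :: y.2.1.2 else y.2.1.2)) hus
      (hω.pair (const [])) ((list_drop hM.comp_fst id.snd.fst.fst).pair
        ((ha.comp_fst.allFalse id.snd.fst.fst).ite (id.snd.snd.list_cons id.snd.fst.snd)
          id.snd.fst.snd))
      (B := fun x => encSize (us x) + 1) (hus.polyBounded_encSize.add (.const 1)) fun x b u hu => ?_
    have hdrop := encSize_le_of_sublist (List.drop_sublist (M x) b.1)
    have hmem := encSize_le_of_mem hu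
    simp only [encSize_prod]
    split
    · simp only [encSize_cons]
      omega
    · omega
  exact hfold.snd.list_reverse.congr fun x => by
    rw [foldl_keptExamples, List.append_nil, List.reverse_reverse]

protected theorem unitVectors {d : S → ℕ} (hd : PolyTime d) :
    PolyTime fun x => unitVectors (d x) :=
  list_map (g := fun y => unitVector (d y.1) y.2) hd.list_range
    ((hd.comp_fst.list_replicate false).list_set id.snd (const true))

protected theorem eliminate :
    PolyTime fun x : SolverState × (List Bool × Bool) => eliminate x.1 x.2 := by
  have hsatisfied : PolyTime fun x : SolverState × (List Bool × Bool) =>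
      parityBit x.2.1 x.1.2.2 == x.2.2 :=
    bool₂ (· == ·) (id.snd.fst.parityBit id.fst.snd.snd) id.snd.snd
  refine (list_match (S := SolverState × (List Bool × Bool)) (U := List Bool)
    (l := fun x => x.1.2.1.filter (parityBit x.2.1))
    (f := fun x => (x.1.1 && (parityBit x.2.1 x.1.2.2 == x.2.2), x.1.2.1, x.1.2.2))
    (g := fun y => (y.1.1.1, y.1.1.2.1.map fun c =>
        if parityBit y.1.2.1 c then bitAdd c y.2.1 else c,
      if parityBit y.1.2.1 y.1.1.2.2 == y.1.2.2 then y.1.1.2.2 else bitAdd y.1.1.2.2 y.2.1))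
    (list_filter (S := SolverState × (List Bool × Bool)) (T := List Bool)
      (g := fun y => parityBit y.1.2.1 y.2) id.fst.snd.fst (id.fst.snd.fst.parityBit id.snd))
    ((bool₂ and id.fst.fst hsatisfied).pair (id.fst.snd.fst.pair id.fst.snd.snd))
    (id.fst.fst.fst.pair ((list_map
      (g := fun z => if parityBit z.1.1.2.1 z.2 then bitAdd z.2 z.1.2.1 else z.2)
      id.fst.fst.snd.fst ((id.fst.fst.snd.fst.parityBit id.snd).ite
        (id.snd.bitAdd id.fst.snd.fst) id.snd)).pair
      (hsatisfied.comp_fst.ite id.fst.fst.snd.snd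
        (id.fst.fst.snd.snd.bitAdd id.snd.fst))))).congr fun x => ?_
  unfold eliminate
  cases x.1.2.1.filter (parityBit x.2.1) <;> rfl

end PolyTime

/-- All the vectors in a state of the elimination have length at most `d`. Together with the bound
on their number, this bounds the size of the state, whatever the equations. -/
structure ShortState (d : ℕ) (st : SolverState) : Prop where
  length_directions : st.2.1.length ≤ d
  length_direction : ∀ b ∈ st.2.1, b.length ≤ d
  length_solution : st.2.2.length ≤ d

namespace ShortState

variable {d : ℕ} {st : SolverState}

theorem init {v : List Bool} (hv : v.length ≤ d) : ShortState d (true, unitVectors d, v) where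
  length_directions := (length_unitVectors d).le
  length_direction b hb := by
    obtain ⟨i, -, rfl⟩ := List.mem_map.1 hb
    exact (length_unitVector d i).le
  length_solution := hv

protected theorem eliminate (h : ShortState d st) (u : List Bool × Bool) :
    ShortState d (eliminate st u) := by
  have hadd {a b : List Bool} (ha : a.length ≤ d) : (bitAdd a b).length ≤ d := by
    rw [length_bitAdd]
    omega
  unfold eliminate
  split
  · exact ⟨h.length_directions, h.length_direction, h.length_solution⟩
  · refine ⟨(List.length_map _).trans_le h.length_directions, fun c' hc' => ?_, ?_⟩
    · obtain ⟨c, hc, rfl⟩ := List.mem_map.1 hc'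
      split
      · exact hadd (h.length_direction c hc)
      · exact h.length_direction c hc
    · dsimp only
      split
      · exact h.length_solution
      · exact hadd h.length_solution

protected theorem foldl (h : ShortState d st) (us : List (List Bool × Bool)) :
    ShortState d (us.foldl eliminate st) := by
  induction us generalizing st with
  | nil => exact h
  | cons u _ ih => exact ih (h.eliminate u)

protected theorem encSize_le (h : ShortState d st) :
    encSize st ≤ d * (4 * d + 2) + 4 * d + 7 := by
  have hdirections : encSize st.2.1 ≤ d * (4 * d + 2) + 1 :=
    (encSize_list_le fun b hb => (encSize_bits_le b).trans
      (Nat.add_le_add_right (Nat.mul_le_mul_left 4 (h.length_direction b hb)) 1)).trans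
      (by gcongr; exact h.length_directions)
  have hsolution := encSize_bits_le st.2.2
  have hlength := h.length_solution
  have hflag := encSize_bool_le st.1
  simp only [encSize_prod]
  omega

end ShortState

namespace PolyTime

variable {S : Type} [Encoded S]

protected theorem solve {d : S → ℕ} {v : S → List Bool} {us : S → List (List Bool × Bool)}
    (hd : PolyTime d) (hv : PolyTime v) (hus : PolyTime us) (hvd : ∀ x, (v x).length ≤ d x) :
    PolyTime fun x => solve (d x) (v x) (us x) := by
  have hdb : PolyBounded d :=
    hd.polyBounded_encSize.mono fun x => by rw [encSize_nat]; omega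
  exact foldl_of_encSize_le hus ((const true).pair (hd.unitVectors.pair hv))
    (step := fun x => eliminate x.2.1 x.2.2)
    (PolyTime.eliminate.comp (id.snd.fst.pair id.snd.snd))
    (B := fun x => d x * (4 * d x + 2) + 4 * d x + 7)
    (((hdb.mul (((PolyBounded.const 4).mul hdb).add (.const 2))).add
      ((PolyBounded.const 4).mul hdb)).add (.const 7))
    fun x l' _ => ((ShortState.init (hvd x)).foldl l').encSize_le

protected theorem chunkResult {d a M m : S → ℕ} {db : S → List (List Bool × Bool)}
    {ω : S → List Bool} (hd : PolyTime d) (ha : PolyTime a) (hM : PolyTime M) (hm : PolyTime m)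
    (hdb : PolyTime db) (hω : PolyTime ω) :
    PolyTime fun x => chunkResult (d x) (a x) (M x) (m x) (db x) (ω x) := by
  have hsolve := PolyTime.solve hd (list_take hd (list_drop (const 1) hω))
    (PolyTime.keptExamples ha hM (list_take hm hdb) (list_drop (nat_add (const 1) hd) hω))
    fun x => List.length_take_le _ _
  exact (bool₂ (fun b c => !b && c) (hω.list_headD true) hsolve.fst).pair hsolve.snd.snd

protected theorem parityLearner : PolyTime parityLearner := by
  have he : PolyTime fun x : Params × List (List Bool × Bool) × List Bool => x.1.2.1 :=
    id.fst.snd.fst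
  have hchunk : PolyTime fun y : (Params × List (List Bool × Bool) × List Bool) ×
      (List (List Bool × Bool) × List Bool) =>
      chunkResult y.1.1.1 (Nat.size (4 * y.1.1.2.1)) (8 * y.1.1.2.1)
        (PrivateLearning.bound chunkExamples y.1.1) y.2.1 y.2.2 :=
    PolyTime.chunkResult id.fst.fst.fst ((const 4).nat_mul he.comp_fst).nat_size
      ((const 8).nat_mul he.comp_fst) (bound _ id.fst.fst) id.snd.fst id.snd.snd
  have hiter := iterate (S := Params × List (List Bool × Bool) × List Bool)
    (T := List (List Bool × Bool) × List Bool) (n := fun x => x.1.2.2.2)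
    (step := fun y => nextChunk y.1.1.1 (Nat.size (4 * y.1.1.2.1)) (8 * y.1.1.2.1)
      (PrivateLearning.bound chunkExamples y.1.1) (PrivateLearning.bound chunkCoins y.1.1) y.2)
    id.fst.snd.snd.snd id.snd
    (hchunk.fst.ite id.snd ((list_drop (bound _ id.fst.fst) id.snd.fst).pair
      (list_drop (bound _ id.fst.fst) id.snd.snd))) (.const 0) fun x st => by
        simp only [nextChunk]
        split
        · omega
        · have hdb := encSize_le_of_sublist
            (List.drop_sublist (PrivateLearning.bound chunkExamples x.1) st.1)
          have hω := encSize_le_of_sublist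
            (List.drop_sublist (PrivateLearning.bound chunkCoins x.1) st.2)
          simp only [encSize_prod]
          omega
  have hlast := hchunk.comp (id.pair hiter)
  exact hlast.fst.ite hlast.snd (const [])

end PolyTime

/-! ### The elimination finds a uniformly random solution -/

theorem bitAdd_comm (a b : List Bool) : bitAdd a b = bitAdd b a :=
  List.zipWith_comm_of_comm fun _ _ => Bool.xor_comm _ _

theorem bitAdd_assoc (a b c : List Bool) : bitAdd (bitAdd a b) c = bitAdd a (bitAdd b c) := by
  induction a generalizing b c with
  | nil => rfl
  | cons x a ih =>
    cases b with
    | nil => rfl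
    | cons y b =>
      cases c with
      | nil => rfl
      | cons z c => simp only [bitAdd_cons, Bool.xor_assoc, ih]

theorem parityBit_replicate_set (x : List Bool) {i : ℕ} (hi : i < x.length) :
    parityBit x ((List.replicate x.length false).set i true) = x[i] := by
  induction x generalizing i with
  | nil => exact absurd hi (Nat.not_lt_zero i)
  | cons a x ih =>
    cases i with
    | zero =>
      simp [List.replicate_succ, parityBit_comm x, parityBit_replicate_false]
    | succ i => simpa [List.replicate_succ] using ih (Nat.lt_of_succ_lt_succ hi)

section Elimination

variable {d : ℕ}

theorem eq_replicate_false_of_forall_unitVectors {x : PARITY.domain d}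
    (hx : ∀ b ∈ unitVectors d, parityBit x.1 b = false) : x.1 = List.replicate d false := by
  refine List.eq_replicate_iff.2 ⟨length_of_domain x, fun b hb => ?_⟩
  obtain ⟨i, hi, rfl⟩ := List.getElem_of_mem hb
  rw [← parityBit_replicate_set x.1 hi, length_of_domain]
  exact hx _ (List.mem_map.2 ⟨i, List.mem_range.2 (hi.trans_eq (length_of_domain x)), rfl⟩)

/-- The solutions `r` of the linear equations `⟨x, r⟩ = y` given by the labeled examples
`(x, y) ∈ us`. -/
def solutions (us : List (PARITY.Example d)) : Set (PARITY.domain d) :=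
  {r | ∀ u ∈ us, parityBit u.1.1 r.1 = u.2}

/-- The solutions of the homogeneous linear equations that correspond to the labeled examples. -/
def homogeneousSolutions (us : List (PARITY.Example d)) : Set (PARITY.domain d) :=
  {t | ∀ u ∈ us, parityBit u.1.1 t.1 = false}

theorem mem_solutions_append {us vs : List (PARITY.Example d)} {r : PARITY.domain d} :
    r ∈ solutions (us ++ vs) ↔ r ∈ solutions us ∧ r ∈ solutions vs :=
  List.forall_mem_append

theorem mem_solutions_cons {u : PARITY.Example d} {us : List (PARITY.Example d)}
    {r : PARITY.domain d} :
    r ∈ solutions (u :: us) ↔ parityBit u.1.1 r.1 = u.2 ∧ r ∈ solutions us :=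
  List.forall_mem_cons

theorem mem_solutions_concat {us : List (PARITY.Example d)} {u : PARITY.Example d}
    {r : PARITY.domain d} :
    r ∈ solutions (us ++ [u]) ↔ r ∈ solutions us ∧ parityBit u.1.1 r.1 = u.2 :=
  mem_solutions_append.trans (and_congr_right' List.forall_mem_singleton)

theorem mem_homogeneousSolutions_concat {us : List (PARITY.Example d)} {u : PARITY.Example d}
    {t : PARITY.domain d} :
    t ∈ homogeneousSolutions (us ++ [u]) ↔
      t ∈ homogeneousSolutions us ∧ parityBit u.1.1 t.1 = false :=
  List.forall_mem_append.trans (and_congr_right' List.forall_mem_singleton)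

theorem translate_mem_solutions {us : List (PARITY.Example d)} {t r : PARITY.domain d}
    (ht : t ∈ homogeneousSolutions us) (hr : r ∈ solutions us) :
    translate t r ∈ solutions us := fun u hu => by
  rw [parityBit_translate, ht u hu, hr u hu, Bool.false_xor]

theorem translate_mem_homogeneousSolutions_of_mem_solutions {us : List (PARITY.Example d)}
    {r s : PARITY.domain d} (hr : r ∈ solutions us) (hs : s ∈ solutions us) :
    translate r s ∈ homogeneousSolutions us := fun u hu => by
  rw [parityBit_translate, hr u hu, hs u hu, Bool.xor_self]

theorem translate_mem_homogeneousSolutions {us : List (PARITY.Example d)}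
    {t t' : PARITY.domain d} (ht : t ∈ homogeneousSolutions us)
    (ht' : t' ∈ homogeneousSolutions us) : translate t t' ∈ homogeneousSolutions us :=
  fun u hu => by rw [parityBit_translate, ht u hu, ht' u hu, Bool.xor_self]

theorem eliminate_of_forall {st : SolverState} {u : List Bool × Bool}
    (h : ∀ b ∈ st.2.1, parityBit u.1 b = false) :
    eliminate st u = (st.1 && (parityBit u.1 st.2.2 == u.2), st.2.1, st.2.2) := by
  rw [eliminate, List.filter_eq_nil_iff.2 fun b hb => Bool.not_eq_true _ ▸ h b hb]

theorem eliminate_of_exists {st : SolverState} {u : List Bool × Bool}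
    (h : ∃ b ∈ st.2.1, parityBit u.1 b = true) :
    ∃ b ∈ st.2.1, parityBit u.1 b = true ∧ eliminate st u = (st.1,
      st.2.1.map fun c => if parityBit u.1 c then bitAdd c b else c,
      if parityBit u.1 st.2.2 == u.2 then st.2.2 else bitAdd st.2.2 b) := by
  cases hfilter : st.2.1.filter (parityBit u.1) with
  | nil =>
    obtain ⟨b, hb, hbu⟩ := h
    exact absurd hbu (List.filter_eq_nil_iff.1 hfilter b hb)
  | cons b l =>
    obtain ⟨hb, hbu⟩ := List.mem_filter.1 (hfilter ▸ List.mem_cons_self)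
    exact ⟨b, hb, hbu, by rw [eliminate, hfilter]⟩

/-- The correctness of a state of the elimination after the equations given by `us`. The field
`parityBit_eq` says that the directions span the solutions of the homogeneous equations, in terms of
the orthogonal complements. -/
structure SolverInvariant (us : List (PARITY.Example d)) (st : SolverState) : Prop where
  mem_homogeneousSolutions : ∀ b ∈ st.2.1, ∃ t ∈ homogeneousSolutions us, t.1 = b
  parityBit_eq : ∀ x : PARITY.domain d, (∀ b ∈ st.2.1, parityBit x.1 b = false) →
    ∀ t ∈ homogeneousSolutions us, parityBit x.1 t.1 = false
  length_solution : st.2.2.length = d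
  mem_solutions : st.1 = true → ∃ r ∈ solutions us, r.1 = st.2.2
  consistent : (solutions us).Nonempty → st.1 = true

namespace SolverInvariant

variable {us : List (PARITY.Example d)} {st : SolverState} {u : PARITY.Example d}

theorem init (v : PARITY.domain d) : SolverInvariant (d := d) [] (true, unitVectors d, v.1) where
  mem_homogeneousSolutions b hb := by
    obtain ⟨i, -, rfl⟩ := List.mem_map.1 hb
    exact ⟨⟨_, length_unitVector d i⟩, List.forall_mem_nil _, rfl⟩
  parityBit_eq x hx t _ := by
    rw [eq_replicate_false_of_forall_unitVectors hx, parityBit_replicate_false]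
  length_solution := length_of_domain v
  mem_solutions _ := ⟨v, List.forall_mem_nil _, rfl⟩
  consistent _ := rfl

theorem concat_of_forall (h : SolverInvariant us st)
    (hu : ∀ b ∈ st.2.1, parityBit u.1.1 b = false) :
    SolverInvariant (us ++ [u]) (eliminate st (exampleString u)) := by
  rw [eliminate_of_forall (u := exampleString u) hu]
  refine ⟨fun b hb => ?_, fun x hx t ht => ?_, h.length_solution, fun hst => ?_, fun ⟨r, hr⟩ => ?_⟩
  · obtain ⟨t, ht, rfl⟩ := h.mem_homogeneousSolutions b hb
    exact ⟨t, mem_homogeneousSolutions_concat.2 ⟨ht, hu _ hb⟩, rfl⟩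
  · exact h.parityBit_eq x hx t (mem_homogeneousSolutions_concat.1 ht).1
  · obtain ⟨hflag, hsat⟩ := Bool.and_eq_true_iff.1 hst
    obtain ⟨r, hr, hrst⟩ := h.mem_solutions hflag
    exact ⟨r, mem_solutions_concat.2 ⟨hr, hrst ▸ beq_iff_eq.1 hsat⟩, hrst⟩
  · obtain ⟨hr, hru⟩ := mem_solutions_concat.1 hr
    have hflag := h.consistent ⟨r, hr⟩
    obtain ⟨s, hs, hst⟩ := h.mem_solutions hflag
    have hrs := h.parityBit_eq u.1 hu _
      (translate_mem_homogeneousSolutions_of_mem_solutions hs hr)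
    rw [parityBit_translate, bne_eq_false_iff_eq, hru, hst] at hrs
    exact Bool.and_eq_true_iff.2 ⟨hflag, beq_iff_eq.2 hrs⟩

theorem exists_mem_homogeneousSolutions_ite (h : SolverInvariant us st) {b c : List Bool}
    (hb : b ∈ st.2.1) (hbu : parityBit u.1.1 b = true) (hc : c ∈ st.2.1) :
    ∃ t ∈ homogeneousSolutions (us ++ [u]),
      t.1 = if parityBit u.1.1 c then bitAdd c b else c := by
  obtain ⟨t, ht, rfl⟩ := h.mem_homogeneousSolutions b hb
  obtain ⟨t', ht', rfl⟩ := h.mem_homogeneousSolutions c hc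
  split
  case isTrue hcu =>
    exact ⟨translate t' t, mem_homogeneousSolutions_concat.2
      ⟨translate_mem_homogeneousSolutions ht' ht, by
        rw [parityBit_translate, hcu, hbu, Bool.xor_self]⟩, rfl⟩
  case isFalse hcu =>
    exact ⟨t', mem_homogeneousSolutions_concat.2 ⟨ht', Bool.eq_false_of_not_eq_true hcu⟩, rfl⟩

/-- If `x` violates `b`, then `u.1 + x` is orthogonal to the old directions, and the equation `u` of
`t` can be subtracted again. -/
theorem parityBit_eq_of_forall_ite (h : SolverInvariant us st) {b : List Bool}
    (hb : b ∈ st.2.1) (hbu : parityBit u.1.1 b = true) {x : PARITY.domain d}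
    (hx : ∀ c ∈ st.2.1, parityBit x.1 (if parityBit u.1.1 c then bitAdd c b else c) = false)
    {t : PARITY.domain d} (ht : t ∈ homogeneousSolutions (us ++ [u])) :
    parityBit x.1 t.1 = false := by
  obtain ⟨ht, htu⟩ := mem_homogeneousSolutions_concat.1 ht
  have hadd {c : List Bool} (hc : c ∈ st.2.1) :
      parityBit x.1 (bitAdd c b) = xor (parityBit x.1 c) (parityBit x.1 b) := by
    obtain ⟨s, -, rfl⟩ := h.mem_homogeneousSolutions b hb
    obtain ⟨s', -, rfl⟩ := h.mem_homogeneousSolutions c hc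
    exact parityBit_translate x.1 s' s
  have htranslate (s : List Bool) : parityBit (translate u.1 x).1 s =
      xor (parityBit u.1.1 s) (parityBit x.1 s) := by
    rw [parityBit_comm, parityBit_translate, parityBit_comm s, parityBit_comm s]
  cases hxb : parityBit x.1 b with
  | false =>
    refine h.parityBit_eq x (fun c hc => ?_) t ht
    have hxc := hx c hc
    split at hxc
    · rwa [hadd hc, hxb, Bool.xor_false] at hxc
    · exact hxc
  | true =>
    suffices hut : parityBit (translate u.1 x).1 t.1 = false by
      rwa [htranslate, htu, Bool.false_xor] at hut
    refine h.parityBit_eq _ (fun c hc => ?_) t ht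
    have hxc := hx c hc
    rw [htranslate, bne_eq_false_iff_eq]
    split at hxc
    case isTrue hcu =>
      rw [hadd hc, hxb, bne_eq_false_iff_eq] at hxc
      rw [hcu, hxc]
    case isFalse hcu => rw [hxc, Bool.eq_false_of_not_eq_true hcu]

theorem exists_mem_solutions_ite (h : SolverInvariant us st) {b : List Bool} (hb : b ∈ st.2.1)
    (hbu : parityBit u.1.1 b = true) (hst : st.1 = true) :
    ∃ r ∈ solutions (us ++ [u]),
      r.1 = if parityBit u.1.1 st.2.2 == u.2 then st.2.2 else bitAdd st.2.2 b := by
  obtain ⟨r, hr, hrst⟩ := h.mem_solutions hst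
  obtain ⟨t, ht, rfl⟩ := h.mem_homogeneousSolutions b hb
  rw [← hrst]
  split
  case isTrue hru => exact ⟨r, mem_solutions_concat.2 ⟨hr, beq_iff_eq.1 hru⟩, rfl⟩
  case isFalse hru =>
    refine ⟨translate t r, mem_solutions_concat.2 ⟨translate_mem_solutions ht hr, ?_⟩,
      bitAdd_comm _ _⟩
    rw [parityBit_translate, hbu, Bool.true_xor]
    exact Bool.not_eq.2 fun hru' => hru (beq_iff_eq.2 hru')

theorem concat_of_exists (h : SolverInvariant us st)
    (hu : ∃ b ∈ st.2.1, parityBit u.1.1 b = true) :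
    SolverInvariant (us ++ [u]) (eliminate st (exampleString u)) := by
  obtain ⟨b, hb, hbu, heliminate⟩ := eliminate_of_exists (u := exampleString u) hu
  rw [heliminate]
  refine ⟨fun c' hc' => ?_, fun x hx t ht => ?_, ?_, h.exists_mem_solutions_ite hb hbu,
    fun ⟨r, hr⟩ => h.consistent ⟨r, (mem_solutions_concat.1 hr).1⟩⟩
  · obtain ⟨c, hc, rfl⟩ := List.mem_map.1 hc'
    exact h.exists_mem_homogeneousSolutions_ite hb hbu hc
  · exact h.parityBit_eq_of_forall_ite hb hbu
      (fun c hc => hx _ (List.mem_map.2 ⟨c, hc, rfl⟩)) ht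
  · obtain ⟨t, -, rfl⟩ := h.mem_homogeneousSolutions b hb
    dsimp only
    split
    · exact h.length_solution
    · rw [length_bitAdd, h.length_solution, length_of_domain, min_self]

end SolverInvariant

/-- The state of the elimination after the labeled examples `us`. -/
def solveState (v : PARITY.domain d) (us : List (PARITY.Example d)) : SolverState :=
  solve d v.1 (us.map exampleString)

theorem solveState_concat (v : PARITY.domain d) (us : List (PARITY.Example d))
    (u : PARITY.Example d) :
    solveState v (us ++ [u]) = eliminate (solveState v us) (exampleString u) := by
  rw [solveState, solve, List.map_append, List.map_singleton, List.foldl_concat]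
  rfl

theorem solverInvariant_solveState (v : PARITY.domain d) (us : List (PARITY.Example d)) :
    SolverInvariant us (solveState v us) := by
  induction us using List.reverseRecOn with
  | nil => exact .init v
  | append_singleton us u ih =>
    rw [solveState_concat]
    by_cases h : ∃ b ∈ (solveState v us).2.1, parityBit u.1.1 b = true
    · exact ih.concat_of_exists h
    · exact ih.concat_of_forall fun b hb => Bool.eq_false_of_not_eq_true fun hbu => h ⟨b, hb, hbu⟩

theorem eliminate_bitAdd {a : List Bool} {st : SolverState} {u : List Bool × Bool}
    (h : parityBit u.1 (bitAdd a st.2.2) = parityBit u.1 st.2.2) :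
    eliminate (st.1, st.2.1, bitAdd a st.2.2) u =
      ((eliminate st u).1, (eliminate st u).2.1, bitAdd a (eliminate st u).2.2) := by
  simp only [eliminate, h]
  cases st.2.1.filter (parityBit u.1) with
  | nil => rfl
  | cons b l =>
    dsimp only
    rw [bitAdd_assoc, apply_ite (bitAdd a)]

/-- A homogeneous solution does not affect any of the decisions of the elimination. -/
theorem solveState_translate {us : List (PARITY.Example d)} {t : PARITY.domain d}
    (ht : t ∈ homogeneousSolutions us) (v : PARITY.domain d) :
    solveState (translate t v) us =
      ((solveState v us).1, (solveState v us).2.1, bitAdd t.1 (solveState v us).2.2) := by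
  induction us using List.reverseRecOn with
  | nil => rfl
  | append_singleton us u ih =>
    obtain ⟨ht, htu⟩ := mem_homogeneousSolutions_concat.1 ht
    have hlength := (solverInvariant_solveState v us).length_solution
    rw [solveState_concat, solveState_concat, ih ht, eliminate_bitAdd]
    rw [parityBit_bitAdd _ ((length_of_domain t).trans hlength.symm)]
    exact (congrArg (xor · _) htu).trans (Bool.false_xor _)

/-- The number of starting vectors that lead the elimination to the solution `s`. -/
noncomputable def solveCount (us : List (PARITY.Example d)) (s : List Bool) : ℕ :=
  {v : PARITY.domain d | (solveState v us).1 = true ∧ (solveState v us).2.2 = s}.ncard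

theorem solveCount_translate {us : List (PARITY.Example d)} {t : PARITY.domain d}
    (ht : t ∈ homogeneousSolutions us) (s : PARITY.domain d) :
    solveCount us (translate t s).1 = solveCount us s.1 := by
  refine (Set.ncard_congr (fun v _ => translate t v) (fun v hv => ?_)
    (fun v w _ _ hvw => (translate t).injective hvw) fun w hw => ?_).symm
  · rw [Set.mem_ofPred_eq, solveState_translate ht]
    exact ⟨hv.1, congrArg (bitAdd t.1) hv.2⟩
  · have hself : translate t (translate t w) = w := (translate t).left_inv w
    refine ⟨translate t w, ?_, hself⟩
    rw [Set.mem_ofPred_eq, solveState_translate ht, hw.2]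
    exact ⟨hw.1, congrArg Subtype.val ((translate t).left_inv s)⟩

theorem solveCount_eq_solveCount {us : List (PARITY.Example d)} {r s : PARITY.domain d}
    (hr : r ∈ solutions us) (hs : s ∈ solutions us) :
    solveCount us r.1 = solveCount us s.1 := by
  have htranslate : translate (translate r s) s = r := Subtype.ext <| by
    change bitAdd (bitAdd r.1 s.1) s.1 = r.1
    rw [bitAdd_comm _ s.1, bitAdd_comm r.1, bitAdd_bitAdd_cancel (length_eq_of_domain s r)]
  rw [← solveCount_translate (translate_mem_homogeneousSolutions_of_mem_solutions hr hs) s,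
    htranslate]

theorem ncard_solutions_mul_solveCount {us : List (PARITY.Example d)} {r : PARITY.domain d}
    (hr : r ∈ solutions us) : (solutions us).ncard * solveCount us r.1 = 2 ^ d := by
  classical
  have hinvariant := fun v => solverInvariant_solveState v us
  have hconsistent (v : PARITY.domain d) : (solveState v us).1 = true :=
    (hinvariant v).consistent ⟨r, hr⟩
  have hfiber : ∀ s ∈ (solutions us).toFinset, (Finset.univ.filter fun v : PARITY.domain d =>
      (⟨_, (hinvariant v).length_solution⟩ : PARITY.domain d) = s).card = solveCount us r.1 := by
    intro s hs
    rw [solveCount_eq_solveCount hr (Set.mem_toFinset.1 hs), solveCount,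
      Set.ncard_eq_toFinset_card']
    congr 1
    ext v
    simp [Subtype.ext_iff, hconsistent]
  have hsum := Finset.card_eq_sum_card_fiberwise (s := (Finset.univ : Finset (PARITY.domain d)))
    (t := (solutions us).toFinset) (f := fun v => ⟨_, (hinvariant v).length_solution⟩)
    fun v _ => by
      obtain ⟨s, hs, hsv⟩ := (hinvariant v).mem_solutions (hconsistent v)
      obtain rfl : s = ⟨_, (hinvariant v).length_solution⟩ := Subtype.ext hsv
      exact Set.mem_toFinset.2 hs
  rw [Finset.sum_congr rfl hfiber, Finset.sum_const, smul_eq_mul, Finset.card_univ, card_domain,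
    ← Set.ncard_eq_toFinset_card'] at hsum
  exact hsum.symm

theorem mem_solutions_append_cons {us vs : List (PARITY.Example d)} {u : PARITY.Example d}
    {r : PARITY.domain d} :
    r ∈ solutions (us ++ u :: vs) ↔ r ∈ solutions (us ++ vs) ∧ parityBit u.1.1 r.1 = u.2 := by
  rw [mem_solutions_append, mem_solutions_cons, mem_solutions_append]
  tauto

/-- The vectors that only violate the equation `u` are a translate of the solutions, unless there
are none. -/
theorem ncard_solutions_append_le (us vs : List (PARITY.Example d)) (u : PARITY.Example d)
    (h : (solutions (us ++ u :: vs)).Nonempty) :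
    (solutions (us ++ vs)).ncard ≤ 2 * (solutions (us ++ u :: vs)).ncard := by
  have hsub : solutions (us ++ u :: vs) ⊆ solutions (us ++ vs) :=
    fun r hr => (mem_solutions_append_cons.1 hr).1
  have hadd := Set.ncard_sdiff_add_ncard_of_subset hsub
  suffices hle : (solutions (us ++ vs) \ solutions (us ++ u :: vs)).ncard ≤
      (solutions (us ++ u :: vs)).ncard by omega
  rcases (solutions (us ++ vs) \ solutions (us ++ u :: vs)).eq_empty_or_nonempty with
    hempty | ⟨w, hw, hwu⟩
  · rw [hempty, Set.ncard_empty]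
    exact Nat.zero_le _
  obtain ⟨r, hr⟩ := h
  obtain ⟨hr, hru⟩ := mem_solutions_append_cons.1 hr
  have hviolates {s : PARITY.domain d} (hs : s ∈ solutions (us ++ vs))
      (hsu : s ∉ solutions (us ++ u :: vs)) : parityBit u.1.1 s.1 = !u.2 :=
    Bool.eq_not.2 fun hsu' => hsu (mem_solutions_append_cons.2 ⟨hs, hsu'⟩)
  refine Set.ncard_le_ncard_of_injOn (translate (translate w r)) (fun s hs => ?_)
    (translate (translate w r)).injective.injOn
  refine mem_solutions_append_cons.2 ⟨translate_mem_solutions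
    (translate_mem_homogeneousSolutions_of_mem_solutions hw hr) hs.1, ?_⟩
  rw [parityBit_translate, parityBit_translate, hviolates hw hwu, hviolates hs.1 hs.2, hru]
  cases u.2 <;> rfl

theorem solveCount_append_cons_le (us vs : List (PARITY.Example d)) (u : PARITY.Example d)
    (s : List Bool) : solveCount (us ++ u :: vs) s ≤ 2 * solveCount (us ++ vs) s := by
  by_cases hs : ∃ r ∈ solutions (us ++ u :: vs), r.1 = s
  · obtain ⟨r, hr, rfl⟩ := hs
    have hpos : 0 < (solutions (us ++ u :: vs)).ncard := (Set.ncard_pos).2 ⟨r, hr⟩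
    refine Nat.le_of_mul_le_mul_left ?_ hpos
    calc (solutions (us ++ u :: vs)).ncard * solveCount (us ++ u :: vs) r.1
        = (solutions (us ++ vs)).ncard * solveCount (us ++ vs) r.1 := by
          rw [ncard_solutions_mul_solveCount hr,
            ncard_solutions_mul_solveCount (mem_solutions_append_cons.1 hr).1]
      _ ≤ 2 * (solutions (us ++ u :: vs)).ncard * solveCount (us ++ vs) r.1 := by
          gcongr
          exact ncard_solutions_append_le us vs u ⟨r, hr⟩
      _ = _ := by ring
  · have hempty : solveCount (us ++ u :: vs) s = 0 := by
      refine (Set.ncard_eq_zero (Set.toFinite _)).2 (Set.eq_empty_of_forall_notMem ?_)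
      rintro v ⟨hv, hvs⟩
      obtain ⟨r, hr, hrv⟩ := (solverInvariant_solveState v _).mem_solutions hv
      exact hs ⟨r, hr, hrv.trans hvs⟩
    rw [hempty]
    exact Nat.zero_le _

end Elimination

/-! ### The distribution of the examples that are kept -/

/-- The distribution of a fair coin. -/
noncomputable abbrev fair : PMF Bool := PMF.uniformOfFintype Bool

theorem expect_fair (g : Bool → ℝ≥0∞) : expect fair g = 2⁻¹ * g true + 2⁻¹ * g false := by
  rw [expect_fintype]
  simp

theorem expect_draws_add {D : Type*} (μ : PMF D) (m n : ℕ) (f : List D → List D → ℝ≥0∞) :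
    expect (draws μ (m + n)) (fun l => f (l.take m) (l.drop m)) =
      expect (draws μ m) fun l => expect (draws μ n) fun l' => f l l' := by
  rw [draws_add, expect_bind]
  refine expect_congr fun l hl => ?_
  rw [expect_map]
  refine expect_congr fun l' _ => ?_
  simp [← length_of_mem_support_draws hl]

/-- The probability that an example is kept. -/
noncomputable def keepProb (a : ℕ) : ℝ≥0∞ := 2⁻¹ ^ a

/-- The probability that an example is not kept. -/
noncomputable def dropProb (a : ℕ) : ℝ≥0∞ := 1 - keepProb a

theorem keepProb_succ (a : ℕ) : keepProb (a + 1) = 2⁻¹ * keepProb a := pow_succ' _ _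

theorem keepProb_le_one (a : ℕ) : keepProb a ≤ 1 := pow_le_one₀ zero_le (by simp)

theorem keepProb_ne_top (a : ℕ) : keepProb a ≠ ⊤ :=
  ((keepProb_le_one a).trans_lt ENNReal.one_lt_top).ne

theorem keepProb_add_dropProb (a : ℕ) : keepProb a + dropProb a = 1 :=
  add_tsub_cancel_of_le (keepProb_le_one a)

theorem dropProb_succ (a : ℕ) : dropProb (a + 1) = 2⁻¹ + 2⁻¹ * dropProb a := by
  refine (ENNReal.add_right_inj (keepProb_ne_top (a + 1))).1 ?_
  calc keepProb (a + 1) + dropProb (a + 1)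
      = 2⁻¹ + 2⁻¹ * (keepProb a + dropProb a) := by
        rw [keepProb_add_dropProb, keepProb_add_dropProb, mul_one, ENNReal.inv_two_add_inv_two]
    _ = keepProb (a + 1) + (2⁻¹ + 2⁻¹ * dropProb a) := by rw [keepProb_succ]; ring

theorem allFalse_cons (a : ℕ) (b : Bool) (ω : List Bool) :
    allFalse (a + 1) (b :: ω) = (!b && allFalse a ω) := by
  cases b <;> simp [allFalse]

theorem expect_allFalse {a M : ℕ} (h : a ≤ M) (x y : ℝ≥0∞) :
    expect (draws fair M) (fun ω => if allFalse a ω then x else y) =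
      keepProb a * x + dropProb a * y := by
  induction a generalizing M with
  | zero => simp [allFalse, expect_const, keepProb, dropProb]
  | succ a ih =>
    obtain ⟨M, rfl⟩ := Nat.exists_eq_add_of_le' h
    rw [← Nat.add_assoc, draws, expect_bind, expect_fair, expect_map, expect_map]
    simp only [allFalse_cons, Bool.not_true, Bool.false_and, Bool.false_eq_true, if_false,
      Bool.not_false, Bool.true_and, expect_const]
    rw [ih (Nat.le_add_left a M), dropProb_succ, keepProb_succ]
    ring

theorem allFalse_take {a M : ℕ} (h : a ≤ M) (ω : List Bool) :
    allFalse a (ω.take M) = allFalse a ω := by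
  rw [allFalse, allFalse, List.take_take, min_eq_left h]

theorem keptExamples_map {D D' : Type} (a M : ℕ) (f : D → D') (us : List D) (ω : List Bool) :
    keptExamples a M (us.map f) ω = (keptExamples a M us ω).map f := by
  induction us generalizing ω with
  | nil => rfl
  | cons u us ih =>
    simp only [List.map_cons, keptExamples, ih]
    split <;> rfl

theorem keptExamples_take {D : Type} {a M n : ℕ} (h : a ≤ M) (us : List D) (ω : List Bool)
    (hn : us.length * M ≤ n) : keptExamples a M us (ω.take n) = keptExamples a M us ω := by
  induction us generalizing ω n with
  | nil => rfl
  | cons u us ih =>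
    rw [List.length_cons, add_one_mul] at hn
    simp only [keptExamples, allFalse_take (show a ≤ n by omega), List.drop_take]
    rw [ih _ (by omega)]

theorem keptExamples_sublist {D : Type} (a M : ℕ) (us : List D) (ω : List Bool) :
    (keptExamples a M us ω).Sublist us := by
  induction us generalizing ω with
  | nil => exact .slnil
  | cons u us ih =>
    rw [keptExamples]
    split
    · exact (ih _).cons_cons u
    · exact (ih _).cons u

/-- The distribution of the list of examples that are kept. -/
noncomputable def keptLaw {D : Type} (a M : ℕ) (us : List D) : PMF (List D) :=
  (draws fair (us.length * M)).map (keptExamples a M us)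

section KeptLaw

variable {D : Type} {a M : ℕ}

theorem expect_keptLaw_nil (g : List D → ℝ≥0∞) : expect (keptLaw a M []) g = g [] := by
  simp only [keptLaw, expect_map, keptExamples, expect_const]

theorem expect_keptLaw_cons (h : a ≤ M) (u : D) (us : List D) (g : List D → ℝ≥0∞) :
    expect (keptLaw a M (u :: us)) g =
      keepProb a * expect (keptLaw a M us) (fun l => g (u :: l)) +
        dropProb a * expect (keptLaw a M us) g := by
  have hsplit := expect_draws_add fair M (us.length * M) fun ω η =>
    g (if allFalse a ω then u :: keptExamples a M us η else keptExamples a M us η)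
  simp only [allFalse_take h] at hsplit
  rw [keptLaw, expect_map, List.length_cons, add_one_mul, add_comm, ← expect_allFalse h]
  refine hsplit.trans (expect_congr fun ω _ => ?_)
  rw [keptLaw, expect_map, expect_map]
  split <;> rfl

theorem expect_keptLaw_append (h : a ≤ M) (us vs : List D) (g : List D → ℝ≥0∞) :
    expect (keptLaw a M (us ++ vs)) g =
      expect (keptLaw a M us) fun l => expect (keptLaw a M vs) fun l' => g (l ++ l') := by
  induction us generalizing g with
  | nil => rw [expect_keptLaw_nil]; rfl
  | cons u us ih =>
    rw [List.cons_append, expect_keptLaw_cons h, expect_keptLaw_cons h, ih, ih]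
    rfl

theorem expect_keptLaw_append_cons (h : a ≤ M) (us vs : List D) (u : D) (g : List D → ℝ≥0∞) :
    expect (keptLaw a M (us ++ u :: vs)) g =
      keepProb a * (expect (keptLaw a M us) fun l =>
        expect (keptLaw a M vs) fun l' => g (l ++ u :: l')) +
      dropProb a * expect (keptLaw a M (us ++ vs)) g := by
  simp only [expect_keptLaw_append h, expect_keptLaw_cons h, expect_add, expect_mul_left]

theorem dropProb_mul_expect_keptLaw_le (h : a ≤ M) (us vs : List D) (u : D)
    (g : List D → ℝ≥0∞) :
    dropProb a * expect (keptLaw a M (us ++ vs)) g ≤ expect (keptLaw a M (us ++ u :: vs)) g :=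
  (expect_keptLaw_append_cons h us vs u g).ge.trans' le_add_self

theorem expect_keptLaw_append_cons_le (h : a ≤ M) (us vs : List D) (u : D) {g : List D → ℝ≥0∞}
    (hg : ∀ l l', g (l ++ u :: l') ≤ 2 * g (l ++ l')) :
    expect (keptLaw a M (us ++ u :: vs)) g ≤
      (1 + keepProb a) * expect (keptLaw a M (us ++ vs)) g := by
  have hkept : (expect (keptLaw a M us) fun l => expect (keptLaw a M vs) fun l' =>
      g (l ++ u :: l')) ≤ 2 * expect (keptLaw a M (us ++ vs)) g := by
    rw [expect_keptLaw_append h, ← expect_mul_left]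
    refine expect_mono fun l _ => ?_
    rw [← expect_mul_left]
    exact expect_mono fun l' _ => hg l l'
  calc expect (keptLaw a M (us ++ u :: vs)) g
      ≤ keepProb a * (2 * expect (keptLaw a M (us ++ vs)) g) +
          dropProb a * expect (keptLaw a M (us ++ vs)) g := by
        rw [expect_keptLaw_append_cons h]
        gcongr
    _ = ((keepProb a + dropProb a) + keepProb a) * expect (keptLaw a M (us ++ vs)) g := by ring
    _ = (1 + keepProb a) * expect (keptLaw a M (us ++ vs)) g := by rw [keepProb_add_dropProb]

end KeptLaw

/-! ### The distribution of the solution -/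

theorem expect_draws_fair (d : ℕ) (g : List Bool → ℝ≥0∞) :
    expect (draws fair d) g = ∑ v : PARITY.domain d, (2 ^ d)⁻¹ * g v.1 := by
  have hofFn (v : List.Vector Bool d) : List.ofFn (Equiv.vectorEquivFin Bool d v) = v.1 := by
    rw [← List.Vector.toList_ofFn]
    exact congrArg Subtype.val ((Equiv.vectorEquivFin Bool d).symm_apply_apply v)
  rw [← coins_eq_draws, coins, expect_map, expect_fintype,
    ← Equiv.sum_comp (Equiv.vectorEquivFin Bool d)]
  refine Finset.sum_congr rfl fun v _ => ?_
  rw [hofFn]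
  simp

/-- The outcome of an attempt to solve the equations `us`, where the coin `b` can make it fail and
`v` is the starting vector of the elimination. -/
def attempt (d : ℕ) (us : List (List Bool × Bool)) (b : Bool) (v : List Bool) :
    Option (List Bool) :=
  if !b && (solve d v us).1 then some (solve d v us).2.2 else none

section Laws

variable {d : ℕ}

/-- The distribution of the outcome of an attempt. -/
noncomputable def solveLaw (us : List (PARITY.Example d)) : PMF (Option (List Bool)) :=
  fair.bind fun b => (draws fair d).map (attempt d (us.map exampleString) b)

theorem apply_eq_expect {D : Type*} [DecidableEq D] (μ : PMF D) (a : D) :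
    μ a = expect μ fun b => if b = a then 1 else 0 := by
  rw [expect, tsum_eq_single a fun b hb => by rw [if_neg hb, mul_zero], if_pos rfl, mul_one]

theorem expect_solveLaw (us : List (PARITY.Example d)) (g : Option (List Bool) → ℝ≥0∞) :
    expect (solveLaw us) g = 2⁻¹ * g none + 2⁻¹ * ∑ v : PARITY.domain d, (2 ^ d)⁻¹ *
      g (if (solveState v us).1 then some (solveState v us).2.2 else none) := by
  rw [solveLaw, expect_bind, expect_fair, expect_map, expect_map]
  simp only [attempt, Bool.not_true, Bool.false_and, Bool.false_eq_true, if_false, expect_const,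
    Bool.not_false, Bool.true_and]
  rw [expect_draws_fair]
  rfl

theorem solveLaw_apply_some (us : List (PARITY.Example d)) (s : List Bool) :
    solveLaw us (some s) = 2⁻¹ * ((2 ^ d)⁻¹ * solveCount us s) := by
  classical
  rw [apply_eq_expect, expect_solveLaw, solveCount, Set.ncard_eq_toFinset_card',
    Set.toFinset_ofPred, Finset.card_filter, Nat.cast_sum, ← Finset.mul_sum]
  simp only [reduceCtorEq, if_false, mul_zero, zero_add]
  congr 2
  refine Finset.sum_congr rfl fun v _ => ?_
  cases (solveState v us).1 <;> simp

theorem inv_two_le_solveLaw_apply_none (us : List (PARITY.Example d)) :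
    2⁻¹ ≤ solveLaw us none := by
  classical
  rw [apply_eq_expect, expect_solveLaw, if_pos rfl, mul_one]
  exact le_self_add

theorem solveLaw_apply_none_of_nonempty {us : List (PARITY.Example d)}
    (h : (solutions us).Nonempty) : solveLaw us none = 2⁻¹ := by
  classical
  rw [apply_eq_expect, expect_solveLaw, if_pos rfl, mul_one]
  simp [(solverInvariant_solveState _ us).consistent h]

/-- An inconsistent system changes the probability of failure from `1/2` to `1`, which is why the
learner fails with probability `1/2` in any case. -/
theorem solveLaw_append_cons_apply_le (us vs : List (PARITY.Example d)) (u : PARITY.Example d)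
    (o : Option (List Bool)) : solveLaw (us ++ u :: vs) o ≤ 2 * solveLaw (us ++ vs) o := by
  cases o with
  | none =>
    calc solveLaw (us ++ u :: vs) none ≤ 1 := PMF.coe_le_one _ _
      _ = 2 * 2⁻¹ := (ENNReal.mul_inv_cancel two_ne_zero ENNReal.ofNat_ne_top).symm
      _ ≤ 2 * solveLaw (us ++ vs) none := by gcongr; exact inv_two_le_solveLaw_apply_none _
  | some s =>
    have hcount : (solveCount (us ++ u :: vs) s : ℝ≥0∞) ≤ 2 * solveCount (us ++ vs) s := by
      exact_mod_cast solveCount_append_cons_le us vs u s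
    rw [solveLaw_apply_some, solveLaw_apply_some]
    calc 2⁻¹ * ((2 ^ d)⁻¹ * (solveCount (us ++ u :: vs) s : ℝ≥0∞))
        ≤ 2⁻¹ * ((2 ^ d)⁻¹ * (2 * solveCount (us ++ vs) s)) := by gcongr
      _ = 2 * (2⁻¹ * ((2 ^ d)⁻¹ * solveCount (us ++ vs) s)) := by ring

/-! ### The distribution of the result -/

/-- The outcome for one chunk. -/
def chunkOutcome (d a M m : ℕ) (db : List (List Bool × Bool)) (ω : List Bool) :
    Option (List Bool) :=
  attempt d (keptExamples a M (db.take m) (ω.drop (1 + d))) (ω.headD true) ((ω.drop 1).take d)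

theorem chunkOutcome_eq_ite (d a M m : ℕ) (db : List (List Bool × Bool)) (ω : List Bool) :
    chunkOutcome d a M m db ω =
      if (chunkResult d a M m db ω).1 then some (chunkResult d a M m db ω).2 else none :=
  rfl

theorem headD_take_one_add {D : Type*} (l : List D) (n : ℕ) (x : D) :
    (l.take (1 + n)).headD x = l.headD x := by
  rw [Nat.add_comm]
  cases l <;> rfl

theorem chunkOutcome_take {a M m : ℕ} (h : a ≤ M) (db : List (List Bool × Bool))
    (ω : List Bool) :
    chunkOutcome d a M m (db.take m) (ω.take (1 + d + m * M)) = chunkOutcome d a M m db ω := by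
  have hkept : keptExamples a M (db.take m) ((ω.take (1 + d + m * M)).drop (1 + d)) =
      keptExamples a M (db.take m) (ω.drop (1 + d)) := by
    rw [List.drop_take, keptExamples_take h]
    rw [Nat.add_sub_cancel_left]
    exact Nat.mul_le_mul_right M (List.length_take_le m db)
  have hstart : ((ω.take (1 + d + m * M)).drop 1).take d = (ω.drop 1).take d := by
    rw [List.drop_take, List.take_take, min_eq_left (by omega)]
  rw [chunkOutcome, chunkOutcome, List.take_take, min_self, hkept, hstart, Nat.add_assoc,
    headD_take_one_add]

/-- The distribution of the outcome for a chunk. -/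
noncomputable def chunkLaw (a M : ℕ) (us : List (PARITY.Example d)) :
    PMF (Option (List Bool)) :=
  (keptLaw a M us).bind solveLaw

theorem map_chunkOutcome (a M : ℕ) (us : List (PARITY.Example d)) :
    (draws fair (1 + d + us.length * M)).map
      (chunkOutcome d a M us.length (us.map exampleString)) = chunkLaw a M us := by
  have houtcome : chunkOutcome d a M us.length (us.map exampleString) = fun ω =>
      attempt d ((keptExamples a M us (ω.drop (1 + d))).map exampleString)
        (((ω.take (1 + d)).take 1).headD true) ((ω.take (1 + d)).drop 1) := by
    funext ω
    rw [chunkOutcome, List.take_of_length_le (by rw [List.length_map]), keptExamples_map,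
      List.drop_take, Nat.add_sub_cancel_left, List.take_take, min_eq_left (Nat.le_add_right 1 d),
      headD_take_one_add ω 0]
  rw [houtcome, map_draws_add fair (1 + d) (us.length * M) fun ω η =>
      attempt d ((keptExamples a M us η).map exampleString) ((ω.take 1).headD true) (ω.drop 1),
    bind_draws_add fair 1 d fun ω v => (draws fair (us.length * M)).map fun η =>
      attempt d ((keptExamples a M us η).map exampleString) (ω.headD true) v]
  simp only [draws, PMF.bind_bind, PMF.pure_map, PMF.pure_bind, List.headD_cons]
  rw [chunkLaw, keptLaw, PMF.bind_map]
  simp only [Function.comp_def, solveLaw]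
  rw [PMF.bind_comm (draws fair (us.length * M))]
  congr 1
  funext b
  exact PMF.bind_comm (draws fair d) (draws fair (us.length * M)) fun v η =>
    PMF.pure (attempt d ((keptExamples a M us η).map exampleString) b v)

theorem map_chunkOutcome_take (a M : ℕ) {m : ℕ} {us : List (PARITY.Example d)}
    (hm : m ≤ us.length) :
    (draws fair (1 + d + m * M)).map
      (chunkOutcome d a M m ((us.map exampleString).take m)) = chunkLaw a M (us.take m) := by
  have hmap := map_chunkOutcome a M (us.take m)
  rwa [List.length_take_of_le hm, List.map_take] at hmap

/-- The distribution of the first successful outcome among `K` chunks. -/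
noncomputable def resultLaw (a M m : ℕ) : ℕ → List (PARITY.Example d) → PMF (List Bool)
  | 0, _ => PMF.pure []
  | K + 1, us => (chunkLaw a M (us.take m)).bind fun o =>
      o.elim (resultLaw a M m K (us.drop m)) PMF.pure

theorem firstResult_zero (d a M m c : ℕ) (db : List (List Bool × Bool)) (ω : List Bool) :
    firstResult d a M m c 0 db ω = (chunkOutcome d a M m db ω).elim [] id := by
  simp only [firstResult, chunkOutcome_eq_ite, Function.iterate_zero_apply]
  by_cases h : (chunkResult d a M m db ω).1 = true <;> simp [h]

theorem firstResult_succ (d a M m c K : ℕ) (db : List (List Bool × Bool)) (ω : List Bool) :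
    firstResult d a M m c (K + 1) db ω =
      (chunkOutcome d a M m db ω).elim (firstResult d a M m c K (db.drop m) (ω.drop c)) id := by
  rw [chunkOutcome_eq_ite]
  by_cases h : (chunkResult d a M m db ω).1 = true
  · have hfix : nextChunk d a M m c (db, ω) = (db, ω) := if_pos h
    simp [firstResult, Function.iterate_fixed hfix, h]
  · have hnext : nextChunk d a M m c (db, ω) = (db.drop m, ω.drop c) := if_neg h
    rw [firstResult, Function.iterate_succ_apply, hnext, if_neg h]
    rfl

theorem map_firstResult {a M m : ℕ} (h : a ≤ M) (K : ℕ) (us : List (PARITY.Example d))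
    (hus : us.length = (K + 1) * m) :
    (draws fair ((K + 1) * (1 + d + m * M))).map
      (firstResult d a M m (1 + d + m * M) K (us.map exampleString)) =
        resultLaw a M m (K + 1) us := by
  have hm : m ≤ us.length := hus ▸ Nat.le_mul_of_pos_left m K.succ_pos
  rw [resultLaw, ← map_chunkOutcome_take a M hm, PMF.bind_map]
  induction K generalizing us with
  | zero =>
    rw [zero_add, one_mul]
    refine pmf_bind_congr _ fun ω hω => ?_
    rw [Function.comp_apply, Function.comp_apply, firstResult_zero, ← chunkOutcome_take h,
      List.take_of_length_le (length_of_mem_support_draws hω).le]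
    cases chunkOutcome d a M m (List.take m (us.map exampleString)) ω <;> rfl
  | succ K ih =>
    have hdrop : (us.drop m).length = (K + 1) * m := by
      rw [List.length_drop, hus, Nat.add_one_mul (K + 1) m, Nat.add_sub_cancel]
    have hresult : firstResult d a M m (1 + d + m * M) (K + 1) (us.map exampleString) = fun ω =>
        (chunkOutcome d a M m ((us.map exampleString).take m) (ω.take (1 + d + m * M))).elim
          (firstResult d a M m (1 + d + m * M) K ((us.map exampleString).drop m)
            (ω.drop (1 + d + m * M))) id :=
      funext fun ω => by rw [firstResult_succ, chunkOutcome_take h]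
    rw [hresult, Nat.add_one_mul (K + 1), Nat.add_comm ((K + 1) * _),
      map_draws_add fair _ _ fun ω η =>
        (chunkOutcome d a M m ((us.map exampleString).take m) ω).elim
          (firstResult d a M m (1 + d + m * M) K ((us.map exampleString).drop m) η) id]
    congr 1
    funext ω
    rw [Function.comp_apply]
    cases chunkOutcome d a M m (List.take m (us.map exampleString)) ω with
    | none =>
      have hm' : m ≤ (us.drop m).length := hdrop ▸ Nat.le_mul_of_pos_left m K.succ_pos
      simp only [Option.elim_none]
      rw [← List.map_drop, ih (us.drop m) hdrop hm', resultLaw, ← map_chunkOutcome_take a M hm',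
        PMF.bind_map]
    | some s => exact PMF.map_const _ _

/-! ### Privacy of the learner -/

theorem chunkLaw_apply_le {a M : ℕ} (h : a ≤ M) {ρ : ℝ≥0∞}
    (hρ : 1 + keepProb a ≤ ρ * dropProb a) (us vs : List (PARITY.Example d))
    (u u' : PARITY.Example d) (o : Option (List Bool)) :
    chunkLaw a M (us ++ u :: vs) o ≤ ρ * chunkLaw a M (us ++ u' :: vs) o := by
  have happly (l : List (PARITY.Example d)) :
      chunkLaw a M l o = expect (keptLaw a M l) (solveLaw · o) := PMF.bind_apply _ _ _
  rw [happly, happly]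
  calc expect (keptLaw a M (us ++ u :: vs)) (solveLaw · o)
      ≤ (1 + keepProb a) * expect (keptLaw a M (us ++ vs)) (solveLaw · o) :=
        expect_keptLaw_append_cons_le h us vs u fun l l' => solveLaw_append_cons_apply_le l l' u o
    _ ≤ (ρ * dropProb a) * expect (keptLaw a M (us ++ vs)) (solveLaw · o) := by gcongr
    _ = ρ * (dropProb a * expect (keptLaw a M (us ++ vs)) (solveLaw · o)) := by ring
    _ ≤ ρ * expect (keptLaw a M (us ++ u' :: vs)) (solveLaw · o) := by
        gcongr
        exact dropProb_mul_expect_keptLaw_le h us vs u' _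

/-- The chunks are disjoint, hence an example affects only one of them, and the privacy loss does
not depend on their number. -/
theorem resultLaw_apply_le {a M m : ℕ} (h : a ≤ M) {ρ : ℝ≥0∞} (hρ₁ : 1 ≤ ρ)
    (hρ : 1 + keepProb a ≤ ρ * dropProb a) (K : ℕ) (us vs : List (PARITY.Example d))
    (u u' : PARITY.Example d) (s : List Bool) :
    resultLaw a M m K (us ++ u :: vs) s ≤ ρ * resultLaw a M m K (us ++ u' :: vs) s := by
  induction K generalizing us with
  | zero => exact le_mul_of_one_le_left' hρ₁
  | succ K ih =>
    rw [resultLaw, resultLaw]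
    rcases lt_or_ge us.length m with hm | hm
    · obtain ⟨k, rfl⟩ := Nat.exists_eq_add_of_lt hm
      simp only [Nat.add_assoc, List.take_length_add_append, List.drop_length_add_append,
        List.take_succ_cons, List.drop_succ_cons]
      rw [← mul_one ρ]
      exact bind_apply_le_mul_bind_apply (fun o => chunkLaw_apply_le h hρ _ _ _ _ o)
        fun o _ => by rw [one_mul]
    · rw [List.take_append_of_le_length hm, List.take_append_of_le_length hm,
        List.drop_append_of_le_length hm, List.drop_append_of_le_length hm, ← one_mul ρ]
      refine bind_apply_le_mul_bind_apply (fun o => by rw [one_mul]) fun o _ => ?_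
      cases o with
      | none => exact ih _
      | some t => exact le_mul_of_one_le_left' hρ₁

end Laws

theorem ofFn_eq_take_append_cons_drop {D : Type*} {n : ℕ} {z z' : Fin n → D} {i : Fin n}
    (h : ∀ j, j ≠ i → z j = z' j) :
    List.ofFn z' = (List.ofFn z).take i ++ z' i :: (List.ofFn z).drop (i + 1) := by
  have hset : List.ofFn z' = (List.ofFn z).set i (z' i) := by
    refine List.ext_getElem (by simp) fun j hj _ => ?_
    rw [List.getElem_set, List.getElem_ofFn]
    split
    case isTrue hij => exact congrArg z' (Fin.ext hij.symm)
    case isFalse hij =>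
      rw [List.getElem_ofFn]
      exact (h _ fun hji => hij (congrArg Fin.val hji).symm).symm
  rw [hset, List.set_eq_take_append_cons_drop, if_pos (by simp)]

/-! ### Accuracy of the learner -/

section Accuracy

variable {d : ℕ}

theorem indicator_solutions_cons (r : PARITY.domain d) (u : PARITY.Example d)
    (us : List (PARITY.Example d)) :
    {S | r ∈ solutions S}.indicator (1 : List (PARITY.Example d) → ℝ≥0∞) (u :: us) =
      {u | parityBit u.1.1 r.1 = u.2}.indicator 1 u * {S | r ∈ solutions S}.indicator 1 us := by
  by_cases hu : parityBit u.1.1 r.1 = u.2 <;> by_cases hus : r ∈ solutions us <;>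
    simp [mem_solutions_cons, hu, hus]

theorem expect_toOuterMeasure_keptLaw_solutions {a M : ℕ} (h : a ≤ M) (ν : PMF (PARITY.Example d))
    (r : PARITY.domain d) (n : ℕ) :
    expect (draws ν n) (fun us => (keptLaw a M us).toOuterMeasure {S | r ∈ solutions S}) =
      (keepProb a * ν.toOuterMeasure {u | parityBit u.1.1 r.1 = u.2} + dropProb a) ^ n := by
  simp only [toOuterMeasure_eq_expect]
  induction n with
  | zero =>
    rw [draws, expect_pure, expect_keptLaw_nil, pow_zero]
    exact Set.indicator_of_mem (show r ∈ solutions [] from List.forall_mem_nil _) 1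
  | succ n ih =>
    have hcons (u : PARITY.Example d) (us : List (PARITY.Example d)) :
        expect (keptLaw a M (u :: us)) ({S | r ∈ solutions S}.indicator 1) =
          (keepProb a * {u | parityBit u.1.1 r.1 = u.2}.indicator 1 u + dropProb a) *
            expect (keptLaw a M us) ({S | r ∈ solutions S}.indicator 1) := by
      simp only [expect_keptLaw_cons h, indicator_solutions_cons, expect_mul_left]
      ring
    simp only [draws, expect_bind, expect_map, hcons, expect_mul_left, ih]
    rw [expect_mul_right, expect_add, expect_mul_left, expect_const, pow_succ']

open Classical in
theorem toOuterMeasure_solveLaw_le (us : List (PARITY.Example d)) (bad : Set (List Bool)) :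
    (solveLaw us).toOuterMeasure (some '' bad) ≤
      ∑ r : PARITY.domain d with r.1 ∈ bad, {S | r ∈ solutions S}.indicator 1 us := by
  by_cases h : ∃ r ∈ solutions us, r.1 ∈ bad
  · obtain ⟨r, hr, hbad⟩ := h
    calc (solveLaw us).toOuterMeasure (some '' bad)
        ≤ {S | r ∈ solutions S}.indicator 1 us := by
          rw [Set.indicator_of_mem (show us ∈ {S | r ∈ solutions S} from hr)]
          exact toOuterMeasure_le_one _ _
      _ ≤ _ := Finset.single_le_sum (f := fun r => {S | r ∈ solutions S}.indicator 1 us)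
          (fun _ _ => zero_le) (Finset.mem_filter.2 ⟨Finset.mem_univ r, hbad⟩)
  · suffices hzero : (solveLaw us).toOuterMeasure (some '' bad) = 0 from hzero.trans_le zero_le
    have hgood (v : PARITY.domain d) :
        (if (solveState v us).1 then some (solveState v us).2.2 else none) ∉ some '' bad := by
      rintro ⟨s, hs, hsome⟩
      split at hsome
      case isTrue hv =>
        obtain ⟨r, hr, hrv⟩ := (solverInvariant_solveState v us).mem_solutions hv
        exact h ⟨r, hr, by rwa [hrv, ← Option.some.inj hsome]⟩
      case isFalse => exact Option.some_ne_none s hsome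
    simp [toOuterMeasure_eq_expect, expect_solveLaw, Set.indicator_of_notMem (hgood _)]

open Classical in
theorem toOuterMeasure_chunkLaw_le (a M : ℕ) (us : List (PARITY.Example d))
    (bad : Set (List Bool)) :
    (chunkLaw a M us).toOuterMeasure (some '' bad) ≤
      ∑ r : PARITY.domain d with r.1 ∈ bad,
        (keptLaw a M us).toOuterMeasure {S | r ∈ solutions S} := by
  simp only [toOuterMeasure_eq_expect (keptLaw a M us)]
  rw [← expect_sum, chunkLaw, toOuterMeasure_bind]
  exact expect_mono fun S _ => toOuterMeasure_solveLaw_le S bad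

theorem expect_toOuterMeasure_chunkLaw_le {a M m : ℕ} (h : a ≤ M) {ν : PMF (PARITY.Example d)}
    {bad : Set (List Bool)} {η : ℝ≥0∞}
    (hη : ∀ r : PARITY.domain d, r.1 ∈ bad →
      (keepProb a * ν.toOuterMeasure {u | parityBit u.1.1 r.1 = u.2} + dropProb a) ^ m ≤ η) :
    expect (draws ν m) (fun us => (chunkLaw a M us).toOuterMeasure (some '' bad)) ≤
      2 ^ d * η := by
  classical
  calc expect (draws ν m) (fun us => (chunkLaw a M us).toOuterMeasure (some '' bad))
      ≤ expect (draws ν m) fun us => ∑ r : PARITY.domain d with r.1 ∈ bad,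
          (keptLaw a M us).toOuterMeasure {S | r ∈ solutions S} :=
        expect_mono fun us _ => toOuterMeasure_chunkLaw_le a M us bad
    _ ≤ ∑ r : PARITY.domain d with r.1 ∈ bad, η := by
        rw [expect_sum]
        refine Finset.sum_le_sum fun r hr => ?_
        rw [expect_toOuterMeasure_keptLaw_solutions h]
        exact hη r (Finset.mem_filter.1 hr).2
    _ ≤ ∑ _r : PARITY.domain d, η := Finset.sum_le_sum_of_subset (Finset.filter_subset _ _)
    _ = 2 ^ d * η := by
        rw [Finset.sum_const, Finset.card_univ, card_domain, nsmul_eq_mul]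
        norm_cast

theorem chunkLaw_apply_none_le (a M : ℕ) {us : List (PARITY.Example d)}
    (h : (solutions us).Nonempty) : chunkLaw a M us none ≤ 2⁻¹ := by
  obtain ⟨r, hr⟩ := h
  calc chunkLaw a M us none = expect (keptLaw a M us) (solveLaw · none) := PMF.bind_apply _ _ _
    _ ≤ expect (keptLaw a M us) fun _ => 2⁻¹ := by
        refine expect_mono fun S hS => ?_
        obtain ⟨ω, -, rfl⟩ := (PMF.mem_support_map_iff _ _ _).1 hS
        exact (solveLaw_apply_none_of_nonempty
          ⟨r, fun u hu => hr u ((keptExamples_sublist a M us ω).subset hu)⟩).le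
    _ = 2⁻¹ := expect_const _ _

theorem mem_support_of_mem_support_draws {D : Type*} {μ : PMF D} {n : ℕ} {l : List D}
    (hl : l ∈ (draws μ n).support) {u : D} (hu : u ∈ l) : u ∈ μ.support := by
  induction n generalizing l with
  | zero =>
    rw [draws, PMF.support_pure, Set.mem_singleton_iff] at hl
    exact absurd (hl ▸ hu) List.not_mem_nil
  | succ n ih =>
    simp only [draws, PMF.mem_support_bind_iff, PMF.mem_support_map_iff] at hl
    obtain ⟨x, hx, l', hl', rfl⟩ := hl
    rcases List.mem_cons.1 hu with rfl | hu
    · exact hx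
    · exact ih hl' hu

theorem toOuterMeasure_resultLaw_succ (a M m K : ℕ) (us : List (PARITY.Example d))
    (bad : Set (List Bool)) :
    (resultLaw a M m (K + 1) us).toOuterMeasure bad =
      (chunkLaw a M (us.take m)).toOuterMeasure (some '' bad) +
        chunkLaw a M (us.take m) none * (resultLaw a M m K (us.drop m)).toOuterMeasure bad := by
  classical
  rw [resultLaw, toOuterMeasure_bind, toOuterMeasure_eq_expect _ (some '' bad),
    apply_eq_expect _ none, ← expect_mul_right, ← expect_add]
  refine expect_congr fun o _ => ?_
  cases o with
  | none => simp
  | some s => by_cases hs : s ∈ bad <;> simp [PMF.toOuterMeasure_pure_apply, hs]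

/-- Each chunk is reached with at most half the probability of the one before, hence the failure
bounds of the chunks add up to at most twice the first one. -/
theorem expect_toOuterMeasure_resultLaw_le {a M m : ℕ} (h : a ≤ M) {ν : PMF (PARITY.Example d)}
    {r₀ : PARITY.domain d} (hr₀ : ∀ u ∈ ν.support, parityBit u.1.1 r₀.1 = u.2)
    {bad : Set (List Bool)} {η : ℝ≥0∞}
    (hη : ∀ r : PARITY.domain d, r.1 ∈ bad →
      (keepProb a * ν.toOuterMeasure {u | parityBit u.1.1 r.1 = u.2} + dropProb a) ^ m ≤ η)
    (K : ℕ) :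
    expect (draws ν (K * m)) (fun us => (resultLaw a M m K us).toOuterMeasure bad) ≤
      2 * (2 ^ d * η) + 2⁻¹ ^ K := by
  induction K with
  | zero =>
    refine (expect_mono fun us _ => toOuterMeasure_le_one _ _).trans ?_
    rw [expect_const, pow_zero]
    exact le_add_self
  | succ K ih =>
    rw [Nat.add_one_mul, Nat.add_comm]
    simp only [toOuterMeasure_resultLaw_succ]
    rw [expect_draws_add ν m (K * m) fun us vs =>
      (chunkLaw a M us).toOuterMeasure (some '' bad) +
        chunkLaw a M us none * (resultLaw a M m K vs).toOuterMeasure bad]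
    simp only [expect_add, expect_const, expect_mul_left]
    calc _ ≤ 2 ^ d * η + expect (draws ν m) fun _ => 2⁻¹ * (2 * (2 ^ d * η) + 2⁻¹ ^ K) := by
          refine add_le_add (expect_toOuterMeasure_chunkLaw_le h hη) (expect_mono fun us hus => ?_)
          gcongr
          exact chunkLaw_apply_none_le a M
            ⟨r₀, fun u hu => hr₀ u (mem_support_of_mem_support_draws hus hu)⟩
      _ = 2 ^ d * η + ((2⁻¹ * 2) * (2 ^ d * η) + 2⁻¹ ^ (K + 1)) := by
          rw [expect_const, pow_succ']
          ring
      _ = 2 * (2 ^ d * η) + 2⁻¹ ^ (K + 1) := by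
          rw [ENNReal.inv_mul_cancel two_ne_zero ENNReal.ofNat_ne_top]
          ring

theorem toOuterMeasure_parityBit_eq_add_err (μ : PMF (PARITY.domain d)) (c : PARITY.domain d → Bool)
    (r : PARITY.domain d) :
    (μ.map fun x => (x, c x)).toOuterMeasure {u | parityBit u.1.1 r.1 = u.2} +
      err μ c (parityFun r.1) = 1 := by
  rw [PMF.toOuterMeasure_map_apply, err, ← toOuterMeasure_add_compl μ {x | parityFun r.1 x = c x}]
  congr 2
  ext x
  rw [Set.mem_preimage, Set.mem_ofPred_eq, Set.mem_ofPred_eq, parityFun, parityBit_comm]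

end Accuracy

/-! ### The parameters of the learner -/

theorem inv_two_pow_eq_ofReal (n : ℕ) : (2⁻¹ : ℝ≥0∞) ^ n = ENNReal.ofReal ((1 / 2) ^ n) := by
  rw [ENNReal.ofReal_pow one_half_pos.le, one_div, ENNReal.ofReal_inv_of_pos two_pos,
    ENNReal.ofReal_ofNat]

theorem dropProb_eq_ofReal (a : ℕ) : dropProb a = ENNReal.ofReal (1 - (1 / 2) ^ a) := by
  rw [dropProb, keepProb, inv_two_pow_eq_ofReal, ENNReal.ofReal_sub _ (by positivity),
    ENNReal.ofReal_one]

theorem half_pow_mul_two_pow (a : ℕ) : (1 / 2 : ℝ) ^ a * 2 ^ a = 1 := by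
  rw [← mul_pow, one_div_mul_cancel two_ne_zero, one_pow]

theorem one_add_keepProb_le {ε : ℝ} (hε : 0 < ε) {e a : ℕ} (he : 1 / ε ≤ e)
    (ha : 4 * e < 2 ^ a) : 1 + keepProb a ≤ ENNReal.ofReal (Real.exp ε) * dropProb a := by
  set p : ℝ := (1 / 2) ^ a with hp
  have hp0 : 0 < p := by positivity
  have he1 : (1 : ℝ) ≤ e := by
    exact_mod_cast (Nat.cast_pos (α := ℝ)).1 ((one_div_pos.2 hε).trans_le he)
  have hpe : p * (4 * e) ≤ 1 := by
    rw [← half_pow_mul_two_pow a]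
    gcongr
    exact_mod_cast ha.le
  have hp4 : p ≤ 1 / 4 := by nlinarith
  have hpε : 4 * p ≤ ε := by
    have : 1 ≤ e * ε := (div_le_iff₀ hε).1 he
    nlinarith
  rw [keepProb, inv_two_pow_eq_ofReal, dropProb_eq_ofReal, ← ENNReal.ofReal_one, ← hp,
    ← ENNReal.ofReal_add zero_le_one hp0.le, ← ENNReal.ofReal_mul (Real.exp_nonneg _)]
  refine ENNReal.ofReal_le_ofReal ?_
  calc 1 + p ≤ (4 * p + 1) * (1 - p) := by nlinarith
    _ ≤ (ε + 1) * (1 - p) := by gcongr; linarith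
    _ ≤ Real.exp ε * (1 - p) := by
        gcongr
        · linarith
        · exact Real.add_one_le_exp ε

theorem one_sub_pow_le_half_pow {q : ℝ} (hq : q ≤ 1) {n L : ℕ} (h : L ≤ n * q) :
    (1 - q) ^ n ≤ (1 / 2) ^ L := by
  have hexp : Real.exp (-1) ≤ 1 / 2 := by
    rw [Real.exp_neg, one_div]
    gcongr
    linarith [Real.add_one_le_exp 1]
  calc (1 - q) ^ n ≤ Real.exp (-q) ^ n := by
        gcongr
        exact Real.one_sub_le_exp_neg q
    _ = Real.exp (-(n * q)) := by rw [← Real.exp_nat_mul, mul_neg]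
    _ ≤ Real.exp (-L) := by gcongr
    _ = Real.exp (-1) ^ L := by rw [← Real.exp_nat_mul, mul_neg_one]
    _ ≤ (1 / 2) ^ L := by gcongr

theorem keepProb_mul_add_dropProb_pow_le {α : ℝ} (hα : 0 < α) (hα1 : α ≤ 1) {a e A L : ℕ}
    (hA : 1 / α ≤ A) (ha : 2 ^ a ≤ 8 * e) {x : ℝ≥0∞} (hx : x ≤ ENNReal.ofReal (1 - α)) :
    (keepProb a * x + dropProb a) ^ (L * A * (8 * e)) ≤ 2⁻¹ ^ L := by
  set p : ℝ := (1 / 2) ^ a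
  have hp0 : 0 < p := by positivity
  have hp1 : p ≤ 1 := pow_le_one₀ one_half_pos.le one_half_lt_one.le
  have hpα : p * α ≤ 1 := mul_le_one₀ hp1 hα.le hα1
  have hbase : keepProb a * x + dropProb a ≤ ENNReal.ofReal (1 - p * α) := by
    calc keepProb a * x + dropProb a
        ≤ ENNReal.ofReal p * ENNReal.ofReal (1 - α) + ENNReal.ofReal (1 - p) := by
          rw [keepProb, inv_two_pow_eq_ofReal, dropProb_eq_ofReal]
          gcongr
      _ = ENNReal.ofReal (1 - p * α) := by
          rw [← ENNReal.ofReal_mul hp0.le, ← ENNReal.ofReal_add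
            (mul_nonneg hp0.le (sub_nonneg.2 hα1)) (sub_nonneg.2 hp1)]
          ring_nf
  have hAα : 1 ≤ A * α := (div_le_iff₀ hα).1 hA
  have hpe : 1 ≤ p * (8 * e) := by
    rw [← half_pow_mul_two_pow a]
    gcongr
    exact_mod_cast ha
  refine (pow_le_pow_left₀ zero_le hbase _).trans ?_
  rw [inv_two_pow_eq_ofReal, ← ENNReal.ofReal_pow (sub_nonneg.2 hpα)]
  refine ENNReal.ofReal_le_ofReal (one_sub_pow_le_half_pow hpα ?_)
  calc (L : ℝ) = L * (1 * 1) := by ring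
    _ ≤ L * ((A * α) * (p * (8 * e))) := by gcongr
    _ = (L * A * (8 * e) : ℕ) * (p * α) := by push_cast; ring

theorem half_pow_ceil_logb_le {β : ℝ} (hβ : 0 < β) :
    (1 / 2 : ℝ) ^ ⌈Real.logb 2 (1 / β)⌉₊ ≤ β := by
  have hlog : Real.logb 2 (1 / β) ≤ ⌈Real.logb 2 (1 / β)⌉₊ := Nat.le_ceil _
  rw [Real.logb_le_iff_le_rpow one_lt_two (one_div_pos.2 hβ), Real.rpow_natCast] at hlog
  rw [one_div_pow]
  exact (one_div_le (by positivity) hβ).2 hlog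

theorem two_mul_two_pow_mul_add_inv_two_pow (d b : ℕ) :
    2 * (2 ^ d * 2⁻¹ ^ (d + b + 2)) + 2⁻¹ ^ (b + 1) = (2⁻¹ : ℝ≥0∞) ^ b := by
  have htwo : (2 : ℝ≥0∞) * 2⁻¹ = 1 := ENNReal.mul_inv_cancel two_ne_zero ENNReal.ofNat_ne_top
  calc 2 * (2 ^ d * 2⁻¹ ^ (d + b + 2)) + 2⁻¹ ^ (b + 1)
      = (2 * 2⁻¹) ^ d * (2 * 2⁻¹) * (2⁻¹ ^ b * 2⁻¹) + 2⁻¹ ^ b * (2⁻¹ : ℝ≥0∞) := by ring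
    _ = 2⁻¹ ^ b * (2⁻¹ + 2⁻¹) := by rw [htwo]; ring
    _ = 2⁻¹ ^ b := by rw [ENNReal.inv_two_add_inv_two, mul_one]

theorem two_pow_size_le {n : ℕ} (hn : n ≠ 0) : 2 ^ n.size ≤ 2 * n := by
  obtain ⟨k, hk⟩ := Nat.exists_eq_succ_of_ne_zero (Nat.size_pos.2 (Nat.pos_of_ne_zero hn)).ne'
  rw [hk, pow_succ']
  exact Nat.mul_le_mul_left 2 (Nat.lt_size.1 (hk ▸ k.lt_succ_self))

theorem size_four_mul_le (e : ℕ) : Nat.size (4 * e) ≤ 8 * e :=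
  (size_le_self _).trans (by omega)

/-! ### Parities are efficiently privately learnable -/

theorem differentiallyPrivate_resultLaw {d : ℕ} {ε : ℝ} (hε : 0 < ε) {e : ℕ} (he : 1 / ε ≤ e)
    (m K n : ℕ) :
    DifferentiallyPrivate ε fun z : Fin n → PARITY.Example d =>
      resultLaw (Nat.size (4 * e)) (8 * e) m K (List.ofFn z) :=
  differentiallyPrivate_of_apply_le fun z z' i hz o => by
    rw [ofFn_eq_take_append_cons_drop (i := i) fun j _ => rfl, ofFn_eq_take_append_cons_drop hz]
    exact resultLaw_apply_le (size_four_mul_le e)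
      (ENNReal.one_le_ofReal.2 (Real.one_le_exp hε.le))
      (one_add_keepProb_le hε he (Nat.lt_size_self _)) K _ _ _ _ o

theorem pacSucceeds_resultLaw {d n e A b : ℕ} {α β : ℝ} (hα : 0 < α) (hα1 : α ≤ 1) (he : e ≠ 0)
    (hA : 1 / α ≤ A) (hb : (1 / 2) ^ b ≤ β) (hn : n = (b + 1) * ((d + b + 2) * A * (8 * e)))
    (r₀ : PARITY.domain d) (μ : PMF (PARITY.domain d)) :
    PACSucceeds
      (fun z : Fin n → PARITY.Example d =>
        (resultLaw (Nat.size (4 * e)) (8 * e) ((d + b + 2) * A * (8 * e)) (b + 1)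
          (List.ofFn z)).map (hypothesis PARITY d fun x => parityBit x.1 x.2))
      (parityFun r₀.1) μ α β := by
  set bad : Set (List Bool) := hypothesis PARITY d (fun x => parityBit x.1 x.2) ⁻¹'
    {h | err μ (parityFun r₀.1) h ≤ ENNReal.ofReal α}ᶜ
  have hconsistent : ∀ u ∈ (μ.map fun x => (x, parityFun r₀.1 x)).support,
      parityBit u.1.1 r₀.1 = u.2 := by
    intro u hu
    obtain ⟨x, -, rfl⟩ := (PMF.mem_support_map_iff _ _ _).1 hu
    exact parityBit_comm _ _
  have hsurvival : ∀ r : PARITY.domain d, r.1 ∈ bad →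
      (keepProb (Nat.size (4 * e)) * (μ.map fun x => (x, parityFun r₀.1 x)).toOuterMeasure
        {u | parityBit u.1.1 r.1 = u.2} + dropProb (Nat.size (4 * e))) ^
          ((d + b + 2) * A * (8 * e)) ≤ 2⁻¹ ^ (d + b + 2) := by
    intro r hr
    refine keepProb_mul_add_dropProb_pow_le hα hα1 hA
      ((two_pow_size_le (by omega)).trans (by omega)) ?_
    rw [ENNReal.ofReal_sub _ hα.le, ENNReal.ofReal_one,
      ← toOuterMeasure_parityBit_eq_add_err μ (parityFun r₀.1) r]
    refine ENNReal.le_sub_of_add_le_right ENNReal.ofReal_ne_top ?_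
    gcongr
    exact (not_le.1 (Set.notMem_of_mem_compl hr)).le
  rw [pacSucceeds_iff_expect_compl_le]
  simp only [PMF.toOuterMeasure_map_apply]
  rw [← expect_map _ List.ofFn fun us => (resultLaw (Nat.size (4 * e)) (8 * e)
    ((d + b + 2) * A * (8 * e)) (b + 1) us).toOuterMeasure bad, map_ofFn_iid, hn]
  refine (expect_toOuterMeasure_resultLaw_le (size_four_mul_le e) hconsistent hsurvival _).trans ?_
  rw [two_mul_two_pow_mul_add_inv_two_pow, inv_two_pow_eq_ofReal]
  exact ENNReal.ofReal_le_ofReal hb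

theorem randomizedAlg_parityLearner {d n : ℕ} (e A b : ℕ)
    (hn : n = (b + 1) * ((d + b + 2) * A * (8 * e))) :
    (randomizedAlg parityLearner (d, e, A, b)
      (bound ((MvPolynomial.X 3 + 1) * chunkCoins) (d, e, A, b)) :
        (Fin n → PARITY.Example d) → PMF (List Bool)) = fun z =>
      resultLaw (Nat.size (4 * e)) (8 * e) ((d + b + 2) * A * (8 * e)) (b + 1) (List.ofFn z) := by
  have hexamples : bound chunkExamples (d, e, A, b) = (d + b + 2) * A * (8 * e) := by
    simp [bound, chunkExamples]
  have hcoins : bound chunkCoins (d, e, A, b) =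
      1 + d + (d + b + 2) * A * (8 * e) * (8 * e) := by
    rw [← hexamples]
    simp [bound, chunkCoins]
  have hallCoins : bound ((MvPolynomial.X 3 + 1) * chunkCoins) (d, e, A, b) =
      (b + 1) * (1 + d + (d + b + 2) * A * (8 * e) * (8 * e)) := by
    rw [← hcoins]
    simp [bound]
  funext z
  rw [← map_firstResult (size_four_mul_le e) b (List.ofFn z) (by rw [List.length_ofFn, hn]),
    randomizedAlg, hallCoins, coins_eq_draws, List.map_ofFn]
  simp only [parityLearner, hcoins, hexamples]
  rfl

theorem efficientlyPrivatelyPACLearnable_parity : EfficientlyPrivatelyPACLearnable PARITY := by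
  refine ⟨(MvPolynomial.X 3 + 1) * chunkExamples, (MvPolynomial.X 3 + 1) * chunkCoins,
    parityLearner, fun x => parityBit x.1 x.2, PolyTime.parityLearner,
    PolyTime.id.fst.parityBit PolyTime.id.snd, fun d ε hε α hα β hβ => ?_⟩
  dsimp only [params]
  have hn : bound ((MvPolynomial.X 3 + 1) * chunkExamples)
      (d, ⌈1 / ε⌉₊, ⌈1 / α⌉₊, ⌈Real.logb 2 (1 / β)⌉₊) = (⌈Real.logb 2 (1 / β)⌉₊ + 1) *
        ((d + ⌈Real.logb 2 (1 / β)⌉₊ + 2) * ⌈1 / α⌉₊ * (8 * ⌈1 / ε⌉₊)) := by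
    simp [bound, chunkExamples]
  rw [randomizedAlg_parityLearner _ _ _ hn]
  refine ⟨differentiallyPrivate_resultLaw hε (Nat.le_ceil _) _ _ _, fun c hc μ => ?_⟩
  obtain ⟨r₀, rfl⟩ := mem_concepts_iff.1 hc
  exact pacSucceeds_resultLaw hα.1 (by linarith [hα.2]) (Nat.ceil_pos.2 (one_div_pos.2 hε)).ne'
    (Nat.le_ceil _) (half_pow_ceil_logb_le hβ.1) hn r₀ μ

end PrivateLearning

theorem mainTheorem7 :
    ({C : PrivateLearning.ConceptClass | PrivateLearning.LocallyLearnable C} ⊂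
      {C : PrivateLearning.ConceptClass | PrivateLearning.PrivatelyPACLearnable C}) ∧
    ({C : PrivateLearning.ConceptClass | PrivateLearning.EfficientlyLocallyLearnable C} ⊂
      {C : PrivateLearning.ConceptClass | PrivateLearning.EfficientlyPrivatelyPACLearnable C}) ∧
    (PrivateLearning.PrivatelyPACLearnable PrivateLearning.PARITY ∧
      ¬ PrivateLearning.LocallyLearnable PrivateLearning.PARITY) ∧
    (PrivateLearning.EfficientlyPrivatelyPACLearnable PrivateLearning.PARITY ∧
      ¬ PrivateLearning.EfficientlyLocallyLearnable PrivateLearning.PARITY) := by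
  have hefficient := PrivateLearning.efficientlyPrivatelyPACLearnable_parity
  have hprivate := hefficient.privatelyPACLearnable
  have hlocal := PrivateLearning.not_locallyLearnable_parity
  have hefficientlocal := PrivateLearning.not_efficientlyLocallyLearnable_parity
  exact ⟨⟨fun _ h => h.privatelyPACLearnable, fun h => hlocal (h hprivate)⟩,
    ⟨fun _ h => h.efficientlyPrivatelyPACLearnable, fun h => hefficientlocal (h hefficient)⟩,
    ⟨hprivate, hlocal⟩, hefficient, hefficientlocal⟩
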